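/- **Setting.** Let $(E,\mathcal E)$ be a measurable space. Let $(R_x)_{x\in E}$ be a random replacement kernel: each $R_x$ is a random finite signed measure on $E$ which a.s. is positive on $E\setminus\{x\}$, and $x\mapsto\mathcal L(R_x)$ is a probability kernel from $E$ to the space of finite signed measures (with the $\sigma$-field generated by the maps $\mu\mapsto\mu(A)$, $A\in\mathcal E$). Let $\mathfrak m_0$ be a non-random finite positive measure on $E$. For a (signed) measure $\mu$ and a function $f$ write $\mu f=\int f\,d\mu$, and let $|\mu|$ be the total variation measure. Fix a measurable $W:E\to[1,\infty)$ and a real $q>2$, put $V=W^q$, and write $\mathbf R_x=\mathbb E R_x$. Assume: * (B) $R_x(E)=1$ a.s., for every $x\in E$; * (H) there are $\vartheta\in(0,1)$, $C_1\ge0$, $C_2>0$ with $\mathbf R_xV\le\vartheta V(x)+C_1$ and $\mathbb E[(|R_x|W)^q]\le C_2V(x)$ for all $x\in E$, and $\mathfrak m_0V<\infty$; * (N) $\nu$ is a probability measure on $E$ with $\nu\mathbf R=\nu$ and $\nu V<\infty$. Let $(\mathfrak m_n)_{n\ge0}$ be the measure-valued Pólya process: $\mathfrak m_{n+1}=\mathfrak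 m_n+R^{(n+1)}_{Y_{n+1}}$, where, given the history up to time $n$, $Y_{n+1}$ has law $\tilde{\mathfrak m}_n=\mathfrak m_n/\mathfrak m_n(E)$ and, given this history and $Y_{n+1}=y$, $R^{(n+1)}_{Y_{n+1}}$ has the law of $R_y$. The urn is assumed tenable: a.s. every $\mathfrak m_n$ is a non-zero positive measure. Let $B(W)$ be the complex Banach space of measurable $g:E\to\mathbb C$ with $\|g\|=\sup_x|g(x)|/W(x)<\infty$, and let $\mathbf R$ be the bounded operator $(\mathbf Rf)(x)=\mathbf R_xf$ on $B(W)$. Let $D\subseteq B(W)$ be a closed $\mathbf R$-invariant subspace with $1\in D$, and let $\mathbf R_D$ be the restriction of $\mathbf R$ to $D$. A bounded operator $T$ is called spectrally-large quasi-compact if $1$ is an isolated point of $\sigma(T)$ whose spectral projection has rank $1$, and $\operatorname{Re}\lambda<1$ for all $\lambda\in\sigma(T)\setminus\{1\}$. Assume that $\mathbf R_D$ is spectrally-large quasi-compact and that $$\sigma(\mathbf R_D)=\{1,\lambda_1,\dots,\lambda_p\}\cup\Delta,$$ where $p\ge1$, the $\lambda_j$ are distinct, $\operatorname{Re}\lambda_1=\dots=\operatorname{Re}\lambda_p\in(\tfrac12,1)$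 and $\sup\operatorname{Re}\Delta<\operatorname{Re}\lambda_1$. Let $\Pi_{\lambda_j}$ be the spectral projection of $\mathbf R_D$ at $\lambda_j$, let $\kappa_j=\min\{k\ge1:(\mathbf R_D-\lambda_j)^k=0\text{ on }\Pi_{\lambda_j}D\}$, and assume that $\kappa=\max_j\kappa_j<\infty$. Let $f\in D$, let $\Lambda_1,\dots,\Lambda_p\in L^2$ be complex random variables such that $$\frac{n^{1-\operatorname{Re}\lambda_1}}{(\log n)^{\kappa-1}}\bigl(\tilde{\mathfrak m}_nf-\nu f\bigr)-\sum_{j=1}^pn^{\mathrm i\operatorname{Im}\lambda_j}\Lambda_j\to0\qquad\text{a.s. and in }L^2,$$ and let $g_j=(\mathbf R-\lambda_j)^{\kappa-1}\Pi_{\lambda_j}f$. **Theorem.** For each $j=1,\dots,p$ the following are equivalent: 1. $\Lambda_j$ is a.s. non-random; 2. $\Lambda_j=\mathbb E\Lambda_j$ a.s.; 3. $\Lambda_j=0$ a.s.; 4. $\mathfrak m_ng_j=0$ a.s., for every $n\ge0$; 5. $\mathfrak m_0g_j=0$, and $R^{(n+1)}_{Y_{n+1}}g_j=0$ a.s. for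 every $n\ge0$; 6. $\mathfrak m_n|g_j|=0$ a.s., for every $n\ge0$; 7. $\mathfrak m_n\{x:|g_j(x)|\ne0\}=0$ a.s., for every $n\ge0$; 8. $\mathfrak m_0\mathbf R^n|g_j|=0$ for every $n\ge0$. Moreover, if $\mathbf R$ is spectrally-large quasi-compact on $B(W)$, then 1–8 imply that $g_j=0$ $\nu$-a.e. Conversely, if $\mathfrak m_0$ is absolutely continuous with respect to $\nu$, then $g_j=0$ $\nu$-a.e. implies 1–8. -/

import Mathlib

open MeasureTheory Filter Topology
open scoped ENNReal NNReal

noncomputable section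

namespace MVPP

/-! ### Signed measures as a measurable space -/

/-- The σ-field on the space of finite signed measures generated by the evaluations `μ ↦ μ A`,
`A` measurable. -/
instance instMeasurableSpaceSignedMeasure {E : Type*} [MeasurableSpace E] :
    MeasurableSpace (SignedMeasure E) :=
  ⨆ (A : Set E) (_ : MeasurableSet A), (borel ℝ).comap (fun μ : SignedMeasure E => μ A)

theorem measurable_eval {E : Type*} [MeasurableSpace E] {A : Set E} (hA : MeasurableSet A) :
    Measurable (fun μ : SignedMeasure E => μ A) := by
  have h : (borel ℝ).comap (fun μ : SignedMeasure E => μ A) ≤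
      instMeasurableSpaceSignedMeasure (E := E) :=
    le_iSup₂_of_le (f := fun (A : Set E) (_ : MeasurableSet A) =>
      (borel ℝ).comap (fun μ : SignedMeasure E => μ A)) A hA le_rfl
  rw [BorelSpace.measurable_eq (α := ℝ)]
  exact (comap_measurable _).mono h le_rfl

/-! ### The weighted space `B(W)` -/

/-- A measurable weight function `W : E → [1, ∞)`. -/
structure Weight (E : Type*) [MeasurableSpace E] where
  toFun : E → ℝ
  measurable' : Measurable toFun
  one_le' : ∀ x, 1 ≤ toFun x

instance {E : Type*} [MeasurableSpace E] : CoeFun (Weight E) (fun _ => E → ℝ) := ⟨Weight.toFun⟩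

theorem Weight.pos {E : Type*} [MeasurableSpace E] (W : Weight E) (x : E) : 0 < W x :=
  lt_of_lt_of_le one_pos (W.one_le' x)

/-- The measurable functions `g : E → ℂ` with `|g| ≤ C W` for some constant `C`, as a linear
subspace of all functions. -/
def boundedFunctions {E : Type*} [MeasurableSpace E] (W : Weight E) : Submodule ℂ (E → ℂ) where
  carrier := {g | Measurable g ∧ ∃ C : ℝ, ∀ x, ‖g x‖ ≤ C * W x}
  zero_mem' := ⟨measurable_zero, 0, fun x => by simp⟩
  add_mem' := by
    rintro f g ⟨hf, C, hC⟩ ⟨hg, C', hC'⟩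
    refine ⟨hf.add hg, C + C', fun x => ?_⟩
    calc ‖f x + g x‖ ≤ ‖f x‖ + ‖g x‖ := norm_add_le _ _
      _ ≤ C * W x + C' * W x := add_le_add (hC x) (hC' x)
      _ = (C + C') * W x := by ring
  smul_mem' := by
    rintro c f ⟨hf, C, hC⟩
    refine ⟨hf.const_smul c, ‖c‖ * C, fun x => ?_⟩
    calc ‖c • f x‖ = ‖c‖ * ‖f x‖ := norm_smul _ _
      _ ≤ ‖c‖ * (C * W x) := mul_le_mul_of_nonneg_left (hC x) (norm_nonneg _)
      _ = ‖c‖ * C * W x := by ring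

/-- The space `B(W)` of measurable functions with `sup |g| / W < ∞`; its norm is defined below. -/
def BW {E : Type*} [MeasurableSpace E] (W : Weight E) : Type _ := boundedFunctions W

namespace BW

variable {E : Type*} [MeasurableSpace E] {W : Weight E}

instance : AddCommGroup (BW W) := inferInstanceAs (AddCommGroup (boundedFunctions W))
instance : Module ℂ (BW W) := inferInstanceAs (Module ℂ (boundedFunctions W))

instance : CoeFun (BW W) (fun _ => E → ℂ) := ⟨fun f => f.1⟩

/-- Build an element of `B(W)`. -/
def mk (g : E → ℂ) (hg : Measurable g) (hb : ∃ C : ℝ, ∀ x, ‖g x‖ ≤ C * W x) : BW W := ⟨g, hg, hb⟩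

@[simp] theorem mk_apply (g : E → ℂ) (hg hb) (x : E) : (mk g hg hb : BW W) x = g x := rfl
@[simp] theorem zero_apply (x : E) : (0 : BW W) x = 0 := rfl
@[simp] theorem add_apply (f g : BW W) (x : E) : (f + g) x = f x + g x := rfl
@[simp] theorem smul_apply (c : ℂ) (f : BW W) (x : E) : (c • f) x = c * f x := rfl

@[ext] theorem ext {f g : BW W} (h : ∀ x, f x = g x) : f = g := Subtype.ext (funext h)

theorem measurable (f : BW W) : Measurable (f : E → ℂ) := f.2.1

/-- The norm `sup_x |g x| / W x`. -/
instance : Norm (BW W) := ⟨fun f => ⨆ x, ‖f x‖ / W x⟩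

theorem norm_def (f : BW W) : ‖f‖ = ⨆ x, ‖f x‖ / W x := rfl

theorem bddAbove (f : BW W) : BddAbove (Set.range fun x => ‖f x‖ / W x) := by
  obtain ⟨C, hC⟩ := f.2.2
  refine ⟨C, ?_⟩
  rintro _ ⟨x, rfl⟩
  exact (div_le_iff₀ (W.pos x)).2 (hC x)

theorem norm_apply_le (f : BW W) (x : E) : ‖f x‖ ≤ ‖f‖ * W x :=
  (div_le_iff₀ (W.pos x)).1 (le_ciSup f.bddAbove x)

theorem norm_nonneg' (f : BW W) : 0 ≤ ‖f‖ :=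
  Real.iSup_nonneg fun x => div_nonneg (norm_nonneg _) (W.pos x).le

theorem norm_le_of (f : BW W) {C : ℝ} (hC : 0 ≤ C) (h : ∀ x, ‖f x‖ ≤ C * W x) : ‖f‖ ≤ C :=
  Real.iSup_le (fun x => (div_le_iff₀ (W.pos x)).2 (h x)) hC

theorem normedCore : NormedSpace.Core ℂ (BW W) where
  norm_nonneg := norm_nonneg'
  norm_smul c f := by
    rw [norm_def, norm_def, Real.mul_iSup_of_nonneg (norm_nonneg c)]
    congr 1
    ext x
    rw [smul_apply, norm_mul, mul_div_assoc]
  norm_triangle f g := by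
    refine norm_le_of _ (add_nonneg f.norm_nonneg' g.norm_nonneg') fun x => ?_
    calc ‖f x + g x‖ ≤ ‖f x‖ + ‖g x‖ := norm_add_le _ _
      _ ≤ ‖f‖ * W x + ‖g‖ * W x := add_le_add (f.norm_apply_le x) (g.norm_apply_le x)
      _ = (‖f‖ + ‖g‖) * W x := by ring
  norm_eq_zero_iff f := by
    constructor
    · intro h
      ext x
      have := f.norm_apply_le x
      rw [h, zero_mul] at this
      exact norm_le_zero_iff.1 this
    · rintro rfl
      exact le_antisymm (norm_le_of _ le_rfl fun x => by simp) (norm_nonneg' _)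

instance : NormedAddCommGroup (BW W) := NormedAddCommGroup.ofCore normedCore
instance : NormedSpace ℂ (BW W) := NormedSpace.ofCore normedCore

instance : CompleteSpace (BW W) := by
  refine Metric.complete_of_cauchySeq_tendsto fun u hu => ?_
  have hpt : ∀ x, CauchySeq fun n => u n x := by
    intro x
    rw [Metric.cauchySeq_iff] at hu ⊢
    intro ε hε
    obtain ⟨N, hN⟩ := hu (ε / W x) (div_pos hε (W.pos x))
    refine ⟨N, fun m hm n hn => ?_⟩
    have h := hN m hm n hn
    rw [dist_eq_norm] at h ⊢
    exact lt_of_le_of_lt ((u m - u n).norm_apply_le x) ((lt_div_iff₀ (W.pos x)).1 h)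
  choose g hg using fun x => cauchySeq_tendsto_of_complete (hpt x)
  have hbound : ∀ ε > 0, ∃ N, ∀ n ≥ N, ∀ x, ‖u n x - g x‖ ≤ ε * W x := by
    intro ε hε
    obtain ⟨N, hN⟩ := Metric.cauchySeq_iff.1 hu ε hε
    refine ⟨N, fun n hn x => ?_⟩
    have hlim : Tendsto (fun m => ‖u n x - u m x‖) atTop (𝓝 ‖u n x - g x‖) :=
      (tendsto_const_nhds.sub (hg x)).norm
    refine le_of_tendsto hlim (eventually_atTop.2 ⟨N, fun m hm => ?_⟩)
    refine ((u n - u m).norm_apply_le x).trans ?_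
    have h := hN n hn m hm
    rw [dist_eq_norm] at h
    exact mul_le_mul_of_nonneg_right h.le (W.pos x).le
  have hgm : Measurable g := measurable_of_tendsto_metrizable (fun n => (u n).measurable)
    (tendsto_pi_nhds.2 hg)
  obtain ⟨N, hN⟩ := hbound 1 one_pos
  let G : BW W := mk g hgm ⟨‖u N‖ + 1, fun x => by
    have h1 := hN N le_rfl x
    have h2 := (u N).norm_apply_le x
    have h3 : ‖g x‖ ≤ ‖u N x‖ + ‖u N x - g x‖ := by
      have := norm_sub_le (u N x) (u N x - g x)
      rwa [sub_sub_cancel] at this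
    linarith⟩
  refine ⟨G, Metric.tendsto_atTop.2 fun ε hε => ?_⟩
  obtain ⟨N, hN⟩ := hbound (ε / 2) (half_pos hε)
  refine ⟨N, fun n hn => ?_⟩
  rw [dist_eq_norm]
  exact lt_of_le_of_lt (norm_le_of _ (half_pos hε).le fun x => hN n hn x) (half_lt_self hε)

variable (W) in
/-- The constant function `1` as an element of `B(W)`. -/
def one : BW W := mk (fun _ => 1) measurable_const ⟨1, fun x => by simpa using W.one_le' x⟩

/-- The function `|g|` as an element of `B(W)`. -/
def abs (g : BW W) : BW W :=
  mk (fun x => ((‖g x‖ : ℝ) : ℂ)) (Complex.measurable_ofReal.comp g.measurable.norm)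
    ⟨‖g‖, fun x => by simpa using g.norm_apply_le x⟩

end BW

/-! ### Replacement kernels and their mean -/

section Mean

variable {E Ω' : Type*} [MeasurableSpace E] [MeasurableSpace Ω']

/-- The expectation of a random signed measure `ρ`, i.e. the signed measure `A ↦ 𝔼[ρ(A)]`, which
is well defined when `𝔼‖ρ‖ < ∞` (`‖ρ‖` the total variation). Junk value `0` otherwise. -/
def meanMeasure (ρ : Ω' → SignedMeasure E) (PR : Measure Ω') : SignedMeasure E := by
  classical
  exact
  if h : Measurable ρ ∧ ∫⁻ ω, (ρ ω).variation Set.univ ∂PR < ∞ then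
    { measureOf' := fun A => if MeasurableSet A then ∫ ω, ρ ω A ∂PR else 0
      empty' := by simp
      not_measurable' := fun A hA => if_neg hA
      m_iUnion' := by
        intro A hA hdisj
        have hm : ∀ i, Measurable fun ω => ρ ω (A i) := fun i => (measurable_eval (hA i)).comp h.1
        have hle : ∫⁻ ω, ∑' i, ‖ρ ω (A i)‖ₑ ∂PR ≤ ∫⁻ ω, (ρ ω).variation Set.univ ∂PR := by
          refine lintegral_mono fun ω => ?_
          calc ∑' i, ‖ρ ω (A i)‖ₑ ≤ ∑' i, (ρ ω).variation (A i) :=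
                ENNReal.tsum_le_tsum fun i => (ρ ω).enorm_measure_le_variation _
            _ = (ρ ω).variation (⋃ i, A i) := (measure_iUnion hdisj hA).symm
            _ ≤ _ := measure_mono (Set.subset_univ _)
        rw [lintegral_tsum fun i => (hm i).enorm.aemeasurable] at hle
        have hfin : ∑' i, ∫⁻ ω, ‖ρ ω (A i)‖ₑ ∂PR ≠ ∞ := (hle.trans_lt h.2).ne
        simp only [hA, if_true, MeasurableSet.iUnion hA]
        have := hasSum_integral_of_summable_integral_norm (μ := PR)
          (F := fun i ω => ρ ω (A i))
          (fun i => ⟨(hm i).aestronglyMeasurable,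
            lt_of_le_of_lt (ENNReal.le_tsum i) hfin.lt_top⟩)
          (by
            have := ENNReal.summable_toReal hfin
            refine this.congr fun i => ?_
            rw [integral_norm_eq_lintegral_enorm (hm i).aestronglyMeasurable])
        have hU : ∀ ω, ∑' i, ρ ω (A i) = ρ ω (⋃ i, A i) := fun ω =>
          ((ρ ω).m_iUnion hA hdisj).tsum_eq
        simpa only [hU] using this }
  else 0

theorem meanMeasure_apply {ρ : Ω' → SignedMeasure E} {PR : Measure Ω'} (hρ : Measurable ρ)
    (hfin : ∫⁻ ω, (ρ ω).variation Set.univ ∂PR < ∞) {A : Set E} (hA : MeasurableSet A) :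
    meanMeasure ρ PR A = ∫ ω, ρ ω A ∂PR := by
  rw [meanMeasure, dif_pos ⟨hρ, hfin⟩]
  exact if_pos hA

/-- `|𝔼 ρ| w ≤ 𝔼[|ρ| w]` for `w ≥ 0`. -/
theorem lintegral_meanMeasure_le {ρ : Ω' → SignedMeasure E} {PR : Measure Ω'} (hρ : Measurable ρ)
    (hfin : ∫⁻ ω, (ρ ω).variation Set.univ ∂PR < ∞) (w : E → ℝ≥0∞) :
    ∫⁻ x, w x ∂(meanMeasure ρ PR).variation ≤ ∫⁻ ω, ∫⁻ x, w x ∂(ρ ω).variation ∂PR := by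
  set s := meanMeasure ρ PR with hs
  have key : ∀ A, MeasurableSet A → ‖s A‖ₑ ≤ ∫⁻ ω, ‖ρ ω A‖ₑ ∂PR := fun A hA => by
    rw [hs, meanMeasure_apply hρ hfin hA]
    exact enorm_integral_le_lintegral_enorm _
  obtain ⟨P, hP, hpos, hneg⟩ := s.exists_compl_positive_negative
  have hvar : ∀ A, MeasurableSet A → s.variation A ≤ ‖s (A ∩ P)‖ₑ + ‖s (A ∩ Pᶜ)‖ₑ := by
    intro A hA
    have hb : ∀ B, MeasurableSet B → B ⊆ A → ‖s B‖ₑ ≤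
        (s.toMeasureOfZeroLE P hP hpos + s.toMeasureOfLEZero Pᶜ hP.compl hneg) B := by
      intro B hB _
      rw [Measure.add_apply, s.toMeasureOfZeroLE_apply hpos hP hB,
        s.toMeasureOfLEZero_apply hneg hP.compl hB]
      have e1 : s B = s (P ∩ B) + s (Pᶜ ∩ B) := by
        rw [← VectorMeasure.of_union _ (hP.inter hB) (hP.compl.inter hB),
          ← Set.union_inter_distrib_right, Set.union_compl_self, Set.univ_inter]
        exact (disjoint_compl_right.inf_left _).inf_right _
      rw [e1]
      refine (enorm_add_le _ _).trans (add_le_add (le_of_eq ?_) (le_of_eq ?_))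
      · have h0 : 0 ≤ s (P ∩ B) := s.nonneg_of_zero_le_restrict
          (s.zero_le_restrict_subset hP Set.inter_subset_left hpos)
        rw [Real.enorm_of_nonneg h0, ENNReal.ofReal_eq_coe_nnreal h0]
      · have h0 : s (Pᶜ ∩ B) ≤ 0 := s.nonpos_of_restrict_le_zero
          (s.restrict_le_zero_subset hP.compl Set.inter_subset_left hneg)
        rw [← enorm_neg, Real.enorm_of_nonneg (neg_nonneg.2 h0),
          ENNReal.ofReal_eq_coe_nnreal (neg_nonneg.2 h0)]
    have hle := VectorMeasure.variation_apply_le_of_forall_enorm_le hA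
      (fun B hB hBA => hb B hB hBA)
    refine hle.trans (le_of_eq ?_)
    rw [Measure.add_apply, s.toMeasureOfZeroLE_apply hpos hP hA,
      s.toMeasureOfLEZero_apply hneg hP.compl hA]
    have h0 : 0 ≤ s (P ∩ A) := s.nonneg_of_zero_le_restrict
      (s.zero_le_restrict_subset hP Set.inter_subset_left hpos)
    have h1 : s (Pᶜ ∩ A) ≤ 0 := s.nonpos_of_restrict_le_zero
      (s.restrict_le_zero_subset hP.compl Set.inter_subset_left hneg)
    rw [Set.inter_comm A P, Set.inter_comm A Pᶜ, Real.enorm_of_nonneg h0,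
      ENNReal.ofReal_eq_coe_nnreal h0, ← enorm_neg (s (Pᶜ ∩ A)),
      Real.enorm_of_nonneg (neg_nonneg.2 h1), ENNReal.ofReal_eq_coe_nnreal (neg_nonneg.2 h1)]
  have hvar2 : ∀ A, MeasurableSet A →
      s.variation A ≤ ∫⁻ ω, (‖ρ ω (A ∩ P)‖ₑ + ‖ρ ω (A ∩ Pᶜ)‖ₑ) ∂PR := by
    intro A hA
    have hm1 : Measurable fun ω => ‖ρ ω (A ∩ P)‖ₑ :=
      ((measurable_eval (hA.inter hP)).comp hρ).enorm
    rw [lintegral_add_left hm1]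
    exact (hvar A hA).trans (add_le_add (key _ (hA.inter hP)) (key _ (hA.inter hP.compl)))
  have hm : ∀ A, MeasurableSet A →
      Measurable fun ω => ‖ρ ω (A ∩ P)‖ₑ + ‖ρ ω (A ∩ Pᶜ)‖ₑ := fun A hA =>
    ((measurable_eval (hA.inter hP)).comp hρ).enorm.add
      ((measurable_eval (hA.inter hP.compl)).comp hρ).enorm
  rw [lintegral]
  refine iSup₂_le fun φ hφ => ?_
  calc φ.lintegral s.variation
      ≤ ∑ c ∈ φ.range, c * ∫⁻ ω, (‖ρ ω (φ ⁻¹' {c} ∩ P)‖ₑ + ‖ρ ω (φ ⁻¹' {c} ∩ Pᶜ)‖ₑ) ∂PR :=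
        Finset.sum_le_sum fun c _ => mul_le_mul_right (hvar2 _ (φ.measurableSet_fiber c)) _
    _ = ∫⁻ ω, ∑ c ∈ φ.range,
          c * (‖ρ ω (φ ⁻¹' {c} ∩ P)‖ₑ + ‖ρ ω (φ ⁻¹' {c} ∩ Pᶜ)‖ₑ) ∂PR := by
        rw [lintegral_finsetSum' _ fun c _ =>
          ((hm _ (φ.measurableSet_fiber c)).const_mul c).aemeasurable]
        exact Finset.sum_congr rfl fun c _ =>
          (lintegral_const_mul c (hm _ (φ.measurableSet_fiber c))).symm
    _ ≤ ∫⁻ ω, φ.lintegral (ρ ω).variation ∂PR := by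
        refine lintegral_mono fun ω => Finset.sum_le_sum fun c _ => ?_
        refine mul_le_mul_right ?_ _
        rw [← measure_inter_add_sdiff (μ := (ρ ω).variation) (φ ⁻¹' {c}) hP]
        exact add_le_add ((ρ ω).enorm_measure_le_variation _)
          ((ρ ω).enorm_measure_le_variation _)
    _ ≤ ∫⁻ ω, ∫⁻ x, w x ∂(ρ ω).variation ∂PR := by
        refine lintegral_mono fun ω => ?_
        rw [← SimpleFunc.lintegral_eq_lintegral]
        exact lintegral_mono hφ

end Mean

/-- Bochner integration against a signed measure, in terms of its Jordan decomposition. -/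
theorem integral_eq_jordan {E : Type*} [MeasurableSpace E] (μ : SignedMeasure E) {f : E → ℂ}
    (hf : Integrable f μ.variation) :
    ∫ᵛ x, f x ∂<•μ = ∫ x, f x ∂μ.toJordanDecomposition.posPart -
      ∫ x, f x ∂μ.toJordanDecomposition.negPart := by
  rw [← SignedMeasure.totalVariation_eq_variation, SignedMeasure.totalVariation] at hf
  conv_lhs => rw [← μ.toSignedMeasure_toJordanDecomposition, JordanDecomposition.toSignedMeasure]
  rw [VectorMeasure.integral_sub_vectorMeasure, VectorMeasure.integral_toSignedMeasure,
    VectorMeasure.integral_toSignedMeasure]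
  · rw [VectorMeasure.Integrable, Measure.variation_toSignedMeasure]
    exact hf.left_of_add_measure
  · rw [VectorMeasure.Integrable, Measure.variation_toSignedMeasure]
    exact hf.right_of_add_measure

theorem integral_const_mul {E : Type*} [MeasurableSpace E] (μ : SignedMeasure E) {f : E → ℂ}
    (hf : Integrable f μ.variation) (c : ℂ) :
    ∫ᵛ x, c * f x ∂<•μ = c * ∫ᵛ x, f x ∂<•μ := by
  rw [integral_eq_jordan μ hf, integral_eq_jordan μ (hf.const_mul c),
    MeasureTheory.integral_const_mul, MeasureTheory.integral_const_mul, mul_sub]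

/-- If `x ↦ β x` is a signed kernel, then `x ↦ (β x) f` is measurable. -/
theorem measurable_integral_signedKernel {E : Type*} [MeasurableSpace E] {β : E → SignedMeasure E}
    (hβ : ∀ A, MeasurableSet A → Measurable fun x => β x A) {f : E → ℂ} (hf : Measurable f)
    (hint : ∀ x, Integrable f (β x).variation) : Measurable fun x => ∫ᵛ y, f y ∂<•(β x) := by
  have hsimple : ∀ φ : SimpleFunc E ℂ, (∀ x, Integrable φ (β x).variation) ∧
      Measurable fun x => ∫ᵛ y, φ y ∂<•(β x) := by
    have hfinv : ∀ x, IsFiniteMeasure (β x).variation := fun x => by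
      rw [← SignedMeasure.totalVariation_eq_variation]; infer_instance
    intro φ
    have hi : ∀ (ψ : SimpleFunc E ℂ) (x : E), Integrable ψ (β x).variation := fun ψ x => by
      have := hfinv x
      exact ψ.integrable_of_isFiniteMeasure
    refine ⟨hi φ, ?_⟩
    induction φ using SimpleFunc.induction with
    | const c hs =>
      rename_i s
      have : ∀ x, ∫ᵛ y, (SimpleFunc.piecewise s hs (SimpleFunc.const E c)
          (SimpleFunc.const E 0)) y ∂<•(β x) = (β x s) • c := by
        intro x
        classical
        have := hfinv x
        have e : ⇑(SimpleFunc.piecewise s hs (SimpleFunc.const E c) (SimpleFunc.const E 0)) =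
            s.indicator (fun _ => c) := by
          ext y
          by_cases hy : y ∈ s <;> simp [SimpleFunc.piecewise_apply, hy]
        rw [e]
        exact VectorMeasure.integral_indicator_const _ hs
      simp only [this]
      exact (hβ s hs).smul_const c
    | add hd hf' hg' =>
      rename_i φ ψ
      have : ∀ x, ∫ᵛ y, (φ + ψ) y ∂<•(β x) = ∫ᵛ y, φ y ∂<•(β x) + ∫ᵛ y, ψ y ∂<•(β x) :=
        fun x => VectorMeasure.integral_fun_add (hi φ x) (hi ψ x)
      simp only [this]
      exact hf'.add hg'
  refine measurable_of_tendsto_metrizable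
    (f := fun n x => ∫ᵛ y, SimpleFunc.approxOn f hf Set.univ 0 (Set.mem_univ _) n y ∂<•(β x))
    (fun n => (hsimple _).2) (tendsto_pi_nhds.2 fun x => ?_)
  have hlim := SimpleFunc.tendsto_approxOn_L1_enorm (μ := (β x).variation) hf
    (Set.mem_univ (0 : ℂ)) (by simp) (by simpa using (hint x).2)
  rw [tendsto_iff_edist_tendsto_0]
  refine tendsto_of_tendsto_of_tendsto_of_le_of_le tendsto_const_nhds
    (by simpa only [mul_zero] using ENNReal.Tendsto.const_mul (a := ‖(ContinuousLinearMap.lsmul ℝ ℝ :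
      ℝ →L[ℝ] ℂ →L[ℝ] ℂ).flip‖ₑ) hlim (Or.inr enorm_ne_top)) (fun _ => zero_le) (fun n => ?_)
  refine (VectorMeasure.edist_integral_le_lintegral_edist ((hsimple _).1 x) (hint x)).trans ?_
  simp only [edist_eq_enorm_sub]
  exact le_rfl

/-! ### The replacement kernel, the standing assumptions, and the operator `R` -/

section Model

variable {E Ω' : Type*} [MeasurableSpace E] [MeasurableSpace Ω']

/-- A random replacement kernel: a family `(ρ x)_{x ∈ E}` of random finite signed measures on `E`,
defined on a probability space `(Ω', PR)`, such that the laws `x ↦ 𝓛(ρ x)` form a probability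
kernel from `E` to the space of signed measures, and such that a.s. `ρ x` is positive on
`E \ {x}`. -/
structure IsReplacementKernel (ρ : E → Ω' → SignedMeasure E) (PR : Measure Ω') : Prop where
  isProbabilityMeasure : IsProbabilityMeasure PR
  measurable : ∀ x, Measurable (ρ x)
  measurable_law : Measurable fun x => PR.map (ρ x)
  nonneg_off : ∀ x, ∀ᵐ ω ∂PR, ∀ A, MeasurableSet A → x ∉ A → 0 ≤ ρ x ω A

/-- The moment bound `𝔼[(|ρ x| W)^q] ≤ C W(x)^q` for all `x`, with `q > 2`. -/
structure MomentBound (W : Weight E) (q : ℝ) (ρ : E → Ω' → SignedMeasure E) (PR : Measure Ω') :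
    Prop where
  two_lt : 2 < q
  bound : ∃ C : ℝ, 0 < C ∧ ∀ x,
    ∫⁻ ω, (∫⁻ y, ENNReal.ofReal (W y) ∂(ρ x ω).variation) ^ q ∂PR ≤ ENNReal.ofReal (C * W x ^ q)

/-- The standing assumptions: the urn is balanced (B), the Lyapunov and moment assumptions (H)
hold with `V = W ^ q`, `q > 2`, and `ν` is an invariant probability measure with `ν V < ∞` (N). -/
structure StandingAssumptions (W : Weight E) (q : ℝ) (ρ : E → Ω' → SignedMeasure E)
    (PR : Measure Ω') (m₀ ν : Measure E) : Prop where
  kernel : IsReplacementKernel ρ PR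
  balance : ∀ x, ∀ᵐ ω ∂PR, ρ x ω Set.univ = 1
  moment : MomentBound W q ρ PR
  lyapunov : ∃ ϑ C : ℝ, 0 < ϑ ∧ ϑ < 1 ∧ 0 ≤ C ∧ ∀ x,
    (meanMeasure (ρ x) PR).Integrable (fun y => W y ^ q) ∧
      ∫ᵛ y, W y ^ q ∂<•(meanMeasure (ρ x) PR) ≤ ϑ * W x ^ q + C
  initial : Integrable (fun y => W y ^ q) m₀
  isProbabilityMeasure : IsProbabilityMeasure ν
  invariant : ∀ A, MeasurableSet A → ∫ x, meanMeasure (ρ x) PR A ∂ν = ν.real A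
  integrable : Integrable (fun y => W y ^ q) ν

variable {W : Weight E} {q : ℝ} {ρ : E → Ω' → SignedMeasure E} {PR : Measure Ω'}

/-- `𝔼[|ρ x| W] ≤ C W(x)`. -/
theorem first_moment (hρ : IsReplacementKernel ρ PR) (hM : MomentBound W q ρ PR) :
    ∃ C : ℝ, 0 ≤ C ∧ ∀ x,
      ∫⁻ ω, ∫⁻ y, ENNReal.ofReal (W y) ∂(ρ x ω).variation ∂PR ≤ ENNReal.ofReal (C * W x) := by
  obtain ⟨C, hC, hb⟩ := hM.bound
  have hq : (1 : ℝ) ≤ q := by linarith [hM.two_lt]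
  have := hρ.isProbabilityMeasure
  refine ⟨1 + C, by positivity, fun x => ?_⟩
  set w : ℝ≥0∞ := ENNReal.ofReal (W x) with hw
  have hw0 : w ≠ 0 := (ENNReal.ofReal_pos.2 (W.pos x)).ne'
  have hwt : w ≠ ∞ := ENNReal.ofReal_ne_top
  have hpt : ∀ t : ℝ≥0∞, t ≤ w + w * (w ^ q)⁻¹ * t ^ q := by
    intro t
    rcases le_total t w with h | h
    · exact h.trans le_self_add
    · refine le_trans ?_ le_add_self
      rcases eq_or_ne t ∞ with rfl | ht
      · rw [ENNReal.top_rpow_of_pos (by linarith), ENNReal.mul_top]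
        exact mul_ne_zero hw0 (ENNReal.inv_ne_zero.2
          (ENNReal.rpow_ne_top_of_nonneg (by linarith) hwt))
      · have h1 : (t / w) ≤ (t / w) ^ q := by
          have h2 : 1 ≤ t / w := (ENNReal.le_div_iff_mul_le (Or.inl hw0) (Or.inl hwt)).2
            (by simpa using h)
          calc t / w = (t / w) ^ (1 : ℝ) := (ENNReal.rpow_one _).symm
            _ ≤ (t / w) ^ q := ENNReal.rpow_le_rpow_of_exponent_le h2 hq
        calc t = w * (t / w) := (ENNReal.mul_div_cancel hw0 hwt).symm
          _ ≤ w * (t / w) ^ q := mul_le_mul_right h1 _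
          _ = w * (w ^ q)⁻¹ * t ^ q := by
            rw [ENNReal.div_rpow_of_nonneg _ _ (by linarith), div_eq_mul_inv]
            ring
  calc ∫⁻ ω, ∫⁻ y, ENNReal.ofReal (W y) ∂(ρ x ω).variation ∂PR
      ≤ ∫⁻ ω, (w + w * (w ^ q)⁻¹ * (∫⁻ y, ENNReal.ofReal (W y) ∂(ρ x ω).variation) ^ q) ∂PR :=
        lintegral_mono fun ω => hpt _
    _ = w + w * (w ^ q)⁻¹ *
          ∫⁻ ω, (∫⁻ y, ENNReal.ofReal (W y) ∂(ρ x ω).variation) ^ q ∂PR := by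
        rw [lintegral_add_left measurable_const, lintegral_const, measure_univ, mul_one,
          lintegral_const_mul']
        exact ENNReal.mul_ne_top hwt (ENNReal.inv_ne_top.2
          (ENNReal.rpow_pos (pos_iff_ne_zero.2 hw0) hwt).ne')
    _ ≤ w + w * (w ^ q)⁻¹ * (ENNReal.ofReal C * w ^ q) := by
        refine add_le_add le_rfl (mul_le_mul_right ((hb x).trans (le_of_eq ?_)) _)
        rw [ENNReal.ofReal_mul hC.le, hw, ENNReal.ofReal_rpow_of_pos (W.pos x)]
    _ = w + w * ENNReal.ofReal C * ((w ^ q)⁻¹ * w ^ q) := by ring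
    _ = ENNReal.ofReal ((1 + C) * W x) := by
        rw [ENNReal.inv_mul_cancel (ENNReal.rpow_pos (pos_iff_ne_zero.2 hw0) hwt).ne'
          (ENNReal.rpow_ne_top_of_nonneg (by linarith) hwt), mul_one,
          ENNReal.ofReal_mul (by positivity), ENNReal.ofReal_add zero_le_one hC.le,
          ENNReal.ofReal_one, add_mul, one_mul, mul_comm w]

theorem lintegral_variation_univ_lt_top (hρ : IsReplacementKernel ρ PR)
    (hM : MomentBound W q ρ PR) (x : E) : ∫⁻ ω, (ρ x ω).variation Set.univ ∂PR < ∞ := by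
  obtain ⟨C, -, hb⟩ := first_moment hρ hM
  refine lt_of_le_of_lt (lintegral_mono fun ω => ?_) ((hb x).trans_lt ENNReal.ofReal_lt_top)
  rw [← lintegral_one]
  exact lintegral_mono fun y => by simpa using ENNReal.ofReal_le_ofReal (W.one_le' y)

theorem measurable_meanMeasure (hρ : IsReplacementKernel ρ PR) (hM : MomentBound W q ρ PR)
    {A : Set E} (hA : MeasurableSet A) : Measurable fun x => meanMeasure (ρ x) PR A := by
  have h : ∀ x, meanMeasure (ρ x) PR A =
      ∫ r, r A ∂((⟨fun x => PR.map (ρ x), hρ.measurable_law⟩ :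
        ProbabilityTheory.Kernel E (SignedMeasure E)) x) := fun x => by
    rw [meanMeasure_apply (hρ.measurable x) (lintegral_variation_univ_lt_top hρ hM x) hA]
    exact (integral_map (hρ.measurable x).aemeasurable
      (measurable_eval hA).aestronglyMeasurable).symm
  simp only [h]
  exact ((measurable_eval hA).stronglyMeasurable.integral_kernel).measurable

theorem lintegral_enorm_meanMeasure_le (hρ : IsReplacementKernel ρ PR)
    (hM : MomentBound W q ρ PR) : ∃ C : ℝ, 0 ≤ C ∧ ∀ (f : BW W) (x : E),
      ∫⁻ y, ‖f y‖ₑ ∂(meanMeasure (ρ x) PR).variation ≤ ENNReal.ofReal (C * ‖f‖ * W x) := by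
  obtain ⟨C, hC, hb⟩ := first_moment hρ hM
  refine ⟨C, hC, fun f x => ?_⟩
  calc ∫⁻ y, ‖f y‖ₑ ∂(meanMeasure (ρ x) PR).variation
      ≤ ∫⁻ y, ENNReal.ofReal ‖f‖ * ENNReal.ofReal (W y) ∂(meanMeasure (ρ x) PR).variation := by
        refine lintegral_mono fun y => ?_
        rw [← ENNReal.ofReal_mul (norm_nonneg f), ← ofReal_norm]
        exact ENNReal.ofReal_le_ofReal (f.norm_apply_le y)
    _ = ENNReal.ofReal ‖f‖ * ∫⁻ y, ENNReal.ofReal (W y) ∂(meanMeasure (ρ x) PR).variation :=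
        lintegral_const_mul' _ _ ENNReal.ofReal_ne_top
    _ ≤ ENNReal.ofReal ‖f‖ * ENNReal.ofReal (C * W x) :=
        mul_le_mul_right ((lintegral_meanMeasure_le (hρ.measurable x)
          (lintegral_variation_univ_lt_top hρ hM x) _).trans (hb x)) _
    _ = ENNReal.ofReal (C * ‖f‖ * W x) := by
        rw [← ENNReal.ofReal_mul (norm_nonneg f)]
        congr 1
        ring

theorem integrable_meanMeasure (hρ : IsReplacementKernel ρ PR) (hM : MomentBound W q ρ PR)
    (f : BW W) (x : E) : Integrable f (meanMeasure (ρ x) PR).variation := by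
  obtain ⟨C, -, hb⟩ := lintegral_enorm_meanMeasure_le hρ hM
  exact ⟨f.measurable.aestronglyMeasurable, (hb f x).trans_lt ENNReal.ofReal_lt_top⟩

theorem norm_integral_meanMeasure_le (hρ : IsReplacementKernel ρ PR) (hM : MomentBound W q ρ PR) :
    ∃ C : ℝ, 0 ≤ C ∧ ∀ (f : BW W) (x : E),
      ‖∫ᵛ y, f y ∂<•(meanMeasure (ρ x) PR)‖ ≤ C * ‖f‖ * W x := by
  obtain ⟨C, hC, hb⟩ := lintegral_enorm_meanMeasure_le hρ hM
  refine ⟨‖(ContinuousLinearMap.lsmul ℝ ℝ : ℝ →L[ℝ] ℂ →L[ℝ] ℂ).flip‖ * C,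
    by positivity, fun f x => ?_⟩
  refine VectorMeasure.norm_integral_le_lintegral_norm.trans ?_
  rw [mul_assoc, mul_assoc, ← mul_assoc C]
  refine mul_le_mul_of_nonneg_left ?_ (by positivity)
  refine ENNReal.toReal_le_of_le_ofReal
    (mul_nonneg (mul_nonneg hC (norm_nonneg f)) (W.pos x).le) ?_
  simpa only [ofReal_norm] using hb f x

/-- The bounded operator `R` on `B(W)` given by `(R f)(x) = R_x f`, where `R_x = 𝔼[ρ x]`. -/
def meanOp (hρ : IsReplacementKernel ρ PR) (hM : MomentBound W q ρ PR) : BW W →L[ℂ] BW W :=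
  LinearMap.mkContinuousOfExistsBound
    { toFun := fun f => BW.mk (fun x => ∫ᵛ y, f y ∂<•(meanMeasure (ρ x) PR))
        (measurable_integral_signedKernel (fun _ hA => measurable_meanMeasure hρ hM hA)
          f.measurable (integrable_meanMeasure hρ hM f))
        (let ⟨C, _, hb⟩ := norm_integral_meanMeasure_le hρ hM; ⟨C * ‖f‖, hb f⟩)
      map_add' := fun f g => BW.ext fun x =>
        VectorMeasure.integral_fun_add (integrable_meanMeasure hρ hM f x)
          (integrable_meanMeasure hρ hM g x)
      map_smul' := fun c f => BW.ext fun x =>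
        integral_const_mul _ (integrable_meanMeasure hρ hM f x) c }
    (let ⟨C, hC, hb⟩ := norm_integral_meanMeasure_le hρ hM
     ⟨C, fun f => BW.norm_le_of _ (mul_nonneg hC (norm_nonneg f)) (hb f)⟩)

@[simp] theorem meanOp_apply (hρ : IsReplacementKernel ρ PR) (hM : MomentBound W q ρ PR)
    (f : BW W) (x : E) : meanOp hρ hM f x = ∫ᵛ y, f y ∂<•(meanMeasure (ρ x) PR) := rfl

end Model

/-! ### Spectral notions -/

section Spectral

variable {X : Type*} [NormedAddCommGroup X] [NormedSpace ℂ X]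

/-- The spectral (Riesz) projection of `T` at an isolated point `z` of its spectrum,
`(2πi)⁻¹ ∮ (ζ - T)⁻¹ dζ` over a small circle around `z` (the value does not depend on the
radius). Junk value `0` if `z` is not isolated from the rest of the spectrum. -/
def spectralProjection (T : X →L[ℂ] X) (z : ℂ) : X →L[ℂ] X := by
  classical
  exact
  if h : ∃ r : ℝ, 0 < r ∧ Metric.closedBall z r ∩ spectrum ℂ T ⊆ {z} then
    (2 * Real.pi * Complex.I)⁻¹ • ∮ ζ in C(z, h.choose), resolvent T ζ
  else 0

/-- Spectrally-large quasi-compact operators: `1` is an isolated point of the spectrum whose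
spectral projection has rank one, and the rest of the spectrum lies in `{Re < 1}`. -/
structure IsSLQC (T : X →L[ℂ] X) : Prop where
  one_mem : (1 : ℂ) ∈ spectrum ℂ T
  isolated : ∃ r : ℝ, 0 < r ∧ Metric.closedBall 1 r ∩ spectrum ℂ T ⊆ {1}
  rank_one : Module.rank ℂ (LinearMap.range (spectralProjection T 1).toLinearMap) = 1
  re_lt : ∀ z ∈ spectrum ℂ T, z ≠ 1 → z.re < 1

/-- `κ(z) = min {k ≥ 1 : (T - z)^k = 0 on the range of Π_z}`, with `min ∅ = ∞`. -/
def nilpotencyIndex (T : X →L[ℂ] X) (z : ℂ) : ℕ∞ :=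
  ⨅ (k : ℕ) (_ : 1 ≤ k ∧ ∀ v, ((T - z • (1 : X →L[ℂ] X)) ^ k) (spectralProjection T z v) = 0),
    (k : ℕ∞)

/-- The case of a large second eigenvalue: `T` is spectrally-large quasi-compact,
`σ(T) = {1, λ₁, …, λ_p} ∪ Δ` with `p ≥ 1`, distinct `λ_j` of common real part `θ ∈ (1/2, 1)`,
`sup Re Δ < θ`, and `κ = max_j κ(λ_j)` is finite. -/
structure IsLargeCase (T : X →L[ℂ] X) {p : ℕ} (lam : Fin p → ℂ) (θ : ℝ) (κ : ℕ) : Prop where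
  slqc : IsSLQC T
  pos : 0 < p
  injective : Function.Injective lam
  half_lt : 1 / 2 < θ
  lt_one : θ < 1
  re_eq : ∀ j, (lam j).re = θ
  spectrum_eq : ∃ (Δ : Set ℂ) (c : ℝ), c < θ ∧ (∀ z ∈ Δ, z.re ≤ c) ∧
    spectrum ℂ T = ({1} ∪ Set.range lam) ∪ Δ
  index_eq : ⨆ j, nilpotencyIndex T (lam j) = (κ : ℕ∞)

end Spectral

/-! ### The measure-valued Pólya process -/

section Urn

variable {E Ω Ω' : Type*} [MeasurableSpace E] [MeasurableSpace Ω'] [mΩ : MeasurableSpace Ω]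

/-- The composition after `n` steps, `𝔪_n = 𝔪₀ + ∑_{i < n} R_i`. Here `R_i` is the measure added at
the `(i+1)`-st step. -/
def composition (m₀ : Measure E) [IsFiniteMeasure m₀] (R : ℕ → Ω → SignedMeasure E) (n : ℕ)
    (ω : Ω) : SignedMeasure E :=
  m₀.toSignedMeasure + ∑ i ∈ Finset.range n, R i ω

/-- The σ-field generated by the first `n` steps. -/
abbrev history (Y : ℕ → Ω → E) (R : ℕ → Ω → SignedMeasure E) (n : ℕ) : MeasurableSpace Ω :=
  ⨆ (i : ℕ) (_ : i < n), (MeasurableSpace.comap (Y i) inferInstance ⊔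
    MeasurableSpace.comap (R i) inferInstance)

/-- `(Y, R)` drives a (tenable) measure-valued Pólya process with initial composition `m₀` and
random replacement kernel `ρ`. Here `Y n` and `R n` are the colour drawn and the measure added at
the `(n+1)`-st step: given the past, `Y n` has law `𝔪_n / 𝔪_n(E)`, and given the past and
`Y n = y`, `R n` has the law of `ρ y`. -/
structure IsMVPP (P : Measure Ω) (m₀ : Measure E) [IsFiniteMeasure m₀]
    (ρ : E → Ω' → SignedMeasure E) (PR : Measure Ω')
    (Y : ℕ → Ω → E) (R : ℕ → Ω → SignedMeasure E) : Prop where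
  measurable_colour : ∀ n, Measurable (Y n)
  measurable_replacement : ∀ n, Measurable (R n)
  tenable : ∀ᵐ ω ∂P, ∀ n, 0 ≤ composition m₀ R n ω ∧ composition m₀ R n ω ≠ 0
  law_colour : ∀ n, ∀ A : Set E, MeasurableSet A →
    P[(Y n ⁻¹' A).indicator (fun _ => (1 : ℝ)) | history Y R n] =ᵐ[P]
      fun ω => composition m₀ R n ω A / composition m₀ R n ω Set.univ
  law_replacement : ∀ n, ∀ S : Set (SignedMeasure E), MeasurableSet S →
    P[(R n ⁻¹' S).indicator (fun _ => (1 : ℝ)) |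
        history Y R n ⊔ MeasurableSpace.comap (Y n) inferInstance] =ᵐ[P]
      fun ω => (PR.map (ρ (Y n ω))).real S

/-- `n^{1-θ} / (log n)^{κ-1} (𝔪̃_n f - ν f) - ∑_j n^{i Im λ_j} Λ_j`, where
`𝔪̃_n = 𝔪_n / 𝔪_n(E)`. -/
def fluctuationError (m₀ ν : Measure E) [IsFiniteMeasure m₀] (R : ℕ → Ω → SignedMeasure E)
    {p : ℕ} (lam : Fin p → ℂ) (θ : ℝ) (κ : ℕ) (f : E → ℂ) (Λ : Fin p → Ω → ℂ) (n : ℕ) (ω : Ω) :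
    ℂ :=
  (((n : ℝ) ^ (1 - θ) / (Real.log n) ^ (κ - 1) : ℝ) : ℂ) *
      ((∫ᵛ x, f x ∂<•(composition m₀ R n ω)) / ((composition m₀ R n ω Set.univ : ℝ) : ℂ) -
        ∫ x, f x ∂ν) -
    ∑ j, (n : ℂ) ^ (Complex.I * ((lam j).im : ℂ)) * Λ j ω

/-- The random variables `Λ_j ∈ L²` are the fluctuation limits of `𝔪̃_n f`: the above error tends
to `0` a.s. and in `L²`. -/
structure IsFluctuationLimit (P : Measure Ω) (m₀ ν : Measure E) [IsFiniteMeasure m₀]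
    (R : ℕ → Ω → SignedMeasure E) {p : ℕ} (lam : Fin p → ℂ) (θ : ℝ) (κ : ℕ) (f : E → ℂ)
    (Λ : Fin p → Ω → ℂ) : Prop where
  memLp : ∀ j, MemLp (Λ j) 2 P
  tendsto_ae : ∀ᵐ ω ∂P,
    Tendsto (fun n => fluctuationError m₀ ν R lam θ κ f Λ n ω) atTop (𝓝 0)
  tendsto_L2 :
    Tendsto (fun n => eLpNorm (fluctuationError m₀ ν R lam θ κ f Λ n) 2 P) atTop (𝓝 0)

end Urn

end MVPP

end

open MVPP

/-!
Write `a = m₀(E)`, `𝐑` for the mean replacement operator and `g_j` for the function in the theorem,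
an eigenfunction of `𝐑` for `λ_j`. By the balance condition `𝔪_n(E) = a + n`, so that
`𝔼[𝔪_{n+1} f | 𝓕_n] = 𝔪_n (1 + 𝐑 / (a + n)) f`. Consequently conditional means of the urn are
governed by the products `∏_{i < n} (1 + 𝐑 / (i + b))` with `b = a + k`, applied to `f` and integrated
against `𝔪_k` (`StandingAssumptions.integral_meanUrn_add`).

The asymptotics of these products (`IsLargeCase.tendsto_stepProd`) come from the Riesz decomposition
of `𝐑`: the eigenvalue `1` contributes the multiple `ν f` of the constant functions, each `λ_j`
contributes `n ^ λ_j (log n) ^ (κ - 1)` times a non-zero multiple of `g_j`, and the remaining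
spectrum is negligible. Since the oscillations `n ^ (i Im λ_j)` are asymptotically independent
(`eq_zero_of_tendsto_sum_cpow`), comparing with the definition of the fluctuation limits gives
`𝔼[Λ_j | 𝓕_k] = C 𝔪_k g_j` with `C ≠ 0` (`StandingAssumptions.setIntegral_limit`). This identity
links the limits to the urn:

* If `Λ_j` is deterministic, so is every `𝔪_k g_j`. Then `𝐑 g_j`, hence `g_j`, is almost everywhere
  equal to a constant for `𝔼 𝔪_k`, and since one step removes only a bounded mass from any set, this
  constant has to vanish for large `k`
  (`StandingAssumptions.exists_eq_zero_of_deterministic`), so `Λ_j = 0`.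
* If all `𝔪_k g_j` vanish, then `Λ_j` is orthogonal to the histories, hence to its own approximations,
  and so `Λ_j = 0` (`StandingAssumptions.limit_eq_zero`). Moreover `λ_j g_j = 𝐑 g_j = 0` almost
  everywhere for `𝔼 𝔪_k` (`StandingAssumptions.ae_meanUrn_eq_zero`), which is the common content of
  the conditions on `|g_j|`.

The statements about `ν` follow from the convergence of the normalised means `𝔼 𝔪_n / (a + n)` to
`ν` under the spectral assumption on all of `B(W)`, and, in the other direction, from the fact that
`𝐑 + C` is a positive operator for some constant `C`, under which `ν` is invariant up to a factor.
-/

noncomputable section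

namespace MVPP

/-! ### Asymptotic independence of the characters `n ↦ n ^ (i t)` -/

theorem exists_natCast_cpow_ne {x y : ℝ} (h : x ≠ y) :
    ∃ b : ℕ, 0 < b ∧ (b : ℂ) ^ (Complex.I * x) ≠ (b : ℂ) ^ (Complex.I * y) := by
  by_contra! H
  have hlog : Tendsto (fun n : ℕ => (x - y) * (Real.log (n + 1) - Real.log n)) atTop (𝓝 0) := by
    simpa using (Real.tendsto_log_nat_add_one_sub_log).const_mul (x - y)
  have hev : ∀ᶠ n : ℕ in atTop, |(x - y) * (Real.log (n + 1) - Real.log n)| < 2 * Real.pi := by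
    have := hlog.abs
    rw [abs_zero] at this
    exact this.eventually (gt_mem_nhds (by positivity))
  obtain ⟨n, hn, hn1⟩ := (hev.and (eventually_ge_atTop 1)).exists
  have hn0 : (0 : ℝ) < n := by exact_mod_cast hn1
  have key : ∀ b : ℕ, 0 < b → Complex.exp (((x - y) * Real.log b : ℝ) * Complex.I) = 1 := by
    intro b hb
    have h1 := H b hb
    have hb' : (b : ℂ) ≠ 0 := by exact_mod_cast hb.ne'
    rw [Complex.cpow_def_of_ne_zero hb', Complex.cpow_def_of_ne_zero hb',
      ← Complex.natCast_log] at h1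
    have : (((x - y) * Real.log b : ℝ) * Complex.I : ℂ) =
        (Real.log b : ℂ) * (Complex.I * x) - (Real.log b : ℂ) * (Complex.I * y) := by
      push_cast; ring
    rw [this, Complex.exp_sub, h1, div_self (Complex.exp_ne_zero _)]
  have h2 : Complex.exp ((((x - y) * (Real.log (n + 1) - Real.log n) : ℝ) : ℂ) * Complex.I) = 1 := by
    have e : (((x - y) * (Real.log (n + 1) - Real.log n) : ℝ) : ℂ) * Complex.I =
        (((x - y) * Real.log ((n + 1 : ℕ) : ℝ) : ℝ) : ℂ) * Complex.I -
          (((x - y) * Real.log n : ℝ) : ℂ) * Complex.I := by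
      push_cast; ring
    rw [e, Complex.exp_sub, key _ n.succ_pos, key _ hn1, div_one]
  obtain ⟨k, hk⟩ := Complex.exp_eq_one_iff.1 h2
  have hk' : (x - y) * (Real.log (n + 1) - Real.log n) = k * (2 * Real.pi) := by
    have h3 : (((x - y) * (Real.log (n + 1) - Real.log n) : ℝ) : ℂ) =
        ((k * (2 * Real.pi) : ℝ) : ℂ) := by
      apply mul_right_cancel₀ Complex.I_ne_zero
      rw [hk]; push_cast; ring
    exact_mod_cast h3
  have hk0 : k = 0 := by
    rw [hk', abs_mul, abs_of_pos Real.two_pi_pos] at hn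
    have h4 : |(k : ℝ)| < 1 := by
      by_contra! h5
      nlinarith [Real.two_pi_pos]
    have : |k| < 1 := by exact_mod_cast h4
    exact Int.abs_lt_one_iff.1 this
  rw [hk0] at hk'
  have h5 : Real.log (n + 1) - Real.log n ≠ 0 :=
    (sub_pos.2 (Real.log_lt_log hn0 (lt_add_one _))).ne'
  simp [sub_ne_zero.2 h, h5] at hk'

theorem norm_natCast_cpow_I_mul {n : ℕ} (hn : 0 < n) (t : ℝ) :
    ‖(n : ℂ) ^ (Complex.I * t)‖ = 1 := by
  rw [Complex.norm_natCast_cpow_of_pos hn]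
  simp

/-- Distinct characters `n ↦ n ^ (i t)` are asymptotically linearly independent: multiplying `n`
by a fixed integer `b` acts on the coefficients by `b ^ (i t)`, so the terms can be eliminated one
at a time. -/
theorem eq_zero_of_tendsto_sum_cpow {ι : Type*} (s : Finset ι) (t : ι → ℝ) :
    Set.InjOn t s → ∀ z : ι → ℂ,
    Tendsto (fun n : ℕ => ∑ j ∈ s, (n : ℂ) ^ (Complex.I * t j) * z j) atTop (𝓝 0) →
    ∀ j ∈ s, z j = 0 := by
  classical
  induction s using Finset.induction_on with
  | empty => simp
  | insert a s ha ih =>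
    intro hinj z hz
    have hs : ∀ j ∈ s, z j = 0 := by
      intro l hl
      have hne : t l ≠ t a := fun he => ha (by
        rwa [← hinj (Finset.mem_coe.2 (Finset.mem_insert_of_mem hl))
          (Finset.mem_coe.2 (Finset.mem_insert_self a s)) he])
      obtain ⟨b, hb, hbne⟩ := exists_natCast_cpow_ne hne
      have h1 : Tendsto (fun n : ℕ => ∑ j ∈ insert a s,
          ((b * n : ℕ) : ℂ) ^ (Complex.I * t j) * z j) atTop (𝓝 0) :=
        hz.comp (tendsto_id.const_mul_atTop' hb)
      have h2 := h1.sub (hz.const_mul ((b : ℂ) ^ (Complex.I * t a)))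
      rw [mul_zero, sub_zero] at h2
      have h3 := ih (hinj.mono (by simp))
        (fun j => ((b : ℂ) ^ (Complex.I * t j) - (b : ℂ) ^ (Complex.I * t a)) * z j)
        (h2.congr fun n => ?_) l hl
      · exact (mul_eq_zero.1 h3).resolve_left (sub_ne_zero.2 hbne)
      · rw [Finset.mul_sum, ← Finset.sum_sub_distrib, Finset.sum_insert ha]
        have e : ∀ j, ((b * n : ℕ) : ℂ) ^ (Complex.I * t j) =
            (b : ℂ) ^ (Complex.I * t j) * (n : ℂ) ^ (Complex.I * t j) := fun j => by
          rw [Nat.cast_mul, Complex.natCast_mul_natCast_cpow]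
        rw [e, sub_eq_zero.2 (by ring), zero_add]
        refine Finset.sum_congr rfl fun j _ => ?_
        rw [e]; ring
    have ha0 : z a = 0 := by
      have h1 : Tendsto (fun n : ℕ => ‖(n : ℂ) ^ (Complex.I * t a) * z a‖) atTop (𝓝 0) := by
        rw [← tendsto_zero_iff_norm_tendsto_zero]
        refine hz.congr fun n => ?_
        rw [Finset.sum_insert ha, Finset.sum_eq_zero fun j hj => by rw [hs j hj, mul_zero],
          add_zero]
      have h2 : Tendsto (fun _ : ℕ => ‖z a‖) atTop (𝓝 0) := by
        refine h1.congr' ?_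
        filter_upwards [eventually_gt_atTop 0] with n hn
        rw [norm_mul, norm_natCast_cpow_I_mul hn, one_mul]
      exact norm_eq_zero.1 (tendsto_nhds_unique tendsto_const_nhds h2)
    intro j hj
    rcases Finset.mem_insert.1 hj with rfl | hj
    · exact ha0
    · exact hs j hj

/-! ### Products `∏ (1 + δ_i T)` -/

section StepProd

variable {X : Type*} [NormedAddCommGroup X] [NormedSpace ℂ X]

/-- The product `(1 + δ_{n-1} T) ⋯ (1 + δ_0 T)`. -/
def stepProd (T : X →L[ℂ] X) (δ : ℕ → ℂ) : ℕ → (X →L[ℂ] X)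
  | 0 => 1
  | n + 1 => (1 + δ n • T) * stepProd T δ n

theorem stepProd_zero (T : X →L[ℂ] X) (δ : ℕ → ℂ) : stepProd T δ 0 = 1 := rfl

theorem stepProd_succ (T : X →L[ℂ] X) (δ : ℕ → ℂ) (n : ℕ) :
    stepProd T δ (n + 1) = (1 + δ n • T) * stepProd T δ n := rfl

theorem stepProd_succ_apply (T : X →L[ℂ] X) (δ : ℕ → ℂ) (n : ℕ) (v : X) :
    stepProd T δ (n + 1) v = stepProd T δ n v + δ n • T (stepProd T δ n v) := by
  simp [stepProd_succ]

theorem commute_stepProd {T S : X →L[ℂ] X} (h : Commute S T) (δ : ℕ → ℂ) (n : ℕ) :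
    Commute S (stepProd T δ n) := by
  induction n with
  | zero => exact Commute.one_right S
  | succ n ih => exact ((Commute.one_right S).add_right (h.smul_right _)).mul_right ih

theorem stepProd_apply_comm (T : X →L[ℂ] X) (δ : ℕ → ℂ) (n : ℕ) (v : X) :
    stepProd T δ n (T v) = T (stepProd T δ n v) := by
  have := DFunLike.congr_fun (commute_stepProd (Commute.refl T) δ n).eq v
  exact this.symm

theorem stepProd_eigenvector {T : X →L[ℂ] X} {lam : ℂ} {v : X} (h : T v = lam • v) (δ : ℕ → ℂ)
    (n : ℕ) : stepProd T δ n v = (∏ i ∈ Finset.range n, (1 + lam * δ i)) • v := by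
  induction n with
  | zero => simp [stepProd_zero]
  | succ n ih =>
    rw [stepProd_succ_apply, ih, map_smul, h, Finset.prod_range_succ, smul_smul, smul_smul,
      ← add_smul]
    ring_nf

/-- The discrete derivative of `log ^ (s + 1)` is asymptotic to `(s + 1) log ^ s / i`; this feeds the
Stolz–Cesàro computation of the nested harmonic sums. -/
theorem tendsto_log_comparison (s : ℕ) :
    Tendsto (fun i : ℕ => ((Real.log ((i + 1 : ℕ) : ℝ)) ^ (s + 1) - (Real.log i) ^ (s + 1)) /
      ((Real.log i) ^ s / i)) atTop (𝓝 (s + 1)) := by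
  have h1 : Tendsto (fun i : ℕ => (i : ℝ) * (Real.log ((i + 1 : ℕ) : ℝ) - Real.log i)) atTop
      (𝓝 1) := by
    have := (Real.tendsto_mul_log_one_add_div_atTop 1).comp tendsto_natCast_atTop_atTop
    refine this.congr' ?_
    filter_upwards [eventually_gt_atTop 0] with i hi
    have hi' : (0 : ℝ) < i := by exact_mod_cast hi
    simp only [Function.comp]
    rw [← Real.log_div (by positivity) hi'.ne']
    push_cast
    rw [add_div, div_self hi'.ne']
  have hlogt : Tendsto (fun i : ℕ => Real.log i) atTop atTop :=
    Real.tendsto_log_atTop.comp tendsto_natCast_atTop_atTop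
  have h2 : Tendsto (fun i : ℕ => Real.log ((i + 1 : ℕ) : ℝ) / Real.log i) atTop (𝓝 1) := by
    have h3 : Tendsto (fun i : ℕ => (Real.log ((i + 1 : ℕ) : ℝ) - Real.log i) / Real.log i) atTop
        (𝓝 0) := by
      have h4 : Tendsto (fun i : ℕ => Real.log ((i + 1 : ℕ) : ℝ) - Real.log i) atTop (𝓝 0) := by
        simpa using Real.tendsto_log_nat_add_one_sub_log
      exact h4.div_atTop hlogt
    have h5 := h3.const_add 1
    rw [add_zero] at h5
    refine h5.congr' ?_
    filter_upwards [hlogt.eventually_gt_atTop 0] with i hi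
    field_simp
    ring
  have h6 : Tendsto (fun i : ℕ => (i : ℝ) * (Real.log ((i + 1 : ℕ) : ℝ) - Real.log i) *
      ∑ t ∈ Finset.range (s + 1), (Real.log ((i + 1 : ℕ) : ℝ) / Real.log i) ^ t) atTop
      (𝓝 (1 * ∑ t ∈ Finset.range (s + 1), (1 : ℝ) ^ t)) :=
    h1.mul (tendsto_finsetSum _ fun t _ => h2.pow t)
  simp only [one_pow, Finset.sum_const, Finset.card_range, nsmul_eq_mul, mul_one, one_mul,
    Nat.cast_add, Nat.cast_one] at h6
  refine (h6.congr' ?_)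
  filter_upwards [hlogt.eventually_gt_atTop 0, eventually_gt_atTop 0] with i hi hi0
  have hi' : (0 : ℝ) < i := by exact_mod_cast hi0
  rw [← (Commute.all _ _).geom_sum₂_mul, Finset.mul_sum, eq_div_iff (by positivity),
    Finset.sum_mul, Finset.sum_mul]
  refine Finset.sum_congr rfl fun t ht => ?_
  have ht' : t ≤ s := Nat.lt_succ_iff.1 (Finset.mem_range.1 ht)
  rw [Nat.add_sub_cancel, div_pow]
  obtain ⟨r, rfl⟩ := Nat.exists_eq_add_of_le ht'
  rw [Nat.add_sub_cancel_left, pow_add]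
  push_cast
  field_simp

/-- Growth of `∏ (1 + x_i N) v` when `x_i ~ 1 / i` and `N ^ (s + 1) v = 0`. By induction on `s`:
`∏_{i < n} (1 + x_i N) v - v` is the sum of `x_i ∏_{l < i} (1 + x_l N) (N v)`, whose terms are
asymptotic to a multiple of `(log (i + 1)) ^ (s + 1) - (log i) ^ (s + 1)`. -/
theorem tendsto_stepProd_nilpotent (N : X →L[ℂ] X) {x : ℕ → ℂ}
    (hx : Tendsto (fun n : ℕ => (n : ℂ) * x n) atTop (𝓝 1)) (s : ℕ) : ∀ v : X,
    (N ^ (s + 1)) v = 0 →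
    Tendsto (fun n : ℕ => (((Real.log n) ^ s)⁻¹ : ℝ) • stepProd N x n v) atTop
      (𝓝 ((s.factorial : ℝ)⁻¹ • (N ^ s) v)) := by
  induction s with
  | zero =>
    intro v hv
    have hv' : N v = (0 : ℂ) • v := by simpa using hv
    simp [stepProd_eigenvector hv']
  | succ s ih =>
    intro v hv
    have hNv : (N ^ (s + 1)) (N v) = 0 := by
      rw [pow_succ] at hv; exact hv
    have h1 := ih (N v) hNv
    set w : X := (s.factorial : ℝ)⁻¹ • (N ^ s) (N v) with hw
    set g : ℕ → ℝ := fun i => (Real.log ((i + 1 : ℕ) : ℝ)) ^ (s + 1) - (Real.log i) ^ (s + 1)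
      with hg
    have hlogt : Tendsto (fun i : ℕ => Real.log i) atTop atTop :=
      Real.tendsto_log_atTop.comp tendsto_natCast_atTop_atTop
    have hsum : ∀ n, stepProd N x n v =
        v + ∑ i ∈ Finset.range n, x i • stepProd N x i (N v) := by
      intro n
      induction n with
      | zero => simp [stepProd_zero]
      | succ n ihn =>
        rw [stepProd_succ_apply, Finset.sum_range_succ, ← add_assoc, ← ihn, stepProd_apply_comm]
    have hgsum : ∀ n : ℕ, ∑ i ∈ Finset.range n, g i = (Real.log n) ^ (s + 1) := by
      intro n
      rw [hg, Finset.sum_range_sub (fun i : ℕ => (Real.log i) ^ (s + 1))]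
      simp
    have hg0 : 0 ≤ g := by
      intro i
      refine sub_nonneg.2 (pow_le_pow_left₀ (Real.log_natCast_nonneg i) ?_ _)
      rcases Nat.eq_zero_or_pos i with rfl | hi
      · simp
      · exact Real.log_le_log (by exact_mod_cast hi) (by push_cast; linarith)
    have hgt : Tendsto (fun n => ∑ i ∈ Finset.range n, g i) atTop atTop := by
      simp only [hgsum]
      exact (tendsto_pow_atTop (Nat.succ_ne_zero s)).comp hlogt
    set c : X := ((s : ℝ) + 1)⁻¹ • w with hc
    have hcmp := tendsto_log_comparison s
    have hlo : (fun i => x i • stepProd N x i (N v) - g i • c) =o[atTop] g := by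
      have hO : (fun i : ℕ => (Real.log i) ^ s / (i : ℝ)) =O[atTop] g := by
        have h2 := hcmp.inv₀ (by positivity)
        refine Asymptotics.isBigO_of_div_tendsto_nhds ?_ _ (h2.congr fun i => ?_)
        · filter_upwards [hlogt.eventually_gt_atTop 0, eventually_gt_atTop 0] with i hi hi0 h0
          exfalso
          have hi' : (0 : ℝ) < i := by exact_mod_cast hi0
          have : Real.log i < Real.log ((i + 1 : ℕ) : ℝ) :=
            Real.log_lt_log hi' (by push_cast; linarith)
          have h3 := pow_lt_pow_left₀ this hi.le (Nat.succ_ne_zero s)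
          exact (sub_pos.2 h3).ne' h0
        · simp [hg]
      refine Asymptotics.IsLittleO.trans_isBigO ?_ hO
      have h3 : Tendsto (fun i : ℕ => ((i : ℂ) * x i) •
          ((((Real.log i) ^ s)⁻¹ : ℝ) • stepProd N x i (N v)) -
          (g i / ((Real.log i) ^ s / i)) • c) atTop (𝓝 0) := by
        have h4 := (hx.smul h1).sub (hcmp.smul_const c)
        have h5 : (1 : ℂ) • w - ((s : ℝ) + 1) • c = 0 := by
          rw [hc, smul_smul, mul_inv_cancel₀ (by positivity), one_smul, one_smul, sub_self]
        rw [h5] at h4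
        exact h4
      rw [← Asymptotics.isLittleO_one_iff ℝ] at h3
      have h6 := (Asymptotics.isBigO_refl (fun i : ℕ => (Real.log i) ^ s / (i : ℝ))
        atTop).smul_isLittleO h3
      refine h6.congr' ?_ ?_
      · filter_upwards [hlogt.eventually_gt_atTop 0, eventually_gt_atTop 0] with i hi hi0
        have hi' : (i : ℝ) ≠ 0 := by exact_mod_cast hi0.ne'
        have hic : (i : ℂ) ≠ 0 := by exact_mod_cast hi0.ne'
        rw [smul_sub, smul_smul, mul_div_cancel₀ _ (by positivity)]
        congr 1
        rw [← Complex.coe_smul, ← Complex.coe_smul, smul_smul, smul_smul]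
        congr 1
        have hl : ((Real.log i : ℝ) : ℂ) ≠ 0 := by exact_mod_cast hi.ne'
        simp only [Complex.ofReal_div, Complex.ofReal_pow, Complex.ofReal_inv,
          Complex.ofReal_natCast]
        field_simp
      · exact Eventually.of_forall fun i => by simp
    have h7 := hlo.sum_range hg0 hgt
    simp only [hgsum] at h7
    have h8 := h7.tendsto_inv_smul_nhds_zero
    have hv0 : Tendsto (fun n : ℕ => ((Real.log n) ^ (s + 1))⁻¹ • v) atTop (𝓝 0) := by
      have : Tendsto (fun n : ℕ => ((Real.log n) ^ (s + 1))⁻¹) atTop (𝓝 0) :=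
        tendsto_inv_atTop_zero.comp ((tendsto_pow_atTop (Nat.succ_ne_zero s)).comp hlogt)
      simpa using this.smul_const v
    have h9 := (h8.add hv0).add_const c
    rw [zero_add, zero_add] at h9
    have hcv : c = ((s + 1).factorial : ℝ)⁻¹ • (N ^ (s + 1)) v := by
      rw [hc, hw, smul_smul, Nat.factorial_succ, pow_succ]
      push_cast
      rw [mul_inv]
      rfl
    rw [← hcv]
    refine h9.congr' ?_
    filter_upwards [hlogt.eventually_gt_atTop 0] with n hn
    rw [hsum n, Finset.sum_sub_distrib, ← Finset.sum_smul, hgsum, smul_sub, smul_smul,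
      inv_mul_cancel₀ (by positivity), one_smul, smul_add]
    abel

end StepProd

/-! ### Growth of the products for the steps `1 / (i + b)` -/

/-- The steps `1 / (i + b)`; with `b = 𝔪₀(E)` these are the inverse total masses of the urn. -/
def harmonicStep (b : ℝ) (i : ℕ) : ℂ := (((i + b)⁻¹ : ℝ) : ℂ)

theorem tendsto_cpow_div_add_cpow (lam : ℂ) (k : ℕ) :
    Tendsto (fun n : ℕ => (n : ℂ) ^ lam / ((n + k : ℕ) : ℂ) ^ lam) atTop (𝓝 1) := by
  have h1 : Tendsto (fun n : ℕ => (n : ℝ) / ((n + k : ℕ) : ℝ)) atTop (𝓝 1) := by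
    have := tendsto_natCast_div_add_atTop (𝕜 := ℝ) (k : ℝ)
    simpa using this
  have h2 : Tendsto (fun n : ℕ => (((n : ℝ) / ((n + k : ℕ) : ℝ) : ℝ) : ℂ) ^ lam) atTop (𝓝 1) := by
    have h3 : Tendsto (fun n : ℕ => (((n : ℝ) / ((n + k : ℕ) : ℝ) : ℝ) : ℂ)) atTop (𝓝 1) := by
      exact_mod_cast (Complex.continuous_ofReal.tendsto 1).comp h1
    have := h3.cpow (tendsto_const_nhds (x := lam)) (by simp)
    simpa using this
  refine h2.congr fun n => ?_
  have := Complex.div_cpow_ofReal_nonneg (a := (n : ℝ)) (b := ((n + k : ℕ) : ℝ))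
    (by positivity) (by positivity) lam
  rw [Complex.ofReal_div, this]
  norm_cast

/-- Euler's limit for `Γ`: the product is a quotient of two `GammaSeq` terms. -/
theorem tendsto_prod_harmonicStep {b : ℝ} (hb : 0 < b) {lam : ℂ} (hl : 0 ≤ lam.re) :
    Tendsto (fun n : ℕ => (∏ i ∈ Finset.range n, (1 + lam * harmonicStep b i)) / (n : ℂ) ^ lam)
      atTop (𝓝 (Complex.Gamma b / Complex.Gamma (b + lam))) := by
  have hG : Complex.Gamma (b + lam) ≠ 0 := Complex.Gamma_ne_zero_of_re_pos (by
    simp only [Complex.add_re, Complex.ofReal_re]; linarith)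
  rw [← tendsto_add_atTop_iff_nat 1]
  have h1 := ((Complex.GammaSeq_tendsto_Gamma b).div (Complex.GammaSeq_tendsto_Gamma (b + lam))
    hG).mul (tendsto_cpow_div_add_cpow lam 1)
  rw [mul_one] at h1
  refine h1.congr' ?_
  filter_upwards [eventually_gt_atTop 0] with n hn
  have hn' : (n : ℂ) ≠ 0 := by exact_mod_cast hn.ne'
  have hp : ∀ j : ℕ, (b : ℂ) + j ≠ 0 := fun j => by
    have : (0 : ℝ) < b + j := by positivity
    exact_mod_cast this.ne'
  have hp1 : ∏ j ∈ Finset.range (n + 1), ((b : ℂ) + j) ≠ 0 := Finset.prod_ne_zero_iff.2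
    fun j _ => hp j
  have hp2 : ∏ j ∈ Finset.range (n + 1), ((b : ℂ) + lam + j) ≠ 0 := by
    refine Finset.prod_ne_zero_iff.2 fun j _ h0 => ?_
    have := congrArg Complex.re h0
    simp only [Complex.add_re, Complex.ofReal_re, Complex.natCast_re, Complex.zero_re] at this
    have : (0 : ℝ) ≤ j := by positivity
    linarith
  have e : ∏ i ∈ Finset.range (n + 1), (1 + lam * harmonicStep b i) =
      (∏ j ∈ Finset.range (n + 1), ((b : ℂ) + lam + j)) /
        ∏ j ∈ Finset.range (n + 1), ((b : ℂ) + j) := by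
    rw [← Finset.prod_div_distrib]
    refine Finset.prod_congr rfl fun j _ => ?_
    have := hp j
    rw [harmonicStep]
    push_cast
    rw [add_comm (j : ℂ) b]
    field_simp
    ring
  have hf : (n.factorial : ℂ) ≠ 0 := by exact_mod_cast n.factorial_ne_zero
  have h3 : (n : ℂ) ^ (b : ℂ) ≠ 0 := (Complex.cpow_ne_zero_iff_of_exponent_ne_zero
    (by exact_mod_cast hb.ne')).2 hn'
  have h4 : (n : ℂ) ^ lam ≠ 0 := by
    rw [Complex.cpow_def_of_ne_zero hn']; exact Complex.exp_ne_zero _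
  have h5 : ((n + 1 : ℕ) : ℂ) ^ lam ≠ 0 := by
    rw [Complex.cpow_def_of_ne_zero (by exact_mod_cast n.succ_ne_zero)]; exact Complex.exp_ne_zero _
  simp only [Pi.div_apply]
  rw [e, Complex.GammaSeq, Complex.GammaSeq, Complex.cpow_add _ _ hn']
  field_simp

section Growth

variable {X : Type*} [NormedAddCommGroup X] [NormedSpace ℂ X] [CompleteSpace X]

/-- The growth bound on powers contained in Gelfand's formula. -/
theorem exists_norm_pow_le_of_spectralRadius_lt {A : Type*} [NormedRing A] [NormedAlgebra ℂ A]
    [CompleteSpace A] (a : A) {r : ℝ≥0} (hr : 0 < r) (h : spectralRadius ℂ a < r) :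
    ∃ C : ℝ, 0 ≤ C ∧ ∀ l : ℕ, ‖a ^ l‖ ≤ C * (r : ℝ) ^ l := by
  have h1 := (spectrum.pow_nnnorm_pow_one_div_tendsto_nhds_spectralRadius a).eventually
    (gt_mem_nhds h)
  obtain ⟨n0, hn0⟩ := eventually_atTop.1 h1
  refine ⟨1 + ∑ i ∈ Finset.range (n0 + 1), ‖a ^ i‖ / (r : ℝ) ^ i, by positivity, fun l => ?_⟩
  have hs : 0 ≤ ∑ i ∈ Finset.range (n0 + 1), ‖a ^ i‖ / (r : ℝ) ^ i := by positivity
  rcases lt_or_ge l (n0 + 1) with hl | hl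
  · rw [add_mul, one_mul]
    have h2 : ‖a ^ l‖ / (r : ℝ) ^ l ≤ ∑ i ∈ Finset.range (n0 + 1), ‖a ^ i‖ / (r : ℝ) ^ i :=
      Finset.single_le_sum (f := fun i => ‖a ^ i‖ / (r : ℝ) ^ i)
        (fun i _ => by positivity) (Finset.mem_range.2 hl)
    have h3 := (div_le_iff₀ (by positivity)).1 h2
    have : (0 : ℝ) < (r : ℝ) ^ l := by positivity
    linarith
  · have h2 := hn0 l (by omega)
    have hl0 : l ≠ 0 := by omega
    have h3 : (‖a ^ l‖₊ : ℝ≥0∞) ≤ (r : ℝ≥0∞) ^ l := by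
      rw [← ENNReal.rpow_inv_natCast_pow hl0 (‖a ^ l‖₊ : ℝ≥0∞), ← one_div]
      exact pow_le_pow_left₀ zero_le h2.le l
    have h4 : ‖a ^ l‖ ≤ (r : ℝ) ^ l := by exact_mod_cast h3
    have : (0 : ℝ) < (r : ℝ) ^ l := by positivity
    nlinarith

/-- If `Re z ≤ c` on the spectrum, then for small `ε` the spectral radius of `1 + ε U` is less than
`1 + ε d`, for any `d > c`, because `|1 + ε z|² = 1 + 2 ε Re z + O(ε²)`. -/
theorem exists_norm_pow_one_add_smul_le (U : X →L[ℂ] X) {c d : ℝ} (hc : 0 ≤ c) (hcd : c < d)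
    (hσ : ∀ z ∈ spectrum ℂ U, z.re ≤ c) :
    ∃ ε : ℝ, 0 < ε ∧ ∃ C : ℝ, 0 ≤ C ∧
      ∀ l : ℕ, ‖(1 + (ε : ℂ) • U) ^ l‖ ≤ C * (1 + ε * d) ^ l := by
  set M : ℝ := ‖U‖ * ‖(1 : X →L[ℂ] X)‖ with hM
  have hM0 : 0 ≤ M := by positivity
  set c1 : ℝ := (c + d) / 2 with hc1
  set ε : ℝ := 2 * (c1 - c) / (M ^ 2 + 1) with hε
  have hcc1 : c < c1 := by rw [hc1]; linarith
  have hε0 : 0 < ε := by rw [hε]; exact div_pos (by linarith) (by positivity)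
  have hεM : ε * M ^ 2 ≤ 2 * (c1 - c) := by
    have : ε * (M ^ 2 + 1) = 2 * (c1 - c) := by rw [hε]; field_simp
    nlinarith
  have hbound : ∀ k ∈ spectrum ℂ (1 + (ε : ℂ) • U), ‖k‖ ≤ 1 + ε * c1 := by
    intro k hk
    have hεc : (ε : ℂ) ≠ 0 := by exact_mod_cast hε0.ne'
    set z : ℂ := (k - 1) / ε with hz
    have hkz : k = 1 + ε * z := by rw [hz]; field_simp; ring
    have hzσ : z ∈ spectrum ℂ U := by
      rw [spectrum.mem_iff] at hk ⊢
      intro hu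
      apply hk
      have e : algebraMap ℂ (X →L[ℂ] X) k - (1 + (ε : ℂ) • U) =
          (ε : ℂ) • (algebraMap ℂ (X →L[ℂ] X) z - U) := by
        rw [hkz, map_add, map_one, map_mul, Algebra.algebraMap_eq_smul_one (ε : ℂ), smul_sub,
          smul_mul_assoc, one_mul]
        abel
      rw [e]
      exact hu.smul (Units.mk0 _ hεc)
    have hre := hσ z hzσ
    have hn : ‖z‖ ≤ M := spectrum.norm_le_norm_mul_of_mem hzσ
    have hn2 : ‖z‖ ^ 2 ≤ M ^ 2 := pow_le_pow_left₀ (norm_nonneg _) hn 2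
    have hsq : ‖k‖ ^ 2 ≤ (1 + ε * c1) ^ 2 := by
      have e : ‖k‖ ^ 2 = 1 + 2 * ε * z.re + ε ^ 2 * ‖z‖ ^ 2 := by
        rw [hkz, ← Complex.normSq_eq_norm_sq, ← Complex.normSq_eq_norm_sq, Complex.normSq_apply,
          Complex.normSq_apply]
        simp
        ring
      have h1 : ε ^ 2 * ‖z‖ ^ 2 ≤ ε * (2 * (c1 - c)) := by
        calc ε ^ 2 * ‖z‖ ^ 2 ≤ ε ^ 2 * M ^ 2 := by gcongr
          _ = ε * (ε * M ^ 2) := by ring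
          _ ≤ _ := by gcongr
      have h2 : 2 * ε * z.re ≤ 2 * ε * c := by gcongr
      nlinarith [sq_nonneg (ε * c1)]
    have h0 : 0 ≤ 1 + ε * c1 := by
      have : 0 ≤ c1 := by linarith
      positivity
    exact (pow_le_pow_iff_left₀ (norm_nonneg k) h0 two_ne_zero).1 hsq
  have hd : 0 < 1 + ε * d := by
    have : 0 < d := by linarith
    positivity
  have hc1d : 1 + ε * c1 < 1 + ε * d := by
    have : c1 < d := by rw [hc1]; linarith
    gcongr
  have hc10 : 0 ≤ 1 + ε * c1 := by
    have : 0 ≤ c1 := by linarith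
    positivity
  refine ⟨ε, hε0, ?_⟩
  let r : ℝ≥0 := ⟨1 + ε * d, hd.le⟩
  let r1 : ℝ≥0 := ⟨1 + ε * c1, hc10⟩
  have hlt : spectralRadius ℂ (1 + (ε : ℂ) • U) < r := by
    have h1 : spectralRadius ℂ (1 + (ε : ℂ) • U) ≤ r1 :=
      iSup₂_le fun k hk => by
        exact enorm_le_coe.2 (NNReal.coe_le_coe.1 (hbound k hk))
    refine h1.trans_lt ?_
    exact ENNReal.coe_lt_coe.2 (NNReal.coe_lt_coe.1 hc1d)
  exact exists_norm_pow_le_of_spectralRadius_lt _ (r := r) (NNReal.coe_pos.1 hd) hlt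

/-- As soon as `δ ≤ ε`, the factor `1 + δ U` is a convex combination of `1` and `1 + ε U`, so the
power bounds on `1 + ε U` bound the products. -/
theorem stepProd_isBigO (U : X →L[ℂ] X) {b c d : ℝ} (hb : 0 < b) (hc : 0 ≤ c) (hcd : c < d)
    (hσ : ∀ z ∈ spectrum ℂ U, z.re ≤ c) :
    (fun n => stepProd U (harmonicStep b) n) =O[atTop] fun n : ℕ => (n : ℝ) ^ d := by
  obtain ⟨ε, hε, C, hC, hA⟩ := exists_norm_pow_one_add_smul_le U hc hcd hσ
  have hd : 0 < d := by linarith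
  set A : X →L[ℂ] X := 1 + (ε : ℂ) • U with hAdef
  have hδt : Tendsto (fun i : ℕ => ((i : ℝ) + b)⁻¹) atTop (𝓝 0) :=
    tendsto_inv_atTop_zero.comp (tendsto_natCast_atTop_atTop.atTop_add tendsto_const_nhds)
  obtain ⟨i0, hi0⟩ := eventually_atTop.1 (hδt.eventually (ge_mem_nhds hε))
  set p : ℕ → ℝ := fun n => ∏ i ∈ Finset.range n, (1 + d * ((i : ℝ) + b)⁻¹) with hp
  have hp1 : ∀ n, 1 ≤ p n := fun n => Finset.one_le_prod fun i _ => by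
    have : 0 ≤ d * ((i : ℝ) + b)⁻¹ := by positivity
    linarith
  set K : ℝ := C * ‖stepProd U (harmonicStep b) i0‖ with hK
  have hbd : ∀ n, i0 ≤ n → ∀ l, ‖A ^ l * stepProd U (harmonicStep b) n‖ ≤
      K * (1 + ε * d) ^ l * p n := by
    intro n hn
    induction n, hn using Nat.le_induction with
    | base =>
      intro l
      calc ‖A ^ l * stepProd U (harmonicStep b) i0‖
          ≤ ‖A ^ l‖ * ‖stepProd U (harmonicStep b) i0‖ := norm_mul_le _ _
        _ ≤ C * (1 + ε * d) ^ l * ‖stepProd U (harmonicStep b) i0‖ := by gcongr; exact hA l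
        _ = K * (1 + ε * d) ^ l * 1 := by rw [hK]; ring
        _ ≤ _ := by gcongr; exact hp1 _
    | succ n hn ih =>
      intro l
      set δ : ℝ := ((n : ℝ) + b)⁻¹ with hδ
      have hδ0 : 0 ≤ δ := by positivity
      have hδε : δ / ε ≤ 1 := (div_le_one hε).2 (hi0 n hn)
      have e : A ^ l * stepProd U (harmonicStep b) (n + 1) =
          ((1 - δ / ε : ℝ) : ℂ) • (A ^ l * stepProd U (harmonicStep b) n) +
          ((δ / ε : ℝ) : ℂ) • (A ^ (l + 1) * stepProd U (harmonicStep b) n) := by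
        have e1 : (1 + harmonicStep b n • U : X →L[ℂ] X) =
            ((1 - δ / ε : ℝ) : ℂ) • (1 : X →L[ℂ] X) + ((δ / ε : ℝ) : ℂ) • A := by
          have hεc : (ε : ℂ) ≠ 0 := by exact_mod_cast hε.ne'
          have e2 : harmonicStep b n = (δ / ε : ℂ) * ε := by
            rw [harmonicStep, ← hδ]; field_simp
          rw [hAdef, smul_add, smul_smul, e2]
          push_cast
          rw [sub_smul, one_smul]
          abel
        rw [stepProd_succ, e1, pow_succ, add_mul, mul_add, smul_mul_assoc, one_mul, mul_smul_comm,
          smul_mul_assoc, mul_smul_comm, mul_assoc]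
      have hps : p (n + 1) = p n * (1 + d * δ) := by rw [hp]; exact Finset.prod_range_succ _ _
      rw [e]
      calc _ ≤ (1 - δ / ε) * (K * (1 + ε * d) ^ l * p n) +
            (δ / ε) * (K * (1 + ε * d) ^ (l + 1) * p n) := by
            refine (norm_add_le _ _).trans (add_le_add ?_ ?_)
            · rw [norm_smul, Complex.norm_real, Real.norm_of_nonneg (by linarith)]
              exact mul_le_mul_of_nonneg_left (ih l) (by linarith)
            · rw [norm_smul, Complex.norm_real, Real.norm_of_nonneg (by positivity)]
              exact mul_le_mul_of_nonneg_left (ih (l + 1)) (by positivity)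
        _ = _ := by rw [hps, pow_succ]; field_simp; ring
  have hpO : p =O[atTop] fun n : ℕ => (n : ℝ) ^ d := by
    have h1 := (tendsto_prod_harmonicStep hb (lam := (d : ℂ)) (by simpa using hd.le)).norm
    refine Asymptotics.isBigO_of_div_tendsto_nhds ?_ (c := ‖Complex.Gamma b /
      Complex.Gamma (b + d)‖) (h1.congr' ?_)
    · filter_upwards [eventually_gt_atTop 0] with n hn h0
      exact absurd h0 (Real.rpow_pos_of_pos (by exact_mod_cast hn) _).ne'
    · filter_upwards [eventually_gt_atTop 0] with n hn
      rw [norm_div, Complex.norm_natCast_cpow_of_pos hn, Complex.ofReal_re]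
      simp only [Pi.div_apply]
      congr 1
      have : (∏ i ∈ Finset.range n, (1 + (d : ℂ) * harmonicStep b i)) = ((p n : ℝ) : ℂ) := by
        rw [hp]; push_cast [harmonicStep]; rfl
      rw [this, Complex.norm_real, Real.norm_of_nonneg (zero_le_one.trans (hp1 n))]
  refine Asymptotics.IsBigO.trans (Asymptotics.IsBigO.of_bound K ?_) hpO
  filter_upwards [eventually_ge_atTop i0] with n hn
  have := hbd n hn 0
  rw [pow_zero, one_mul, pow_zero, mul_one] at this
  exact this.trans (mul_le_mul_of_nonneg_left (le_abs_self _) (by positivity))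

end Growth

/-! ### Riesz projections -/

section Riesz

theorem circleIntegral_clm_comp {F G : Type*} [NormedAddCommGroup F] [NormedSpace ℂ F]
    [CompleteSpace F] [NormedAddCommGroup G] [NormedSpace ℂ G] [CompleteSpace G] (L : F →L[ℂ] G)
    {f : ℂ → F} {c : ℂ} {R : ℝ} (hf : CircleIntegrable f c R) :
    ∮ z in C(c, R), L (f z) = L (∮ z in C(c, R), f z) := by
  unfold circleIntegral
  rw [← ContinuousLinearMap.intervalIntegral_comp_comm L hf.out]
  simp only [map_smul]

variable {A : Type*} [NormedRing A] [NormedAlgebra ℂ A]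

/-- The contour integral `(2πi)⁻¹ ∮ (ζ - T)⁻¹ dζ` over the circle of centre `z` and radius `r`. -/
def contourProjection (T : A) (z : ℂ) (r : ℝ) : A :=
  (2 * Real.pi * Complex.I : ℂ)⁻¹ • ∮ ζ in C(z, r), resolvent T ζ

variable {T : A} {z : ℂ} {r : ℝ}

theorem sphere_subset_resolventSet (hr : 0 < r)
    (hT : Metric.closedBall z r ∩ spectrum ℂ T ⊆ {z}) {ζ : ℂ} (hζ : ζ ∈ Metric.sphere z r) :
    ζ ∈ resolventSet ℂ T ∧ ζ ≠ z := by
  have hne : ζ ≠ z := by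
    rintro rfl
    simp [hr.ne] at hζ
  refine ⟨?_, hne⟩
  by_contra h
  exact hne (hT ⟨Metric.sphere_subset_closedBall hζ, h⟩)

theorem sub_mul_resolvent {ζ : ℂ} (hζ : ζ ∈ resolventSet ℂ T) :
    (algebraMap ℂ A ζ - T) * resolvent T ζ = 1 := by
  rw [spectrum.resolvent_eq hζ]; exact IsUnit.mul_val_inv hζ

theorem resolvent_mul_sub {ζ : ℂ} (hζ : ζ ∈ resolventSet ℂ T) :
    resolvent T ζ * (algebraMap ℂ A ζ - T) = 1 := by
  rw [spectrum.resolvent_eq hζ]; exact IsUnit.val_inv_mul hζ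

theorem commute_resolvent {S : A} (h : Commute S T) (ζ : ℂ) : Commute S (resolvent T ζ) := by
  by_cases hζ : ζ ∈ resolventSet ℂ T
  · rw [spectrum.resolvent_eq hζ]
    refine Commute.units_inv_right ?_
    exact (Commute.symm (Algebra.commutes ζ S)).sub_right h
  · rw [spectrum.resolvent_zero_of_mem_spectrum hζ]
    exact Commute.zero_right S

/-- On elements annihilated by `(T - w) ^ k`, the resolvent is a polynomial in `(ζ - w)⁻¹`. -/
theorem resolvent_mul_of_pow_mul_eq_zero {w : ℂ} {Q : A} {k : ℕ}
    (hQ : (T - algebraMap ℂ A w) ^ k * Q = 0) {ζ : ℂ} (hζ : ζ ∈ resolventSet ℂ T) (hne : ζ ≠ w) :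
    resolvent T ζ * Q =
      ∑ s ∈ Finset.range k, ((ζ - w) ^ (s + 1))⁻¹ • ((T - algebraMap ℂ A w) ^ s * Q) := by
  set N := T - algebraMap ℂ A w with hN
  have hw : ζ - w ≠ 0 := sub_ne_zero.2 hne
  have key : (algebraMap ℂ A ζ - T) *
      ∑ s ∈ Finset.range k, ((ζ - w) ^ (s + 1))⁻¹ • (N ^ s * Q) = Q := by
    have e : algebraMap ℂ A ζ - T = algebraMap ℂ A (ζ - w) - N := by
      rw [hN, map_sub]; abel
    rw [e, Finset.mul_sum]
    have e2 : ∀ s ∈ Finset.range k, (algebraMap ℂ A (ζ - w) - N) *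
        ((ζ - w) ^ (s + 1))⁻¹ • (N ^ s * Q) =
        -(((ζ - w) ^ (s + 1))⁻¹ • (N ^ (s + 1) * Q) - ((ζ - w) ^ s)⁻¹ • (N ^ s * Q)) := by
      intro s _
      rw [sub_mul, Algebra.algebraMap_eq_smul_one, smul_mul_assoc, one_mul, smul_smul,
        mul_smul_comm, pow_succ' N, mul_assoc, neg_sub]
      congr 2
      rw [pow_succ]
      field_simp
    rw [Finset.sum_congr rfl e2, Finset.sum_neg_distrib,
      Finset.sum_range_sub (fun s => ((ζ - w) ^ s)⁻¹ • (N ^ s * Q)), hQ]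
    simp
  calc resolvent T ζ * Q = resolvent T ζ * ((algebraMap ℂ A ζ - T) *
      ∑ s ∈ Finset.range k, ((ζ - w) ^ (s + 1))⁻¹ • (N ^ s * Q)) := by rw [key]
    _ = _ := by rw [← mul_assoc, resolvent_mul_sub hζ, one_mul]

variable [CompleteSpace A]

theorem continuousOn_resolvent : ContinuousOn (resolvent T) (resolventSet ℂ T) :=
  fun _ hζ => (spectrum.hasDerivAt_resolvent_const_left hζ).continuousAt.continuousWithinAt

theorem circleIntegrable_resolvent (hr : 0 < r)
    (hT : Metric.closedBall z r ∩ spectrum ℂ T ⊆ {z}) : CircleIntegrable (resolvent T) z r :=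
  (continuousOn_resolvent.mono fun _ hζ =>
    (sphere_subset_resolventSet hr hT hζ).1).circleIntegrable hr.le

theorem commute_circleIntegral {S : A} {f : ℂ → A} (hf : CircleIntegrable f z r)
    (h : ∀ ζ, Commute S (f ζ)) : Commute S (∮ ζ in C(z, r), f ζ) := by
  have h1 := circleIntegral_clm_comp (ContinuousLinearMap.mul ℂ A S) hf
  have h2 := circleIntegral_clm_comp ((ContinuousLinearMap.mul ℂ A).flip S) hf
  simp only [ContinuousLinearMap.flip_apply, ContinuousLinearMap.mul_apply'] at h1 h2
  rw [commute_iff_eq, ← h1, ← h2]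
  simp only [fun ζ => (h ζ).eq]

theorem commute_contourProjection (hr : 0 < r)
    (hT : Metric.closedBall z r ∩ spectrum ℂ T ⊆ {z}) {S : A} (h : Commute S T) :
    Commute S (contourProjection T z r) :=
  (commute_circleIntegral (circleIntegrable_resolvent hr hT) (commute_resolvent h)).smul_right _

/-- `z - T` is invertible off the range of the projection at `z`: the inverse is given by the
Cauchy integral `(2πi)⁻¹ ∮ (ζ - z)⁻¹ (ζ - T)⁻¹ dζ`. -/
theorem exists_sub_mul_eq_one_sub_contourProjection (hr : 0 < r)
    (hT : Metric.closedBall z r ∩ spectrum ℂ T ⊆ {z}) :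
    ∃ F : A, (∀ S, Commute S T → Commute S F) ∧
      (algebraMap ℂ A z - T) * F = 1 - contourProjection T z r := by
  have hint : CircleIntegrable (fun ζ => (ζ - z)⁻¹ • resolvent T ζ) z r := by
    refine ContinuousOn.circleIntegrable hr.le (ContinuousOn.smul ?_ (continuousOn_resolvent.mono
      fun _ hζ => (sphere_subset_resolventSet hr hT hζ).1))
    exact ContinuousOn.inv₀ (by fun_prop) fun ζ hζ =>
      sub_ne_zero.2 (sphere_subset_resolventSet hr hT hζ).2
  have hint1 : CircleIntegrable (fun ζ => (ζ - z)⁻¹ • (1 : A)) z r := by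
    refine ContinuousOn.circleIntegrable hr.le (ContinuousOn.smul ?_ continuousOn_const)
    exact ContinuousOn.inv₀ (by fun_prop) fun ζ hζ =>
      sub_ne_zero.2 (sphere_subset_resolventSet hr hT hζ).2
  refine ⟨(2 * Real.pi * Complex.I : ℂ)⁻¹ • ∮ ζ in C(z, r), (ζ - z)⁻¹ • resolvent T ζ,
    fun S hS => (commute_circleIntegral hint fun ζ =>
      (commute_resolvent hS ζ).smul_right _).smul_right _, ?_⟩
  have h1 := circleIntegral_clm_comp (ContinuousLinearMap.mul ℂ A (algebraMap ℂ A z - T)) hint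
  simp only [ContinuousLinearMap.mul_apply'] at h1
  have h2 : ∮ ζ in C(z, r), (algebraMap ℂ A z - T) * ((ζ - z)⁻¹ • resolvent T ζ) =
      ∮ ζ in C(z, r), ((ζ - z)⁻¹ • (1 : A) - resolvent T ζ) := by
    refine circleIntegral.integral_congr hr.le fun ζ hζ => ?_
    obtain ⟨hres, hne⟩ := sphere_subset_resolventSet hr hT hζ
    have e : algebraMap ℂ A z - T = (algebraMap ℂ A ζ - T) - algebraMap ℂ A (ζ - z) := by
      rw [map_sub]; abel
    rw [mul_smul_comm, e, sub_mul, sub_mul_resolvent hres, smul_sub, Algebra.algebraMap_eq_smul_one,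
      smul_mul_assoc, one_mul, smul_smul, inv_mul_cancel₀ (sub_ne_zero.2 hne), one_smul]
  rw [mul_smul_comm, ← h1, h2, circleIntegral.integral_sub hint1
    (circleIntegrable_resolvent hr hT), circleIntegral.integral_smul_const,
    circleIntegral.integral_sub_center_inv z hr.ne', smul_sub, smul_smul,
    inv_mul_cancel₀ Complex.two_pi_I_ne_zero, one_smul]
  rfl

/-- On an element annihilated by `(T - w) ^ k` the resolvent is a finite sum of powers of `(ζ - w)⁻¹`,
so the contour integral reduces to scalar ones. -/
theorem contourProjection_mul (hr : 0 < r) (hT : Metric.closedBall z r ∩ spectrum ℂ T ⊆ {z})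
    {w : ℂ} (hw : w ∉ Metric.sphere z r) {Q : A} {k : ℕ}
    (hQ : (T - algebraMap ℂ A w) ^ k * Q = 0) :
    contourProjection T z r * Q = ∑ s ∈ Finset.range k,
      ((2 * Real.pi * Complex.I : ℂ)⁻¹ * ∮ ζ in C(z, r), ((ζ - w) ^ (s + 1))⁻¹) •
        ((T - algebraMap ℂ A w) ^ s * Q) := by
  have hwne : ∀ ζ ∈ Metric.sphere z r, ζ ≠ w := fun ζ hζ h => hw (h ▸ hζ)
  have h1 := circleIntegral_clm_comp ((ContinuousLinearMap.mul ℂ A).flip Q)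
    (circleIntegrable_resolvent hr hT)
  simp only [ContinuousLinearMap.flip_apply, ContinuousLinearMap.mul_apply'] at h1
  rw [contourProjection, smul_mul_assoc, ← h1, circleIntegral.integral_congr hr.le
    (fun ζ hζ => resolvent_mul_of_pow_mul_eq_zero hQ (sphere_subset_resolventSet hr hT hζ).1
      (hwne ζ hζ)), circleIntegral.integral_fun_sum, Finset.smul_sum]
  · refine Finset.sum_congr rfl fun s _ => ?_
    rw [circleIntegral.integral_smul_const, smul_smul]
  · intro s _
    refine ContinuousOn.circleIntegrable hr.le (ContinuousOn.smul ?_ continuousOn_const)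
    exact ContinuousOn.inv₀ (by fun_prop) fun ζ hζ => pow_ne_zero _ (sub_ne_zero.2 (hwne ζ hζ))

theorem contourProjection_mul_self (hr : 0 < r) (hT : Metric.closedBall z r ∩ spectrum ℂ T ⊆ {z})
    {Q : A} {k : ℕ} (hk : 1 ≤ k) (hQ : (T - algebraMap ℂ A z) ^ k * Q = 0) :
    contourProjection T z r * Q = Q := by
  rw [contourProjection_mul hr hT (by simp [hr.ne]) hQ,
    Finset.sum_eq_single_of_mem 0 (Finset.mem_range.2 hk)]
  · simp only [zero_add, pow_one, pow_zero, one_mul]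
    rw [circleIntegral.integral_sub_center_inv z hr.ne', inv_mul_cancel₀ Complex.two_pi_I_ne_zero,
      one_smul]
  · intro s _ hs
    have h1 := circleIntegral.integral_sub_zpow_of_ne (n := -((s : ℤ) + 1)) (by omega) z z r
    have h2 : ∀ ζ : ℂ, (ζ - z) ^ (-((s : ℤ) + 1)) = ((ζ - z) ^ (s + 1))⁻¹ := fun ζ => by
      rw [zpow_neg]; norm_cast
    simp only [h2] at h1
    rw [h1, mul_zero, zero_smul]

theorem contourProjection_mul_eq_zero (hr : 0 < r)
    (hT : Metric.closedBall z r ∩ spectrum ℂ T ⊆ {z}) {w : ℂ} (hw : w ∉ Metric.closedBall z r)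
    {Q : A} {k : ℕ} (hQ : (T - algebraMap ℂ A w) ^ k * Q = 0) :
    contourProjection T z r * Q = 0 := by
  rw [contourProjection_mul hr hT (fun h => hw (Metric.sphere_subset_closedBall h)) hQ]
  refine Finset.sum_eq_zero fun s _ => ?_
  have hne : ∀ ζ ∈ Metric.closedBall z r, ζ - w ≠ 0 := fun ζ hζ h =>
    hw (sub_eq_zero.1 h ▸ hζ)
  rw [Complex.circleIntegral_eq_zero_of_differentiable_on_off_countable hr.le
    Set.countable_empty, mul_zero, zero_smul]
  · exact ContinuousOn.inv₀ (by fun_prop) fun ζ hζ => pow_ne_zero _ (hne ζ hζ)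
  · intro ζ hζ
    exact DifferentiableAt.inv (by fun_prop) (pow_ne_zero _ (hne ζ
      (Metric.ball_subset_closedBall hζ.1)))

section Sum

variable (S : Finset ℂ) (rad : ℂ → ℝ) (κ : ℕ) (hκ : 1 ≤ κ)
  (hS : ∀ z ∈ S, z ∈ spectrum ℂ T) (hrad : ∀ z ∈ S, 0 < rad z)
  (hT : ∀ z ∈ S, Metric.closedBall z (rad z) ∩ spectrum ℂ T ⊆ {z})
  (hnil : ∀ z ∈ S, (T - algebraMap ℂ A z) ^ κ * contourProjection T z (rad z) = 0)

include hκ hS hrad hT hnil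

theorem contourProjection_mul_sum {z : ℂ} (hz : z ∈ S) :
    contourProjection T z (rad z) * ∑ w ∈ S, contourProjection T w (rad w) =
      contourProjection T z (rad z) := by
  rw [Finset.mul_sum, Finset.sum_eq_single_of_mem z hz]
  · exact contourProjection_mul_self (hrad z hz) (hT z hz) hκ (hnil z hz)
  · intro w hw hwz
    refine contourProjection_mul_eq_zero (hrad z hz) (hT z hz) (fun h => hwz ?_) (hnil w hw)
    exact hT z hz ⟨h, hS w hw⟩

theorem sum_contourProjection_mul_self :
    (∑ w ∈ S, contourProjection T w (rad w)) * ∑ w ∈ S, contourProjection T w (rad w) =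
      ∑ w ∈ S, contourProjection T w (rad w) := by
  conv_lhs => rw [Finset.sum_mul]
  exact Finset.sum_congr rfl fun z hz => contourProjection_mul_sum S rad κ hκ hS hrad hT hnil hz

/-- Removing finitely many nilpotent spectral components: if `Π` is the sum of the projections at
the points of `S`, then the spectrum of `T (1 - Π)` is contained in `(σ(T) \ S) ∪ {0}`. -/
theorem spectrum_mul_one_sub_sum_subset :
    spectrum ℂ (T * (1 - ∑ z ∈ S, contourProjection T z (rad z))) ⊆
      (spectrum ℂ T \ S) ∪ {0} := by
  have hmul := fun z hz => contourProjection_mul_sum S rad κ hκ hS hrad hT hnil (z := z) hz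
  have hidem := sum_contourProjection_mul_self S rad κ hκ hS hrad hT hnil
  have hcomm : ∀ B, Commute B T → Commute B (∑ z ∈ S, contourProjection T z (rad z)) :=
    fun B hB => Commute.sum_right _ _ _ fun z hz =>
      commute_contourProjection (hrad z hz) (hT z hz) hB
  set p : A := ∑ z ∈ S, contourProjection T z (rad z) with hp
  have hq : (1 - p) * (1 - p) = 1 - p := by
    rw [mul_sub, mul_one, sub_mul, one_mul, hidem]; abel
  have hqp : (1 - p) * p = 0 := by rw [sub_mul, one_mul, hidem, sub_self]
  intro ζ hζ
  by_contra hcon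
  rw [Set.mem_union, not_or, Set.mem_singleton_iff, Set.mem_sdiff, not_and, not_not] at hcon
  obtain ⟨h1, h0⟩ := hcon
  have hF : ∃ F : A, (∀ B, Commute B T → Commute B F) ∧
      (algebraMap ℂ A ζ - T) * F * (1 - p) = 1 - p := by
    by_cases hsp : ζ ∈ spectrum ℂ T
    · have hzS : ζ ∈ S := h1 hsp
      obtain ⟨F, hFc, hF⟩ := exists_sub_mul_eq_one_sub_contourProjection (hrad ζ hzS) (hT ζ hzS)
      refine ⟨F, hFc, ?_⟩
      rw [hF, sub_mul, one_mul, mul_sub, mul_one, hmul ζ hzS, sub_self, sub_zero]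
    · have hres : ζ ∈ resolventSet ℂ T := by simpa [spectrum] using hsp
      exact ⟨resolvent T ζ, fun B hB => commute_resolvent hB ζ, by
        rw [sub_mul_resolvent hres, one_mul]⟩
  obtain ⟨F, hFc, hF⟩ := hF
  have hTp : Commute T p := hcomm T (Commute.refl T)
  have hTF : Commute T F := hFc T (Commute.refl T)
  have hpF : Commute p F := hFc p (hTp.symm)
  have hTq : Commute T (1 - p) := (Commute.one_right T).sub_right hTp
  have hqF : Commute (1 - p) F := (Commute.one_left F).sub_left hpF
  have hqpc : Commute (1 - p) p := (Commute.one_left p).sub_left (Commute.refl p)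
  set G : A := F * (1 - p) + ζ⁻¹ • p with hG
  have hUG : Commute (T * (1 - p)) G :=
    (((hTF.mul_right hTq).mul_left (hqF.mul_right (Commute.refl _))).add_right
      ((hTp.mul_left hqpc).smul_right _))
  have hright : (algebraMap ℂ A ζ - T * (1 - p)) * G = 1 := by
    have e1 : T * (1 - p) * (F * (1 - p)) = T * F * (1 - p) := by
      rw [mul_assoc T (1 - p), ← mul_assoc (1 - p) F, hqF.eq, mul_assoc F, hq, mul_assoc]
    have e2 : T * (1 - p) * (ζ⁻¹ • p) = 0 := by
      rw [mul_smul_comm, mul_assoc, hqp, mul_zero, smul_zero]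
    have e3 : algebraMap ℂ A ζ * (ζ⁻¹ • p) = p := by
      rw [Algebra.algebraMap_eq_smul_one, smul_mul_assoc, one_mul, smul_smul, mul_inv_cancel₀ h0,
        one_smul]
    rw [hG, sub_mul, mul_add, mul_add, e1, e2, e3, add_zero, ← mul_assoc,
      add_sub_right_comm, ← sub_mul, ← sub_mul, hF]
    abel
  have hleft : G * (algebraMap ℂ A ζ - T * (1 - p)) = 1 := by
    have hζG : Commute (algebraMap ℂ A ζ) G := Algebra.commutes ζ G
    rw [← (hζG.sub_left hUG).eq, hright]
  exact hζ (spectrum.mem_resolventSet_of_left_right_inverse hright hleft)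

end Sum

end Riesz

/-! ### Asymptotics of the products on the spectral components -/

section Asymptotics

variable {X : Type*} [NormedAddCommGroup X] [NormedSpace ℂ X]

theorem spectralProjection_eq_contourProjection {T : X →L[ℂ] X} {z : ℂ}
    (h : ∃ r : ℝ, 0 < r ∧ Metric.closedBall z r ∩ spectrum ℂ T ⊆ {z}) :
    spectralProjection T z = contourProjection T z h.choose := by
  rw [spectralProjection, dif_pos h]
  rfl

variable [CompleteSpace X]

omit [CompleteSpace X] in
theorem stepProd_mul_eq_of_commute {T q : X →L[ℂ] X} (hq : q * q = q) (hTq : Commute T q)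
    (δ : ℕ → ℂ) (n : ℕ) : stepProd T δ n * q = stepProd (T * q) δ n * q := by
  induction n with
  | zero => rfl
  | succ n ih =>
    have hc : Commute q (stepProd (T * q) δ n) :=
      commute_stepProd (hTq.symm.mul_right (Commute.refl q)) δ n
    have h1 : q * (stepProd (T * q) δ n * q) = stepProd (T * q) δ n * q := by
      rw [← mul_assoc, hc.eq, mul_assoc, hq]
    rw [stepProd_succ, stepProd_succ, mul_assoc, ih, mul_assoc, add_mul, add_mul, smul_mul_assoc,
      smul_mul_assoc, mul_assoc T q, h1]

/-- After removal of finitely many nilpotent spectral components, the products grow at the rate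
given by the rest of the spectrum. -/
theorem stepProd_remainder_isBigO {T : X →L[ℂ] X} (S : Finset ℂ) (κ : ℕ) (hκ : 1 ≤ κ)
    (hS : ∀ z ∈ S, z ∈ spectrum ℂ T)
    (hT : ∀ z ∈ S, ∃ r : ℝ, 0 < r ∧ Metric.closedBall z r ∩ spectrum ℂ T ⊆ {z})
    (hnil : ∀ z ∈ S, (T - algebraMap ℂ (X →L[ℂ] X) z) ^ κ * spectralProjection T z = 0)
    {b c d : ℝ} (hb : 0 < b) (hc : 0 ≤ c) (hcd : c < d)
    (hσ : ∀ z ∈ spectrum ℂ T, z ∉ S → z.re ≤ c) (v : X) :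
    (fun n => stepProd T (harmonicStep b) n (v - ∑ z ∈ S, spectralProjection T z v)) =O[atTop]
      fun n : ℕ => (n : ℝ) ^ d := by
  classical
  have hT' := hT
  choose! rad hrad hball using hT'
  set rad' : ℂ → ℝ := fun z => if h : ∃ r : ℝ, 0 < r ∧ Metric.closedBall z r ∩ spectrum ℂ T ⊆ {z}
    then h.choose else 0 with hrad'
  have hproj : ∀ z ∈ S, spectralProjection T z = contourProjection T z (rad' z) := fun z hz => by
    rw [spectralProjection_eq_contourProjection (hT z hz), hrad']
    simp only [dif_pos (hT z hz)]
  have hr1 : ∀ z ∈ S, 0 < rad' z := fun z hz => by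
    simp only [hrad', dif_pos (hT z hz)]
    exact (hT z hz).choose_spec.1
  have hr2 : ∀ z ∈ S, Metric.closedBall z (rad' z) ∩ spectrum ℂ T ⊆ {z} := fun z hz => by
    simp only [hrad', dif_pos (hT z hz)]
    exact (hT z hz).choose_spec.2
  have hnil' : ∀ z ∈ S,
      (T - algebraMap ℂ (X →L[ℂ] X) z) ^ κ * contourProjection T z (rad' z) = 0 :=
    fun z hz => by rw [← hproj z hz]; exact hnil z hz
  have hsum : ∑ z ∈ S, spectralProjection T z = ∑ z ∈ S, contourProjection T z (rad' z) :=
    Finset.sum_congr rfl hproj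
  have hidem := sum_contourProjection_mul_self S rad' κ hκ hS hr1 hr2 hnil'
  have hspec := spectrum_mul_one_sub_sum_subset S rad' κ hκ hS hr1 hr2 hnil'
  have hcomm : Commute T (∑ z ∈ S, contourProjection T z (rad' z)) :=
    Commute.sum_right _ _ _ fun z hz =>
      commute_contourProjection (hr1 z hz) (hr2 z hz) (Commute.refl T)
  rw [← hsum] at hidem hspec hcomm
  set p : X →L[ℂ] X := ∑ z ∈ S, spectralProjection T z with hp
  have hq : (1 - p) * (1 - p) = 1 - p := by
    rw [mul_sub, mul_one, sub_mul, one_mul, hidem]; abel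
  have hTq : Commute T (1 - p) := (Commute.one_right T).sub_right hcomm
  have hU := stepProd_isBigO (T * (1 - p)) hb hc hcd (fun z hz => by
    rcases hspec hz with h | h
    · exact hσ z h.1 (by simpa using h.2)
    · rw [Set.mem_singleton_iff.1 h]; simpa using hc)
  have e : ∀ n, stepProd T (harmonicStep b) n (v - ∑ z ∈ S, spectralProjection T z v) =
      stepProd (T * (1 - p)) (harmonicStep b) n ((1 - p) v) := by
    intro n
    have h1 := DFunLike.congr_fun (stepProd_mul_eq_of_commute hq hTq (harmonicStep b) n) v
    have h2 : (1 - p) v = v - ∑ z ∈ S, spectralProjection T z v := by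
      rw [hp]; simp
    rw [← h2]
    exact h1
  simp only [e]
  refine Asymptotics.IsBigO.trans (Asymptotics.IsBigO.of_bound ‖(1 - p) v‖ ?_) hU
  exact Eventually.of_forall fun n => by
    rw [mul_comm]; exact ContinuousLinearMap.le_opNorm _ _

theorem IsSLQC.exists_re_le {T : X →L[ℂ] X} (h : IsSLQC T) :
    ∃ c : ℝ, 0 ≤ c ∧ c < 1 ∧ ∀ z ∈ spectrum ℂ T, z ≠ 1 → z.re ≤ c := by
  obtain ⟨r, hr, hball⟩ := h.isolated
  have hK : IsCompact (spectrum ℂ T \ Metric.ball 1 r) :=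
    (spectrum.isCompact T).diff Metric.isOpen_ball
  have hmem : ∀ z ∈ spectrum ℂ T, z ≠ 1 → z ∈ spectrum ℂ T \ Metric.ball 1 r := fun z hz hne =>
    ⟨hz, fun hb => hne (hball ⟨Metric.ball_subset_closedBall hb, hz⟩)⟩
  rcases (spectrum ℂ T \ Metric.ball 1 r).eq_empty_or_nonempty with he | hne
  · exact ⟨0, le_rfl, one_pos, fun z hz h1 => absurd (hmem z hz h1) (by simp [he])⟩
  · obtain ⟨w, hw, hmax⟩ := hK.exists_isMaxOn hne Complex.continuous_re.continuousOn
    refine ⟨max 0 w.re, le_max_left _ _, max_lt one_pos (h.re_lt w hw.1 ?_), fun z hz h1 =>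
      le_max_of_le_right (hmax (hmem z hz h1))⟩
    rintro rfl
    exact hw.2 (Metric.mem_ball_self hr)

theorem IsSLQC.exists_spectralProjection_eq_smul {T : X →L[ℂ] X} (h : IsSLQC T) {e : X}
    (he : T e = e) (he0 : e ≠ 0) (v : X) : ∃ c : ℂ, spectralProjection T 1 v = c • e := by
  have hPe : spectralProjection T 1 e = e := by
    obtain ⟨φ, hφ⟩ := SeparatingDual.exists_eq_one (R := ℂ) he0
    have hQ : (T - algebraMap ℂ (X →L[ℂ] X) 1) ^ 1 * φ.smulRight e = 0 := by
      ext x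
      simp [he]
    have h1 := contourProjection_mul_self h.isolated.choose_spec.1 h.isolated.choose_spec.2
      le_rfl hQ
    rw [← spectralProjection_eq_contourProjection h.isolated] at h1
    have h2 := DFunLike.congr_fun h1 e
    simpa [hφ] using h2
  have hfin : Module.finrank ℂ (LinearMap.range (spectralProjection T 1).toLinearMap) = 1 :=
    Module.rank_eq_one_iff_finrank_eq_one.1 h.rank_one
  let e' : LinearMap.range (spectralProjection T 1).toLinearMap := ⟨e, e, hPe⟩
  have he' : e' ≠ 0 := fun h0 => he0 (congrArg Subtype.val h0)
  obtain ⟨c, hc⟩ := (finrank_eq_one_iff_of_nonzero' e' he').1 hfin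
    ⟨spectralProjection T 1 v, v, rfl⟩
  exact ⟨c, (congrArg Subtype.val hc).symm⟩

theorem IsSLQC.sub_one_mul_spectralProjection {T : X →L[ℂ] X} (h : IsSLQC T) {e : X}
    (he : T e = e) (he0 : e ≠ 0) :
    (T - algebraMap ℂ (X →L[ℂ] X) 1) * spectralProjection T 1 = 0 := by
  ext v
  obtain ⟨c, hc⟩ := h.exists_spectralProjection_eq_smul he he0 v
  simp [hc, he]

theorem isLittleO_natCast_rpow {d d' : ℝ} (hd : d < d') :
    (fun n : ℕ => (n : ℝ) ^ d) =o[atTop] fun n : ℕ => (n : ℝ) ^ d' := by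
  refine Asymptotics.isLittleO_of_tendsto' ?_ ?_
  · filter_upwards [eventually_gt_atTop 0] with n hn h0
    exact absurd h0 (Real.rpow_pos_of_pos (by exact_mod_cast hn) _).ne'
  · have h1 := (tendsto_rpow_neg_atTop (sub_pos.2 hd)).comp (tendsto_natCast_atTop_atTop (R := ℝ))
    refine h1.congr' ?_
    filter_upwards [eventually_gt_atTop 0] with n hn
    rw [← Real.rpow_sub (by exact_mod_cast hn)]
    simp

omit [CompleteSpace X] in
theorem tendsto_smul_of_isBigO_rpow {u : ℕ → X} {d d' : ℝ} (hd : d < d')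
    (hu : u =O[atTop] fun n : ℕ => (n : ℝ) ^ d) :
    Tendsto (fun n : ℕ => ((n : ℝ) ^ d')⁻¹ • u n) atTop (𝓝 0) := by
  have h1 : u =o[atTop] fun n : ℕ => (n : ℝ) ^ d' :=
    hu.trans_isLittleO (isLittleO_natCast_rpow hd)
  exact h1.tendsto_inv_smul_nhds_zero

/-- Law of large numbers for the products of a spectrally-large quasi-compact operator. -/
theorem IsSLQC.tendsto_stepProd {T : X →L[ℂ] X} (h : IsSLQC T) {e : X} (he : T e = e)
    (he0 : e ≠ 0) {b : ℝ} (hb : 0 < b) {v : X} {c : ℂ} (hc : spectralProjection T 1 v = c • e) :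
    Tendsto (fun n : ℕ => (n : ℝ)⁻¹ • (stepProd T (harmonicStep b) n v -
      (∏ i ∈ Finset.range n, (1 + harmonicStep b i)) • c • e)) atTop (𝓝 0) := by
  obtain ⟨c', hc'0, hc'1, hre⟩ := h.exists_re_le
  obtain ⟨d, hd, hd1⟩ := exists_between hc'1
  have h1 := stepProd_remainder_isBigO {1} 1 le_rfl (T := T) (by simpa using h.one_mem)
    (by simpa using h.isolated)
    (by simpa using h.sub_one_mul_spectralProjection he he0) hb hc'0 hd
    (fun z hz hz1 => hre z hz (by simpa using hz1)) v
  have h2 := tendsto_smul_of_isBigO_rpow hd1 h1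
  refine h2.congr fun n => ?_
  rw [Real.rpow_one, Finset.sum_singleton, hc, map_sub, map_smul,
    stepProd_eigenvector (lam := 1) (v := e) (by rw [he, one_smul])]
  simp only [one_mul]
  rw [smul_comm c]

theorem tendsto_nat_mul_step {b : ℝ} (hb : 0 < b) (lam : ℂ) :
    Tendsto (fun n : ℕ => (n : ℂ) * (harmonicStep b n / (1 + lam * harmonicStep b n))) atTop
      (𝓝 1) := by
  have h1 : Tendsto (fun n : ℕ => (n : ℂ) / (n + (b + lam))) atTop (𝓝 1) :=
    tendsto_natCast_div_add_atTop (b + lam)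
  refine h1.congr fun n => ?_
  have h2 : (n : ℂ) + b ≠ 0 := by
    have : (0 : ℝ) < n + b := by positivity
    exact_mod_cast this.ne'
  rw [harmonicStep]
  push_cast
  field_simp
  ring

theorem one_add_mul_harmonicStep_ne_zero {b : ℝ} (hb : 0 < b) {lam : ℂ} (hl : 0 ≤ lam.re) (i : ℕ) :
    1 + lam * harmonicStep b i ≠ 0 := by
  intro h0
  have h1 := congrArg Complex.re h0
  rw [harmonicStep, Complex.add_re, Complex.re_mul_ofReal, Complex.one_re, Complex.zero_re] at h1
  have : (0 : ℝ) ≤ (i + b)⁻¹ := by positivity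
  nlinarith [mul_nonneg hl this]

omit [CompleteSpace X] in
/-- Factoring the scalars `1 + λ δ i` out of the product leaves a product in the steps of `T - λ`,
which is polynomial in a nilpotent on a generalized eigenspace. -/
theorem stepProd_eq_prod_smul {T : X →L[ℂ] X} {lam : ℂ} {δ : ℕ → ℂ}
    (h : ∀ i, 1 + lam * δ i ≠ 0) (n : ℕ) :
    stepProd T δ n = (∏ i ∈ Finset.range n, (1 + lam * δ i)) •
      stepProd (T - lam • (1 : X →L[ℂ] X)) (fun i => δ i / (1 + lam * δ i)) n := by
  induction n with
  | zero => simp [stepProd_zero]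
  | succ n ih =>
    rw [stepProd_succ, ih, stepProd_succ, Finset.prod_range_succ, mul_comm (∏ i ∈ _, _),
      mul_smul_comm, mul_smul, smul_comm (1 + lam * δ n),
      ← smul_mul_assoc (1 + lam * δ n)]
    congr 2
    rw [smul_add, smul_smul, mul_div_cancel₀ _ (h n), add_smul, one_smul, smul_sub, smul_smul,
      mul_comm (δ n) lam]
    abel

theorem tendsto_log_div_log_add (k : ℕ) :
    Tendsto (fun n : ℕ => Real.log n / Real.log ((n + k : ℕ) : ℝ)) atTop (𝓝 1) := by
  have h1 : Tendsto (fun n : ℕ => (n : ℝ) / ((n + k : ℕ) : ℝ)) atTop (𝓝 1) := by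
    simpa using tendsto_natCast_div_add_atTop (𝕜 := ℝ) (k : ℝ)
  have h2 := (Real.continuousAt_log one_ne_zero).tendsto.comp h1
  rw [Real.log_one] at h2
  have h3 : Tendsto (fun n : ℕ => Real.log ((n + k : ℕ) : ℝ)) atTop atTop :=
    (Real.tendsto_log_atTop.comp tendsto_natCast_atTop_atTop).comp (tendsto_add_atTop_nat k)
  have h4 := (h2.div_atTop h3).const_add 1
  rw [add_zero] at h4
  refine h4.congr' ?_
  filter_upwards [h3.eventually_gt_atTop 0, eventually_gt_atTop 0] with n hn hn0
  have hn' : (n : ℝ) ≠ 0 := by exact_mod_cast hn0.ne'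
  have hn2 : ((n + k : ℕ) : ℝ) ≠ 0 := by positivity
  simp only [Function.comp]
  rw [Real.log_div hn' hn2, sub_div, div_self hn.ne']
  ring

omit [CompleteSpace X] in
/-- The products along a nilpotent spectral component at `lam` grow like
`n ^ lam (log n) ^ s`. The asymptotics is read at the shifted time `n + k`. -/
theorem tendsto_stepProd_component {T : X →L[ℂ] X} {lam : ℂ} {b : ℝ} (hb : 0 < b)
    (hl : 0 ≤ lam.re) {v : X} {s : ℕ} (hv : ((T - lam • (1 : X →L[ℂ] X)) ^ (s + 1)) v = 0)
    (k : ℕ) :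
    Tendsto (fun n : ℕ => ((((n + k : ℕ) : ℝ) ^ lam.re * (Real.log ((n + k : ℕ) : ℝ)) ^ s)⁻¹ : ℝ) •
      stepProd T (harmonicStep b) n v -
      (((n + k : ℕ) : ℂ) ^ (Complex.I * (lam.im : ℂ))) •
        ((Complex.Gamma b / Complex.Gamma (b + lam) / s.factorial) •
          ((T - lam • (1 : X →L[ℂ] X)) ^ s) v)) atTop (𝓝 0) := by
  set N : X →L[ℂ] X := T - lam • (1 : X →L[ℂ] X) with hN
  set x : ℕ → ℂ := fun i => harmonicStep b i / (1 + lam * harmonicStep b i) with hx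
  have h1 := tendsto_stepProd_nilpotent N (tendsto_nat_mul_step hb lam) s v hv
  have h2 := (tendsto_prod_harmonicStep hb hl).mul (tendsto_cpow_div_add_cpow lam k)
  have h3 := (tendsto_log_div_log_add k).pow s
  rw [mul_one] at h2
  rw [one_pow] at h3
  have h4 := (h2.smul (h3.smul h1)).sub_const
    ((Complex.Gamma b / Complex.Gamma (b + lam) / s.factorial) • (N ^ s) v)
  have h5 : (Complex.Gamma b / Complex.Gamma (b + lam)) • (1 : ℝ) •
      ((s.factorial : ℝ)⁻¹ • (N ^ s) v) -
      (Complex.Gamma b / Complex.Gamma (b + lam) / s.factorial) • (N ^ s) v = 0 := by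
    rw [one_smul, ← Complex.coe_smul, smul_smul, sub_eq_zero]
    congr 1
    push_cast
    rw [div_eq_mul_inv _ (s.factorial : ℂ)]
  rw [h5] at h4
  rw [tendsto_zero_iff_norm_tendsto_zero] at h4 ⊢
  refine h4.congr' ?_
  have hlogt : Tendsto (fun i : ℕ => Real.log i) atTop atTop :=
    Real.tendsto_log_atTop.comp tendsto_natCast_atTop_atTop
  filter_upwards [eventually_gt_atTop 0, hlogt.eventually_gt_atTop 0,
    (hlogt.comp (tendsto_add_atTop_nat k)).eventually_gt_atTop 0] with n hn hlog hlog2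
  have hnk : 0 < n + k := by omega
  have hu : ‖((n + k : ℕ) : ℂ) ^ (Complex.I * (lam.im : ℂ))‖ = 1 := norm_natCast_cpow_I_mul hnk _
  have hnkc : ((n + k : ℕ) : ℂ) ≠ 0 := by exact_mod_cast hnk.ne'
  have hnc : (n : ℂ) ≠ 0 := by exact_mod_cast hn.ne'
  have hcp : ∀ (m : ℂ) (z : ℂ), m ≠ 0 → m ^ z ≠ 0 := fun m z hm => by
    rw [Complex.cpow_def_of_ne_zero hm]; exact Complex.exp_ne_zero _
  rw [← one_mul ‖_ - _‖, ← hu, ← norm_smul, smul_sub]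
  congr 2
  rw [stepProd_eq_prod_smul (fun i => one_add_mul_harmonicStep_ne_zero hb hl i),
    smul_apply]
  simp only [← Complex.coe_smul, smul_smul]
  congr 1
  have e1 : ((n + k : ℕ) : ℂ) ^ lam = ((((n + k : ℕ) : ℝ) ^ lam.re : ℝ) : ℂ) *
      ((n + k : ℕ) : ℂ) ^ (Complex.I * (lam.im : ℂ)) := by
    rw [Complex.ofReal_cpow (by positivity), Complex.ofReal_natCast, ← Complex.cpow_add _ _ hnkc]
    congr 1
    rw [mul_comm]
    exact (Complex.re_add_im lam).symm
  have hA : ((((n + k : ℕ) : ℝ) ^ lam.re : ℝ) : ℂ) ≠ 0 := by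
    have : (0 : ℝ) < ((n + k : ℕ) : ℝ) ^ lam.re := Real.rpow_pos_of_pos (by exact_mod_cast hnk) _
    exact_mod_cast this.ne'
  have hI := hcp _ (Complex.I * (lam.im : ℂ)) hnkc
  have hn2 := hcp _ lam hnc
  have hl1 : ((Real.log n : ℝ) : ℂ) ≠ 0 := by exact_mod_cast hlog.ne'
  have hl2 : ((Real.log ((n + k : ℕ) : ℝ) : ℝ) : ℂ) ≠ 0 := by exact_mod_cast hlog2.ne'
  rw [e1]
  simp only [Complex.ofReal_mul, Complex.ofReal_inv, Complex.ofReal_pow, Complex.ofReal_div]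
  generalize ((((n + k : ℕ) : ℝ) ^ lam.re : ℝ) : ℂ) = a1 at *
  generalize ((n + k : ℕ) : ℂ) ^ (Complex.I * (lam.im : ℂ)) = a2 at *
  generalize ((Real.log ((n + k : ℕ) : ℝ) : ℝ) : ℂ) = a3 at *
  generalize ((Real.log n : ℝ) : ℂ) = a4 at *
  rw [div_pow]
  field_simp

omit [CompleteSpace X] in
theorem IsLargeCase.one_le_and_pow_mul_eq_zero {T : X →L[ℂ] X} {p : ℕ} {lam : Fin p → ℂ} {θ : ℝ}
    {κ : ℕ} (h : IsLargeCase T lam θ κ) (j : Fin p) :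
    1 ≤ κ ∧ (T - lam j • (1 : X →L[ℂ] X)) ^ κ * spectralProjection T (lam j) = 0 := by
  have h1 : nilpotencyIndex T (lam j) ≤ (κ : ℕ∞) := h.index_eq ▸ le_iSup
    (fun j => nilpotencyIndex T (lam j)) j
  obtain ⟨k, ⟨hk1, hk⟩, hkκ⟩ : ∃ k : ℕ, (1 ≤ k ∧ ∀ v, ((T - lam j • (1 : X →L[ℂ] X)) ^ k)
      (spectralProjection T (lam j) v) = 0) ∧ k ≤ κ := by
    by_contra! hcon
    have h2 : ((κ + 1 : ℕ) : ℕ∞) ≤ nilpotencyIndex T (lam j) :=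
      le_iInf₂ fun k hk => by exact_mod_cast hcon k hk
    have h3 : κ + 1 ≤ κ := by exact_mod_cast h2.trans h1
    omega
  refine ⟨hk1.trans hkκ, ?_⟩
  obtain ⟨r, rfl⟩ := Nat.exists_eq_add_of_le hkκ
  ext v
  rw [add_comm, pow_add, mul_assoc]
  have : (T - lam j • (1 : X →L[ℂ] X)) ^ k * spectralProjection T (lam j) = 0 := by
    ext v; exact hk v
  rw [this, mul_zero]

omit [CompleteSpace X] in
theorem IsLargeCase.isolated {T : X →L[ℂ] X} {p : ℕ} {lam : Fin p → ℂ} {θ : ℝ}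
    {κ : ℕ} (h : IsLargeCase T lam θ κ) (j : Fin p) :
    ∃ r : ℝ, 0 < r ∧ Metric.closedBall (lam j) r ∩ spectrum ℂ T ⊆ {lam j} := by
  obtain ⟨Δ, c, hc, hΔ, hσ⟩ := h.spectrum_eq
  set C : Set ℂ := (({1} ∪ Set.range lam) \ {lam j}) ∪ {z | z.re ≤ c} with hC
  have hclosed : IsClosed C := by
    refine IsClosed.union (Set.Finite.isClosed ?_) (isClosed_le Complex.continuous_re
      continuous_const)
    exact ((Set.finite_singleton _).union (Set.finite_range lam)).sdiff
  have hmem : Cᶜ ∈ 𝓝 (lam j) := by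
    refine hclosed.isOpen_compl.mem_nhds ?_
    rintro (h1 | h1)
    · exact h1.2 rfl
    · rw [Set.mem_ofPred_eq, h.re_eq j] at h1
      linarith
  obtain ⟨r, hr, hrC⟩ := Metric.nhds_basis_closedBall.mem_iff.1 hmem
  refine ⟨r, hr, fun z hz => ?_⟩
  by_contra hne
  have h2 := hrC hz.1
  have h3 := hz.2
  rw [hσ] at h3
  rcases h3 with h3 | h3
  · exact h2 (Or.inl ⟨h3, hne⟩)
  · exact h2 (Or.inr (hΔ z h3))

/-- Asymptotics of the products in the case of a large second eigenvalue, after removal of the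
component of the eigenvalue `1`: each `lam j` contributes an oscillating multiple of
`(T - lam j) ^ (κ - 1) Π_{lam j} f`. -/
theorem IsLargeCase.tendsto_stepProd {T : X →L[ℂ] X} {p : ℕ} {lam : Fin p → ℂ} {θ : ℝ}
    {κ : ℕ} (h : IsLargeCase T lam θ κ) {e : X} (he : T e = e) (he0 : e ≠ 0) {b : ℝ} (hb : 0 < b)
    {f : X} {c : ℂ} (hc : spectralProjection T 1 f = c • e) (k : ℕ) :
    Tendsto (fun n : ℕ =>
      ((((n + k : ℕ) : ℝ) ^ θ * (Real.log ((n + k : ℕ) : ℝ)) ^ (κ - 1))⁻¹ : ℝ) •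
        (stepProd T (harmonicStep b) n f -
          (∏ i ∈ Finset.range n, (1 + harmonicStep b i)) • c • e) -
      ∑ j, (((n + k : ℕ) : ℂ) ^ (Complex.I * ((lam j).im : ℂ))) •
        ((Complex.Gamma b / Complex.Gamma (b + lam j) / (κ - 1).factorial) •
          ((T - lam j • (1 : X →L[ℂ] X)) ^ (κ - 1)) (spectralProjection T (lam j) f)))
      atTop (𝓝 0) := by
  classical
  obtain ⟨Δ, c0, hc0, hΔ, hσ⟩ := h.spectrum_eq
  have hκ : 1 ≤ κ := (h.one_le_and_pow_mul_eq_zero ⟨0, h.pos⟩).1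
  have hθ : 0 < θ := by linarith [h.half_lt]
  obtain ⟨d, hd, hdθ⟩ := exists_between (max_lt hc0 hθ)
  set S : Finset ℂ := insert 1 (Finset.univ.image lam) with hS
  have h1nm : (1 : ℂ) ∉ Finset.univ.image lam := by
    intro h1
    obtain ⟨j, -, hj⟩ := Finset.mem_image.1 h1
    have := h.re_eq j
    rw [hj, Complex.one_re] at this
    linarith [h.lt_one]
  have hrem := stepProd_remainder_isBigO S κ hκ (T := T) (b := b) (c := max c0 0) (d := d)
    (by
      intro z hz
      rw [hσ]
      rcases Finset.mem_insert.1 hz with rfl | hz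
      · exact Or.inl (Or.inl rfl)
      · obtain ⟨j, -, rfl⟩ := Finset.mem_image.1 hz
        exact Or.inl (Or.inr ⟨j, rfl⟩))
    (by
      intro z hz
      rcases Finset.mem_insert.1 hz with rfl | hz
      · exact h.slqc.isolated
      · obtain ⟨j, -, rfl⟩ := Finset.mem_image.1 hz
        exact h.isolated j)
    (by
      intro z hz
      rcases Finset.mem_insert.1 hz with rfl | hz
      · obtain ⟨r, rfl⟩ := Nat.exists_eq_add_of_le hκ
        rw [add_comm, pow_succ, mul_assoc, h.slqc.sub_one_mul_spectralProjection he he0, mul_zero]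
      · obtain ⟨j, -, rfl⟩ := Finset.mem_image.1 hz
        rw [Algebra.algebraMap_eq_smul_one]
        exact (h.one_le_and_pow_mul_eq_zero j).2)
    hb (le_max_right _ _) hd
    (by
      intro z hz hzS
      rw [hσ] at hz
      rcases hz with (hz | ⟨j, rfl⟩) | hz
      · exact absurd (Finset.mem_insert.2 (Or.inl hz)) hzS
      · exact absurd (Finset.mem_insert_of_mem (Finset.mem_image_of_mem _ (Finset.mem_univ j))) hzS
      · exact le_max_of_le_left (hΔ z hz)) f
  have hsumS : ∑ z ∈ S, spectralProjection T z f =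
      c • e + ∑ j, spectralProjection T (lam j) f := by
    rw [hS, Finset.sum_insert h1nm, hc, Finset.sum_image fun i _ j _ hij => h.injective hij]
  rw [hsumS] at hrem
  set u : ℕ → X := fun n => stepProd T (harmonicStep b) n
    (f - (c • e + ∑ j, spectralProjection T (lam j) f)) with hu
  have hrem' : Tendsto (fun n : ℕ =>
      ((((n + k : ℕ) : ℝ) ^ θ * (Real.log ((n + k : ℕ) : ℝ)) ^ (κ - 1))⁻¹ : ℝ) • u n)
      atTop (𝓝 0) := by
    have h1 := (tendsto_smul_of_isBigO_rpow hdθ hrem).norm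
    rw [norm_zero] at h1
    refine squeeze_zero_norm' ?_ h1
    have hlogt : Tendsto (fun i : ℕ => Real.log ((i + k : ℕ) : ℝ)) atTop atTop :=
      (Real.tendsto_log_atTop.comp tendsto_natCast_atTop_atTop).comp (tendsto_add_atTop_nat k)
    filter_upwards [eventually_gt_atTop 0, hlogt.eventually_ge_atTop 1] with n hn hlog
    have hn' : (0 : ℝ) < n := by exact_mod_cast hn
    rw [norm_smul, norm_smul]
    refine mul_le_mul_of_nonneg_right ?_ (norm_nonneg _)
    rw [Real.norm_of_nonneg (by positivity), Real.norm_of_nonneg (by positivity)]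
    refine inv_anti₀ (by positivity) ?_
    calc (n : ℝ) ^ θ ≤ ((n + k : ℕ) : ℝ) ^ θ * 1 := by
          rw [mul_one]
          exact Real.rpow_le_rpow hn'.le (by push_cast; linarith [Nat.cast_nonneg (α := ℝ) k]) hθ.le
      _ ≤ _ := by
          refine mul_le_mul_of_nonneg_left (one_le_pow₀ hlog) (by positivity)
  have hcomp := fun j => tendsto_stepProd_component (T := T) (lam := lam j) hb
    (by rw [h.re_eq j]; exact hθ.le) (v := spectralProjection T (lam j) f) (s := κ - 1)
    (by
      rw [Nat.sub_add_cancel hκ]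
      exact DFunLike.congr_fun (h.one_le_and_pow_mul_eq_zero j).2 f) k
  have hall := (tendsto_finsetSum Finset.univ fun j _ => hcomp j).add hrem'
  rw [Finset.sum_const_zero, zero_add] at hall
  refine hall.congr fun n => ?_
  simp only [h.re_eq]
  rw [Finset.sum_sub_distrib, ← Finset.smul_sum, sub_add_eq_add_sub, ← smul_add]
  congr 2
  rw [hu]
  simp only [map_sub, map_add, map_smul, map_sum]
  rw [stepProd_eigenvector (lam := 1) (v := e) (by rw [he, one_smul])]
  simp only [one_mul]
  rw [smul_comm c]
  abel

end Asymptotics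

/-! ### Functions in `B(W)` -/

namespace BW

variable {E : Type*} [MeasurableSpace E] {W : Weight E}

/-- The indicator function of a measurable set as an element of `B(W)`. -/
def indicator (A : Set E) (hA : MeasurableSet A) : BW W :=
  mk (A.indicator fun _ => 1) (measurable_const.indicator hA) ⟨1, fun x => by
    have := W.one_le' x
    by_cases h : x ∈ A <;> simp [h] <;> linarith⟩

@[simp] theorem indicator_apply (A : Set E) (hA : MeasurableSet A) (x : E) :
    (indicator A hA : BW W) x = A.indicator (fun _ => 1) x := rfl

@[simp] theorem one_apply (x : E) : one W x = 1 := rfl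

@[simp] theorem abs_apply (g : BW W) (x : E) : g.abs x = ((‖g x‖ : ℝ) : ℂ) := rfl

theorem indicator_univ : (indicator Set.univ MeasurableSet.univ : BW W) = one W := by
  ext x; simp

/-- A simple function as an element of `B(W)`. -/
def ofSimple (φ : SimpleFunc E ℂ) : BW W :=
  mk φ φ.measurable (by
    obtain ⟨C, hC⟩ := φ.exists_forall_norm_le
    refine ⟨C, fun x => (hC x).trans ?_⟩
    have h0 : 0 ≤ C := (norm_nonneg _).trans (hC x)
    nlinarith [W.one_le' x])

theorem ofSimple_induction {p : BW W → Prop} (hind : ∀ A hA, p (indicator A hA))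
    (hadd : ∀ f g, p f → p g → p (f + g)) (hsmul : ∀ (c : ℂ) f, p f → p (c • f))
    (φ : SimpleFunc E ℂ) : p (ofSimple φ) := by
  induction φ using SimpleFunc.induction with
  | const c hs =>
    rename_i s
    have e : (ofSimple (SimpleFunc.piecewise s hs (SimpleFunc.const E c)
        (SimpleFunc.const E 0)) : BW W) = c • indicator s hs := by
      ext x
      by_cases hx : x ∈ s <;> simp [ofSimple, hx]
    rw [e]
    exact hsmul c _ (hind s hs)
  | add hd hf hg =>
    rename_i φ ψ
    have e : (ofSimple (φ + ψ) : BW W) = ofSimple φ + ofSimple ψ := rfl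
    rw [e]
    exact hadd _ _ hf hg

/-- Induction principle for `B(W)`: a property of indicators that is stable under linear
combinations and dominated pointwise limits holds on the whole space. -/
theorem induction {p : BW W → Prop} (hind : ∀ A hA, p (indicator A hA))
    (hadd : ∀ f g, p f → p g → p (f + g)) (hsmul : ∀ (c : ℂ) f, p f → p (c • f))
    (hlim : ∀ (u : ℕ → BW W) (g : BW W) (C : ℝ), (∀ n x, ‖u n x‖ ≤ C * W x) →
      (∀ x, Tendsto (fun n => u n x) atTop (𝓝 (g x))) → (∀ n, p (u n)) → p g)
    (g : BW W) : p g := by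
  refine hlim (fun n => ofSimple (SimpleFunc.approxOn g g.measurable Set.univ 0
    (Set.mem_univ _) n)) g (2 * ‖g‖) (fun n x => ?_) (fun x => ?_) fun n => ofSimple_induction hind hadd hsmul _
  · refine (SimpleFunc.norm_approxOn_zero_le g.measurable (Set.mem_univ _) x n).trans ?_
    have := g.norm_apply_le x
    linarith
  · exact SimpleFunc.tendsto_approxOn g.measurable _ (by simp)

theorem integrable {μ : Measure E} (hW : Integrable W μ) (f : BW W) : Integrable f μ :=
  (hW.const_mul ‖f‖).mono' f.measurable.aestronglyMeasurable
    (Eventually.of_forall f.norm_apply_le)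

theorem tendsto_integral {μ : Measure E} (hW : Integrable W μ) {u : ℕ → BW W} {g : BW W} {C : ℝ}
    (hb : ∀ n x, ‖u n x‖ ≤ C * W x) (hu : ∀ x, Tendsto (fun n => u n x) atTop (𝓝 (g x))) :
    Tendsto (fun n => ∫ x, u n x ∂μ) atTop (𝓝 (∫ x, g x ∂μ)) :=
  tendsto_integral_of_dominated_convergence (fun x => C * W x)
    (fun n => (u n).measurable.aestronglyMeasurable) (hW.const_mul C)
    (fun n => Eventually.of_forall (hb n)) (Eventually.of_forall hu)

/-- Integration against a measure with `∫ W < ∞` as a bounded functional on `B(W)`. -/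
def integralCLM {μ : Measure E} (hW : Integrable W μ) : BW W →L[ℂ] ℂ :=
  LinearMap.mkContinuous
    { toFun := fun f => ∫ x, f x ∂μ
      map_add' := fun f g => integral_add (f.integrable hW) (g.integrable hW)
      map_smul' := fun c f => MeasureTheory.integral_const_mul c f }
    (∫ x, W x ∂μ) (fun f => by
      refine (norm_integral_le_of_norm_le (hW.const_mul ‖f‖)
        (Eventually.of_forall f.norm_apply_le)).trans ?_
      rw [MeasureTheory.integral_const_mul, mul_comm])

@[simp] theorem integralCLM_apply {μ : Measure E} (hW : Integrable W μ) (f : BW W) :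
    integralCLM hW f = ∫ x, f x ∂μ := rfl

end BW

theorem Weight.integrable_of_rpow {E : Type*} [MeasurableSpace E] (W : Weight E) {q : ℝ}
    (hq : 1 ≤ q) {μ : Measure E} (h : Integrable (fun y => W y ^ q) μ) : Integrable W μ :=
  h.mono' W.measurable'.aestronglyMeasurable (Eventually.of_forall fun x => by
    rw [Real.norm_of_nonneg (W.pos x).le]
    exact Real.self_le_rpow_of_one_le (W.one_le' x) hq)

/-! ### The mean replacement operator -/

section MeanOp

variable {E Ω' : Type*} [MeasurableSpace E] [MeasurableSpace Ω'] {W : Weight E} {q : ℝ}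
  {ρ : E → Ω' → SignedMeasure E} {PR : Measure Ω'}

theorem isFiniteMeasure_variation (s : SignedMeasure E) : IsFiniteMeasure s.variation := by
  rw [← SignedMeasure.totalVariation_eq_variation]; infer_instance

theorem signedMeasure_integral_indicator (s : SignedMeasure E) {A : Set E}
    (hA : MeasurableSet A) : ∫ᵛ x, A.indicator (fun _ => (1 : ℂ)) x ∂<•s = ((s A : ℝ) : ℂ) := by
  have := isFiniteMeasure_variation s
  rw [VectorMeasure.integral_indicator_const _ hA]
  simp

theorem meanOp_indicator (hρ : IsReplacementKernel ρ PR) (hM : MomentBound W q ρ PR) {A : Set E}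
    (hA : MeasurableSet A) (x : E) :
    meanOp hρ hM (BW.indicator A hA) x = ((meanMeasure (ρ x) PR A : ℝ) : ℂ) := by
  rw [meanOp_apply]
  exact signedMeasure_integral_indicator _ hA

theorem meanOp_one (hρ : IsReplacementKernel ρ PR) (hM : MomentBound W q ρ PR)
    (hB : ∀ x, ∀ᵐ ω ∂PR, ρ x ω Set.univ = 1) : meanOp hρ hM (BW.one W) = BW.one W := by
  have := hρ.isProbabilityMeasure
  ext x
  rw [← BW.indicator_univ, meanOp_indicator, meanMeasure_apply (hρ.measurable x)
    (lintegral_variation_univ_lt_top hρ hM x) MeasurableSet.univ, integral_congr_ae (hB x)]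
  simp

theorem tendsto_meanOp_apply (hρ : IsReplacementKernel ρ PR) (hM : MomentBound W q ρ PR)
    {u : ℕ → BW W} {g : BW W} {C : ℝ} (hb : ∀ n x, ‖u n x‖ ≤ C * W x)
    (hu : ∀ x, Tendsto (fun n => u n x) atTop (𝓝 (g x))) (x : E) :
    Tendsto (fun n => meanOp hρ hM (u n) x) atTop (𝓝 (meanOp hρ hM g x)) := by
  let w : BW W := BW.mk (fun x => ((W x : ℝ) : ℂ)) (Complex.measurable_ofReal.comp W.measurable')
    ⟨1, fun x => by simp [abs_of_pos (W.pos x)]⟩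
  have hw : Integrable (fun y => W y) (meanMeasure (ρ x) PR).variation := by
    have := (integrable_meanMeasure hρ hM w x).norm
    refine this.congr (Eventually.of_forall fun y => ?_)
    simp [w, abs_of_pos (W.pos y)]
  exact VectorMeasure.tendsto_integral_of_dominated_convergence (fun x => C * W x)
    (fun n => (u n).measurable.aestronglyMeasurable) (hw.const_mul C)
    (fun n => Eventually.of_forall (hb n)) (Eventually.of_forall hu)

theorem exists_norm_meanOp_apply_le (hρ : IsReplacementKernel ρ PR) (hM : MomentBound W q ρ PR) :
    ∃ K : ℝ, 0 ≤ K ∧ ∀ (u : BW W) (C : ℝ), (∀ x, ‖u x‖ ≤ C * W x) → ∀ x,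
      ‖meanOp hρ hM u x‖ ≤ K * C * W x := by
  refine ⟨‖meanOp hρ hM‖, norm_nonneg _, fun u C hC x => ?_⟩
  have hC0 : 0 ≤ C := by
    have h1 := (norm_nonneg _).trans (hC x)
    exact nonneg_of_mul_nonneg_left h1 (W.pos x)
  refine ((meanOp hρ hM u).norm_apply_le x).trans (mul_le_mul_of_nonneg_right ?_ (W.pos x).le)
  exact (ContinuousLinearMap.le_opNorm _ _).trans
    (mul_le_mul_of_nonneg_left (u.norm_le_of hC0 hC) (norm_nonneg _))

/-- The mean replacement measures are bounded below on their own colour, uniformly: if `x ∈ A`, the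
part of `A` where `W ≥ W x` has mass at most `|𝐑_x| W / W x`, and the rest avoids `x`. -/
theorem exists_meanMeasure_ge (hρ : IsReplacementKernel ρ PR) (hM : MomentBound W q ρ PR) :
    ∃ C : ℝ, 0 ≤ C ∧ ∀ x A, MeasurableSet A →
      0 ≤ meanMeasure (ρ x) PR A + A.indicator (fun _ => C) x := by
  obtain ⟨C, hC, hb⟩ := first_moment hρ hM
  have hprob := hρ.isProbabilityMeasure
  have hint : ∀ x A, MeasurableSet A → Integrable (fun ω => ρ x ω A) PR := fun x A hA =>
    ⟨((measurable_eval hA).comp (hρ.measurable x)).aestronglyMeasurable,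
      lt_of_le_of_lt (lintegral_mono fun ω => ((ρ x ω).enorm_measure_le_variation A).trans
        (measure_mono (Set.subset_univ A))) (lintegral_variation_univ_lt_top hρ hM x)⟩
  have hnn : ∀ x A, MeasurableSet A → x ∉ A → 0 ≤ meanMeasure (ρ x) PR A := by
    intro x A hA hx
    rw [meanMeasure_apply (hρ.measurable x) (lintegral_variation_univ_lt_top hρ hM x) hA]
    exact integral_nonneg_of_ae ((hρ.nonneg_off x).mono fun ω h => h A hA hx)
  refine ⟨C, hC, fun x A hA => ?_⟩
  by_cases hx : x ∈ A
  · rw [Set.indicator_of_mem hx]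
    set B : Set E := A ∩ {y | W x ≤ W y} with hB
    have hBm : MeasurableSet B := hA.inter (measurableSet_le measurable_const W.measurable')
    have h1 : 0 ≤ meanMeasure (ρ x) PR (A \ B) := hnn x _ (hA.diff hBm) fun h => h.2 ⟨hx, le_refl (W x)⟩
    have h2 : meanMeasure (ρ x) PR A = meanMeasure (ρ x) PR B + meanMeasure (ρ x) PR (A \ B) := by
      rw [← VectorMeasure.of_union Set.disjoint_sdiff_right hBm (hA.diff hBm),
        Set.union_sdiff_cancel Set.inter_subset_left]
    have h3 : |meanMeasure (ρ x) PR B| ≤ C := by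
      rw [meanMeasure_apply (hρ.measurable x) (lintegral_variation_univ_lt_top hρ hM x) hBm,
        ← Real.norm_eq_abs]
      have hw0 : ENNReal.ofReal (W x) ≠ 0 := (ENNReal.ofReal_pos.2 (W.pos x)).ne'
      have h4 : ENNReal.ofReal (W x) * ∫⁻ ω, ‖ρ x ω B‖ₑ ∂PR ≤
          ENNReal.ofReal (W x) * ENNReal.ofReal C := by
        rw [← lintegral_const_mul' _ _ ENNReal.ofReal_ne_top, ← ENNReal.ofReal_mul (W.pos x).le,
          mul_comm (W x)]
        refine (lintegral_mono fun ω => ?_).trans (hb x)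
        calc ENNReal.ofReal (W x) * ‖ρ x ω B‖ₑ
            ≤ ENNReal.ofReal (W x) * (ρ x ω).variation B :=
              mul_le_mul_right ((ρ x ω).enorm_measure_le_variation B) _
          _ = ∫⁻ y in B, ENNReal.ofReal (W x) ∂(ρ x ω).variation := by simp
          _ ≤ ∫⁻ y in B, ENNReal.ofReal (W y) ∂(ρ x ω).variation :=
              setLIntegral_mono' hBm fun y hy => ENNReal.ofReal_le_ofReal hy.2
          _ ≤ _ := setLIntegral_le_lintegral _ _
      have h5 := (ENNReal.mul_le_mul_iff_right hw0 ENNReal.ofReal_ne_top).1 h4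
      refine (norm_integral_le_lintegral_norm _).trans (ENNReal.toReal_le_of_le_ofReal hC ?_)
      simpa only [ofReal_norm] using h5
    have := (abs_le.1 h3).1
    linarith
  · rw [Set.indicator_of_notMem hx, add_zero]
    exact hnn x A hA hx

/-- For a constant `C` large enough, `𝐑 + C` maps non-negative functions to non-negative
functions. -/
theorem exists_meanOp_add_nonneg (hρ : IsReplacementKernel ρ PR) (hM : MomentBound W q ρ PR) :
    ∃ C : ℝ, 0 ≤ C ∧ ∀ h : BW W, (∀ x, 0 ≤ (h x).re ∧ (h x).im = 0) →
      ∀ x, 0 ≤ ((meanOp hρ hM h + (C : ℂ) • h) x).re ∧ ((meanOp hρ hM h + (C : ℂ) • h) x).im = 0 := by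
  obtain ⟨C, hC, hpos⟩ := exists_meanMeasure_ge hρ hM
  refine ⟨C, hC, fun h hh x => ?_⟩
  let s : SignedMeasure E := meanMeasure (ρ x) PR +
    (C.toNNReal • Measure.dirac x).toSignedMeasure
  have hs : 0 ≤ s := by
    refine VectorMeasure.le_iff.2 fun A hA => ?_
    have e : s A = meanMeasure (ρ x) PR A + A.indicator (fun _ => C) x := by
      simp only [s, add_apply]
      rw [Measure.toSignedMeasure_apply_measurable hA]
      by_cases hx : x ∈ A <;> simp [Measure.real, hA, hx, hC]
    rw [e]
    exact hpos x A hA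
  have hval : (meanOp hρ hM h + (C : ℂ) • h) x = ∫ᵛ y, h y ∂<•s := by
    have hd : Integrable h (C.toNNReal • Measure.dirac x) :=
      (integrable_dirac' h.measurable.stronglyMeasurable (by simp)).smul_measure_nnreal
    rw [VectorMeasure.integral_add_vectorMeasure (integrable_meanMeasure hρ hM h x)
      (by rw [VectorMeasure.Integrable, Measure.variation_toSignedMeasure]; exact hd),
      VectorMeasure.integral_toSignedMeasure, integral_smul_nnreal_measure,
      integral_dirac' _ _ h.measurable.stronglyMeasurable, BW.add_apply, BW.smul_apply,
      NNReal.smul_def, Real.coe_toNNReal C hC, Complex.real_smul]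
    rfl
  have hsm : s = (s.toMeasureOfZeroLE Set.univ MeasurableSet.univ
      (by rwa [VectorMeasure.le_restrict_univ_iff_le])).toSignedMeasure :=
    (SignedMeasure.toMeasureOfZeroLE_toSignedMeasure s _).symm
  rw [hval, hsm, VectorMeasure.integral_toSignedMeasure]
  have e : ∀ y, h y = (((h y).re : ℝ) : ℂ) := fun y => Complex.ext rfl (by simp [(hh y).2])
  rw [integral_congr_ae (Eventually.of_forall e),
    show ∫ y, (((h y).re : ℝ) : ℂ) ∂_ = ((∫ y, (h y).re ∂_ : ℝ) : ℂ) from integral_ofReal]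
  exact ⟨by simpa using integral_nonneg fun y => (hh y).1, by simp⟩

theorem integral_meanOp_of_invariant (hρ : IsReplacementKernel ρ PR) (hM : MomentBound W q ρ PR)
    {ν : Measure E} [IsFiniteMeasure ν] (hW : Integrable W ν)
    (hν : ∀ A, MeasurableSet A → ∫ x, meanMeasure (ρ x) PR A ∂ν = ν.real A) (g : BW W) :
    ∫ x, meanOp hρ hM g x ∂ν = ∫ x, g x ∂ν := by
  obtain ⟨K, hK, hKb⟩ := exists_norm_meanOp_apply_le hρ hM
  induction g using BW.induction with
  | hind A hA =>
    simp only [meanOp_indicator, BW.indicator_apply]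
    rw [integral_complex_ofReal, hν A hA, integral_indicator_const _ hA]
    simp
  | hadd f g hf hg =>
    have h1 := (BW.integralCLM hW).map_add (meanOp hρ hM f) (meanOp hρ hM g)
    have h2 := (BW.integralCLM hW).map_add f g
    rw [← map_add] at h1
    simp only [BW.integralCLM_apply] at h1 h2
    rw [h1, h2, hf, hg]
  | hsmul c f hf =>
    have h1 := (BW.integralCLM hW).map_smul c (meanOp hρ hM f)
    have h2 := (BW.integralCLM hW).map_smul c f
    rw [← map_smul] at h1
    simp only [BW.integralCLM_apply] at h1 h2
    rw [h1, h2, hf]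
  | hlim u g C hb hu ih =>
    have h1 := BW.tendsto_integral hW hb hu
    have h2 := BW.tendsto_integral hW (fun n => hKb (u n) C (hb n))
      (tendsto_meanOp_apply hρ hM hb hu)
    simp only [ih] at h2
    exact tendsto_nhds_unique h2 h1

end MeanOp

/-! ### The composition of the urn as a random measure -/

section UrnMeasures

variable {E Ω Ω' : Type*} [MeasurableSpace E] [MeasurableSpace Ω] [MeasurableSpace Ω']
  {W : Weight E} {q : ℝ} {ρ : E → Ω' → SignedMeasure E} {PR : Measure Ω'}
  {m₀ ν : Measure E} [IsFiniteMeasure m₀] {P : Measure Ω} [IsProbabilityMeasure P]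
  {Y : ℕ → Ω → E} {R : ℕ → Ω → SignedMeasure E}

theorem integral_bind_kernel {β F : Type*} [MeasurableSpace β] [NormedAddCommGroup F]
    [NormedSpace ℝ F] {μ : Measure Ω} [SFinite μ] (η : ProbabilityTheory.Kernel Ω β)
    [ProbabilityTheory.IsSFiniteKernel η] {f : β → F} (hf : Integrable f (μ.bind η)) :
    (∫ x, f x ∂(μ.bind η) = ∫ ω, ∫ x, f x ∂(η ω) ∂μ) ∧
      Integrable (fun ω => ∫ x, f x ∂(η ω)) μ ∧ ∀ᵐ ω ∂μ, Integrable f (η ω) := by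
  have e : (η.comp (ProbabilityTheory.Kernel.const Unit μ)) () = μ.bind η := by
    rw [ProbabilityTheory.Kernel.comp_apply, ProbabilityTheory.Kernel.const_apply]
  rw [← e] at hf ⊢
  refine ⟨?_, ?_, ?_⟩
  · rw [ProbabilityTheory.Kernel.integral_comp hf, ProbabilityTheory.Kernel.const_apply]
  · simpa only [ProbabilityTheory.Kernel.const_apply] using hf.integral_comp
  · simpa only [ProbabilityTheory.Kernel.const_apply] using hf.ae_of_comp

theorem eq_toSignedMeasure_variation {s : SignedMeasure E} (hs : 0 ≤ s)
    [IsFiniteMeasure s.variation] : s = s.variation.toSignedMeasure := by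
  obtain ⟨μ, hμ, rfl⟩ : ∃ (μ : Measure E) (_ : IsFiniteMeasure μ), s = μ.toSignedMeasure :=
    ⟨s.toMeasureOfZeroLE Set.univ MeasurableSet.univ
      (by rwa [VectorMeasure.le_restrict_univ_iff_le]), inferInstance,
      (SignedMeasure.toMeasureOfZeroLE_toSignedMeasure s _).symm⟩
  simp only [Measure.variation_toSignedMeasure]

omit [MeasurableSpace Ω] in
theorem measurable_replacement_history {i n : ℕ} (hi : i < n) :
    Measurable[history Y R n] (R i) := by
  have h : MeasurableSpace.comap (R i) inferInstance ≤ history Y R n :=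
    le_sup_right.trans (le_iSup₂_of_le (f := fun (i : ℕ) (_ : i < n) =>
      (MeasurableSpace.comap (Y i) inferInstance ⊔ MeasurableSpace.comap (R i) inferInstance))
      i hi le_rfl)
  exact (comap_measurable (R i)).mono h le_rfl

omit [MeasurableSpace Ω] in
theorem history_mono {n m : ℕ} (h : n ≤ m) : history Y R n ≤ history Y R m :=
  iSup₂_le fun i hi => le_iSup₂_of_le (f := fun (i : ℕ) (_ : i < m) =>
      (MeasurableSpace.comap (Y i) inferInstance ⊔ MeasurableSpace.comap (R i) inferInstance))
      i (hi.trans_le h) le_rfl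

omit [MeasurableSpace Ω] in
theorem composition_apply (n : ℕ) (ω : Ω) (A : Set E) :
    composition m₀ R n ω A = m₀.toSignedMeasure A + ∑ i ∈ Finset.range n, R i ω A := by
  simp [composition]

omit [MeasurableSpace Ω] in
theorem composition_succ (n : ℕ) (ω : Ω) :
    composition m₀ R (n + 1) ω = composition m₀ R n ω + R n ω := by
  rw [composition, composition, Finset.sum_range_succ, add_assoc]

omit [MeasurableSpace Ω] in
theorem measurable_composition_apply (n : ℕ) {A : Set E} (hA : MeasurableSet A) :
    Measurable[history Y R n] (fun ω => composition m₀ R n ω A) := by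
  simp only [composition_apply]
  refine Measurable.const_add ?_ _
  refine Finset.measurable_fun_sum _ fun i hi => ?_
  exact (measurable_eval hA).comp (measurable_replacement_history (Finset.mem_range.1 hi))

omit [IsProbabilityMeasure P] in
theorem IsMVPP.history_le (hR : IsMVPP P m₀ ρ PR Y R) (n : ℕ) :
    history Y R n ≤ ‹MeasurableSpace Ω› :=
  iSup₂_le fun i _ => sup_le (hR.measurable_colour i).comap_le
    (hR.measurable_replacement i).comap_le

omit [IsProbabilityMeasure P] in
theorem IsMVPP.history_sup_le (hR : IsMVPP P m₀ ρ PR Y R) (n : ℕ) :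
    history Y R n ⊔ MeasurableSpace.comap (Y n) inferInstance ≤ ‹MeasurableSpace Ω› :=
  sup_le (hR.history_le n) (hR.measurable_colour n).comap_le

theorem IsMVPP.initial_mass_pos (hR : IsMVPP P m₀ ρ PR Y R) : 0 < m₀.real Set.univ := by
  obtain ⟨ω, hω⟩ := hR.tenable.exists
  have h0 := (hω 0).2
  rw [Measure.real, ENNReal.toReal_pos_iff]
  refine ⟨?_, measure_lt_top _ _⟩
  rw [pos_iff_ne_zero, Ne, Measure.measure_univ_eq_zero]
  rintro rfl
  apply h0
  simp [composition]

/-- The law of a replacement, conditionally on the past and on the colour drawn. -/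
theorem IsMVPP.map_replacement (h : IsReplacementKernel ρ PR)
    (hR : IsMVPP P m₀ ρ PR Y R) (n : ℕ) {B : Set Ω}
    (hB : MeasurableSet[history Y R n ⊔ MeasurableSpace.comap (Y n) inferInstance] B) :
    (P.restrict B).map (R n) = (P.restrict B).bind
      ((⟨fun x => PR.map (ρ x), h.measurable_law⟩ :
        ProbabilityTheory.Kernel E (SignedMeasure E)).comap (Y n) (hR.measurable_colour n)) := by
  have := h.isProbabilityMeasure
  have hprob : ∀ x, IsProbabilityMeasure (PR.map (ρ x)) := fun x =>
    Measure.isProbabilityMeasure_map (h.measurable x).aemeasurable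
  have hBm := hR.history_sup_le n B hB
  ext S hS
  have h1 := setIntegral_condExp (hR.history_sup_le n) (μ := P)
    (f := (R n ⁻¹' S).indicator (fun _ => (1 : ℝ)))
    ((integrable_const 1).indicator (hR.measurable_replacement n hS)) hB
  rw [setIntegral_congr_ae hBm ((hR.law_replacement n S hS).mono fun ω h _ => h)] at h1
  rw [Measure.map_apply (hR.measurable_replacement n) hS, Measure.bind_apply hS
    (ProbabilityTheory.Kernel.aemeasurable _)]
  simp only [ProbabilityTheory.Kernel.comap_apply]
  rw [integral_indicator (hR.measurable_replacement n hS)] at h1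
  simp only [integral_const, smul_eq_mul, mul_one, measureReal_restrict_apply_univ] at h1
  have hm : Measurable fun ω => (PR.map (ρ (Y n ω))) S :=
    ((Measure.measurable_coe hS).comp h.measurable_law).comp (hR.measurable_colour n)
  have h2 : ∫ ω in B, (PR.map (ρ (Y n ω))).real S ∂P =
      (∫⁻ ω in B, (PR.map (ρ (Y n ω))) S ∂P).toReal :=
    integral_toReal hm.aemeasurable (Eventually.of_forall fun ω => measure_lt_top _ _)
  rw [h2] at h1
  have h3 : ∫⁻ ω in B, (PR.map (ρ (Y n ω))) S ∂P ≠ ∞ := by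
    refine ((lintegral_mono fun ω => prob_le_one).trans_lt ?_).ne
    simp
  have h4 : (P.restrict B) (R n ⁻¹' S) ≠ ∞ := measure_ne_top _ _
  have h5 := (ENNReal.toReal_eq_toReal_iff' h3 h4).1 h1
  exact h5.symm

theorem StandingAssumptions.map_univ_ae (h : StandingAssumptions W q ρ PR m₀ ν)
    (hR : IsMVPP P m₀ ρ PR Y R) :
    ∀ᵐ ω ∂P, ∀ n, R n ω Set.univ = 1 := by
  have := h.kernel.isProbabilityMeasure
  rw [ae_all_iff]
  intro n
  have hS : MeasurableSet {s : SignedMeasure E | s Set.univ = 1} :=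
    measurable_eval MeasurableSet.univ (measurableSet_singleton 1)
  have h1 := hR.map_replacement h.kernel n (B := Set.univ) MeasurableSet.univ
  rw [Measure.restrict_univ] at h1
  have h2 : ∀ᵐ s ∂(P.map (R n)), s Set.univ = 1 := by
    rw [h1]
    change (P.bind _) {s : SignedMeasure E | s Set.univ = 1}ᶜ = 0
    rw [Measure.bind_apply hS.compl (ProbabilityTheory.Kernel.aemeasurable _)]
    refine (lintegral_congr fun ω => ?_).trans lintegral_zero
    rw [ProbabilityTheory.Kernel.comap_apply]
    exact (ae_map_iff (h.kernel.measurable _).aemeasurable hS).2 (h.balance _)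
  exact ae_of_ae_map (hR.measurable_replacement n).aemeasurable h2

theorem StandingAssumptions.composition_univ_ae (h : StandingAssumptions W q ρ PR m₀ ν)
    (hR : IsMVPP P m₀ ρ PR Y R) :
    ∀ᵐ ω ∂P, ∀ n : ℕ, composition m₀ R n ω Set.univ = m₀.real Set.univ + n := by
  filter_upwards [h.map_univ_ae hR] with ω hω n
  rw [composition_apply, Measure.toSignedMeasure_apply_measurable MeasurableSet.univ]
  simp [hω]

/-- A measurable set containing the paths on which some composition fails to be a positive measure
of the deterministic total mass `m₀(E) + n`. -/
def irregularPaths (P : Measure Ω) (m₀ : Measure E) [IsFiniteMeasure m₀]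
    (R : ℕ → Ω → SignedMeasure E) : Set Ω :=
  toMeasurable P {ω | ¬ ∀ n : ℕ, 0 ≤ composition m₀ R n ω ∧
    composition m₀ R n ω Set.univ = m₀.real Set.univ + n}

omit [IsProbabilityMeasure P] in
theorem composition_of_notMem_irregularPaths {ω : Ω} (hω : ω ∉ irregularPaths P m₀ R) (n : ℕ) :
    0 ≤ composition m₀ R n ω ∧ composition m₀ R n ω Set.univ = m₀.real Set.univ + n := by
  by_contra hc
  exact hω (subset_toMeasurable _ _ fun hall => hc (hall n))

theorem StandingAssumptions.notMem_irregularPaths_ae (h : StandingAssumptions W q ρ PR m₀ ν)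
    (hR : IsMVPP P m₀ ρ PR Y R) : ∀ᵐ ω ∂P, ω ∉ irregularPaths P m₀ R := by
  rw [ae_iff]
  simp only [not_not]
  change P (irregularPaths P m₀ R) = 0
  rw [irregularPaths, measure_toMeasurable]
  rw [← ae_iff]
  filter_upwards [hR.tenable, h.composition_univ_ae hR] with ω h1 h2 n
  exact ⟨(h1 n).1, h2 n⟩

/-- The composition after `n` steps as a kernel of positive measures. It vanishes on a null set of
paths, outside of which all compositions are positive of the right mass; this makes it a finite
kernel. -/
def IsMVPP.urnKernel (hR : IsMVPP P m₀ ρ PR Y R) (n : ℕ) : ProbabilityTheory.Kernel Ω E := by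
  classical
  exact
  { toFun := fun ω => if ω ∈ irregularPaths P m₀ R then 0 else (composition m₀ R n ω).variation
    measurable' := by
      refine Measure.measurable_of_measurable_coe _ fun A hA => ?_
      have e : (fun ω => (if ω ∈ irregularPaths P m₀ R then (0 : Measure E) else
          (composition m₀ R n ω).variation) A) = fun ω => if ω ∈ irregularPaths P m₀ R then 0 else
            ENNReal.ofReal (composition m₀ R n ω A) := by
        ext ω
        split_ifs with hω
        · simp
        · have := isFiniteMeasure_variation (composition m₀ R n ω)
          conv_rhs => rw [eq_toSignedMeasure_variation
            (composition_of_notMem_irregularPaths hω n).1]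
          rw [Measure.toSignedMeasure_apply_measurable hA, ofReal_measureReal]
      rw [e]
      exact Measurable.ite (measurableSet_toMeasurable _ _) measurable_const
        ((measurable_composition_apply n hA).mono (hR.history_le n) le_rfl).ennreal_ofReal }

omit [IsProbabilityMeasure P] in
theorem IsMVPP.urnKernel_of_mem (hR : IsMVPP P m₀ ρ PR Y R) (n : ℕ) {ω : Ω}
    (hω : ω ∈ irregularPaths P m₀ R) : hR.urnKernel n ω = 0 := if_pos hω

omit [IsProbabilityMeasure P] in
theorem IsMVPP.urnKernel_of_notMem (hR : IsMVPP P m₀ ρ PR Y R) (n : ℕ) {ω : Ω}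
    (hω : ω ∉ irregularPaths P m₀ R) : hR.urnKernel n ω = (composition m₀ R n ω).variation :=
  if_neg hω

instance IsMVPP.isFiniteKernel_urnKernel (hR : IsMVPP P m₀ ρ PR Y R) (n : ℕ) :
    ProbabilityTheory.IsFiniteKernel (hR.urnKernel n) := by
  refine ⟨ENNReal.ofReal (m₀.real Set.univ + n), ENNReal.ofReal_lt_top, fun ω => ?_⟩
  by_cases hω : ω ∈ irregularPaths P m₀ R
  · simp [hR.urnKernel_of_mem n hω]
  · have := isFiniteMeasure_variation (composition m₀ R n ω)
    have hc := composition_of_notMem_irregularPaths hω n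
    rw [hR.urnKernel_of_notMem n hω, ← hc.2]
    conv_rhs => rw [eq_toSignedMeasure_variation hc.1]
    rw [Measure.toSignedMeasure_apply_measurable MeasurableSet.univ, ofReal_measureReal]

theorem StandingAssumptions.composition_eq_urnKernel (h : StandingAssumptions W q ρ PR m₀ ν)
    (hR : IsMVPP P m₀ ρ PR Y R) :
    ∀ᵐ ω ∂P, ∀ n, composition m₀ R n ω = (hR.urnKernel n ω).toSignedMeasure := by
  filter_upwards [h.notMem_irregularPaths_ae hR] with ω hω n
  have := isFiniteMeasure_variation (composition m₀ R n ω)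
  have e := hR.urnKernel_of_notMem n hω
  have e2 := eq_toSignedMeasure_variation (composition_of_notMem_irregularPaths hω n).1
  rw [e2]
  congr 1
  exact e.symm

theorem StandingAssumptions.urnKernel_real_ae (h : StandingAssumptions W q ρ PR m₀ ν)
    (hR : IsMVPP P m₀ ρ PR Y R) {A : Set E} (hA : MeasurableSet A) :
    ∀ᵐ ω ∂P, ∀ n, (hR.urnKernel n ω).real A = composition m₀ R n ω A := by
  filter_upwards [h.composition_eq_urnKernel hR] with ω hω n
  rw [hω, Measure.toSignedMeasure_apply_measurable hA]

/-- The measure `A ↦ 𝔼[𝔪_n(A); B]`. -/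
def IsMVPP.meanUrn (hR : IsMVPP P m₀ ρ PR Y R) (B : Set Ω) (n : ℕ) : Measure E :=
  (P.restrict B).bind (hR.urnKernel n)

instance IsMVPP.isFiniteMeasure_meanUrn (hR : IsMVPP P m₀ ρ PR Y R) (B : Set Ω) (n : ℕ) :
    IsFiniteMeasure (hR.meanUrn B n) := by
  rw [IsMVPP.meanUrn]; infer_instance

theorem StandingAssumptions.meanUrn_real (h : StandingAssumptions W q ρ PR m₀ ν)
    (hR : IsMVPP P m₀ ρ PR Y R) (B : Set Ω) (n : ℕ) {A : Set E} (hA : MeasurableSet A) :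
    (hR.meanUrn B n).real A = ∫ ω in B, composition m₀ R n ω A ∂P := by
  rw [Measure.real, IsMVPP.meanUrn, Measure.bind_apply hA (hR.urnKernel n).aemeasurable,
    ← integral_toReal ((hR.urnKernel n).measurable_coe hA).aemeasurable
      (Eventually.of_forall fun ω => measure_lt_top _ _)]
  exact integral_congr_ae (ae_restrict_of_ae ((h.urnKernel_real_ae hR hA).mono fun ω hω => hω n))

theorem StandingAssumptions.meanUrn_real_univ (h : StandingAssumptions W q ρ PR m₀ ν)
    (hR : IsMVPP P m₀ ρ PR Y R) (B : Set Ω) (n : ℕ) :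
    (hR.meanUrn B n).real Set.univ = (m₀.real Set.univ + n) * P.real B := by
  rw [h.meanUrn_real hR B n MeasurableSet.univ, integral_congr_ae
    (ae_restrict_of_ae ((h.composition_univ_ae hR).mono fun ω hω => hω n))]
  simp [mul_comm]

omit [IsProbabilityMeasure P] in
theorem IsMVPP.meanUrn_mono (hR : IsMVPP P m₀ ρ PR Y R) {B B' : Set Ω} (hB : B ⊆ B') (n : ℕ) :
    hR.meanUrn B n ≤ hR.meanUrn B' n := by
  refine Measure.le_iff.2 fun A hA => ?_
  rw [IsMVPP.meanUrn, IsMVPP.meanUrn, Measure.bind_apply hA (hR.urnKernel n).aemeasurable,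
    Measure.bind_apply hA (hR.urnKernel n).aemeasurable]
  exact lintegral_mono' (Measure.restrict_mono hB le_rfl) le_rfl

theorem StandingAssumptions.meanUrn_univ_zero (h : StandingAssumptions W q ρ PR m₀ ν)
    (hR : IsMVPP P m₀ ρ PR Y R) : hR.meanUrn Set.univ 0 = m₀ := by
  ext A hA
  rw [← measureReal_eq_measureReal_iff, h.meanUrn_real hR _ _ hA]
  simp [composition, Measure.toSignedMeasure_apply_measurable hA]

theorem StandingAssumptions.integrable_composition (h : StandingAssumptions W q ρ PR m₀ ν)
    (hR : IsMVPP P m₀ ρ PR Y R) (n : ℕ) {A : Set E} (hA : MeasurableSet A) :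
    Integrable (fun ω => composition m₀ R n ω A) P := by
  refine Integrable.of_bound
    ((measurable_composition_apply n hA).mono (hR.history_le n) le_rfl).aestronglyMeasurable
    (m₀.real Set.univ + n) ?_
  filter_upwards [h.urnKernel_real_ae hR hA, h.urnKernel_real_ae hR MeasurableSet.univ,
    h.composition_univ_ae hR] with ω h1 h2 h3
  rw [← h3, ← h1, ← h2, Real.norm_of_nonneg measureReal_nonneg]
  exact measureReal_mono (Set.subset_univ A)

/-- The mean of a replacement, conditionally on the past and on the colour drawn. -/
theorem StandingAssumptions.setIntegral_replacement (h : StandingAssumptions W q ρ PR m₀ ν)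
    (hR : IsMVPP P m₀ ρ PR Y R) (n : ℕ) {B : Set Ω}
    (hB : MeasurableSet[history Y R n ⊔ MeasurableSpace.comap (Y n) inferInstance] B)
    {A : Set E} (hA : MeasurableSet A) :
    Integrable (fun ω => R n ω A) P ∧
      ∫ ω in B, R n ω A ∂P = ∫ ω in B, meanMeasure (ρ (Y n ω)) PR A ∂P := by
  have hprob := h.kernel.isProbabilityMeasure
  have hi : Integrable (fun ω => R n ω A) P := by
    refine ((h.integrable_composition hR (n + 1) hA).sub
      (h.integrable_composition hR n hA)).congr (Eventually.of_forall fun ω => ?_)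
    simp [composition_succ]
  refine ⟨hi, ?_⟩
  have hK : ProbabilityTheory.IsMarkovKernel
      ((⟨fun x => PR.map (ρ x), h.kernel.measurable_law⟩ :
        ProbabilityTheory.Kernel E (SignedMeasure E)).comap (Y n) (hR.measurable_colour n)) :=
    ⟨fun ω => Measure.isProbabilityMeasure_map (h.kernel.measurable _).aemeasurable⟩
  have h1 := hR.map_replacement h.kernel n hB
  have h2 : Integrable (fun s : SignedMeasure E => s A) ((P.restrict B).map (R n)) :=
    (integrable_map_measure (measurable_eval hA).aestronglyMeasurable
      (hR.measurable_replacement n).aemeasurable).2 hi.integrableOn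
  have h3 := integral_map (μ := P.restrict B) (hR.measurable_replacement n).aemeasurable
    (measurable_eval hA).aestronglyMeasurable
  rw [h1] at h2 h3
  rw [← h3, (integral_bind_kernel _ h2).1]
  refine integral_congr_ae (Eventually.of_forall fun ω => ?_)
  simp only [ProbabilityTheory.Kernel.comap_apply]
  rw [meanMeasure_apply (h.kernel.measurable _)
    (lintegral_variation_univ_lt_top h.kernel h.moment _) hA]
  exact integral_map (h.kernel.measurable _).aemeasurable (measurable_eval hA).aestronglyMeasurable

/-- The law of a colour drawn, conditionally on the past. -/
theorem StandingAssumptions.map_colour (h : StandingAssumptions W q ρ PR m₀ ν)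
    (hR : IsMVPP P m₀ ρ PR Y R) (n : ℕ) {B : Set Ω} (hB : MeasurableSet[history Y R n] B) :
    (P.restrict B).map (Y n) = ENNReal.ofReal (m₀.real Set.univ + n)⁻¹ • hR.meanUrn B n := by
  ext A hA
  have hBm := hR.history_le n B hB
  have h1 := setIntegral_condExp (hR.history_le n) (μ := P)
    (f := (Y n ⁻¹' A).indicator (fun _ => (1 : ℝ)))
    ((integrable_const 1).indicator (hR.measurable_colour n hA)) hB
  have ha := hR.initial_mass_pos
  rw [← measureReal_eq_measureReal_iff (measure_ne_top _ _)
    (ENNReal.mul_ne_top ENNReal.ofReal_ne_top (measure_ne_top (hR.meanUrn B n) A)), measureReal_ennreal_smul_apply, ENNReal.toReal_ofReal (by positivity),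
    h.meanUrn_real hR _ _ hA, map_measureReal_apply (hR.measurable_colour n) hA,
    ← MeasureTheory.integral_const_mul]
  rw [integral_indicator (hR.measurable_colour n hA)] at h1
  simp only [integral_const, smul_eq_mul, mul_one, measureReal_restrict_apply_univ] at h1
  rw [← h1]
  refine integral_congr_ae (ae_restrict_of_ae ?_)
  filter_upwards [hR.law_colour n A hA, h.composition_univ_ae hR] with ω h2 h3
  rw [h2, h3, div_eq_inv_mul]

end UrnMeasures

/-! ### Mean values along the urn -/

/-- Almost everywhere limits for a measure that may live on a larger σ-field. -/
theorem aestronglyMeasurable_of_tendsto_ae_subalgebra {Ω : Type*} {m m' : MeasurableSpace Ω}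
    {μ : @Measure Ω m'} {u : ℕ → Ω → ℂ} {v : Ω → ℂ} (hu : ∀ n, AEStronglyMeasurable[m] (u n) μ)
    (hlim : ∀ᵐ ω ∂μ, Tendsto (fun n => u n ω) atTop (𝓝 (v ω))) : AEStronglyMeasurable[m] v μ := by
  refine ⟨fun ω => limUnder atTop fun n => (hu n).mk _ ω,
    @StronglyMeasurable.limUnder _ _ _ m _ _ _ _ _ _ _ fun n => (hu n).stronglyMeasurable_mk, ?_⟩
  filter_upwards [hlim, ae_all_iff.2 fun n => (hu n).ae_eq_mk] with ω h1 h2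
  simp only [h2] at h1
  exact h1.limUnder_eq.symm

section MeanValues

variable {E Ω Ω' : Type*} [MeasurableSpace E] [MeasurableSpace Ω] [MeasurableSpace Ω']
  {W : Weight E} {q : ℝ} {ρ : E → Ω' → SignedMeasure E} {PR : Measure Ω'}
  {m₀ ν : Measure E} [IsFiniteMeasure m₀] {P : Measure Ω} [IsProbabilityMeasure P]
  {Y : ℕ → Ω → E} {R : ℕ → Ω → SignedMeasure E}

theorem integral_indicator_apply (μ : Measure E) {A : Set E} (hA : MeasurableSet A) :
    ∫ x, (BW.indicator A hA : BW W) x ∂μ = ((μ.real A : ℝ) : ℂ) := by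
  simp only [BW.indicator_apply]
  rw [integral_indicator_const _ hA]
  simp

theorem StandingAssumptions.integral_indicator_meanUrn_succ
    (h : StandingAssumptions W q ρ PR m₀ ν) (hR : IsMVPP P m₀ ρ PR Y R) (n : ℕ) {B : Set Ω}
    (hB : MeasurableSet[history Y R n ⊔ MeasurableSpace.comap (Y n) inferInstance] B)
    {A : Set E} (hA : MeasurableSet A) :
    ∫ x, (BW.indicator A hA : BW W) x ∂hR.meanUrn B (n + 1) =
      ∫ x, (BW.indicator A hA : BW W) x ∂hR.meanUrn B n +
        ∫ x, meanOp h.kernel h.moment (BW.indicator A hA) x ∂((P.restrict B).map (Y n)) := by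
  obtain ⟨h1, h2⟩ := h.setIntegral_replacement hR n hB hA
  rw [integral_indicator_apply, integral_indicator_apply]
  simp only [meanOp_indicator]
  rw [integral_complex_ofReal, integral_map (hR.measurable_colour n).aemeasurable
    (measurable_meanMeasure h.kernel h.moment hA).aestronglyMeasurable, ← h2,
    h.meanUrn_real hR _ _ hA, h.meanUrn_real hR _ _ hA, ← Complex.ofReal_add,
    ← integral_add (h.integrable_composition hR n hA).integrableOn h1.integrableOn]
  simp [composition_succ]

theorem StandingAssumptions.map_colour_le (h : StandingAssumptions W q ρ PR m₀ ν)
    (hR : IsMVPP P m₀ ρ PR Y R) (n : ℕ) (B : Set Ω) :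
    (P.restrict B).map (Y n) ≤
      ENNReal.ofReal (m₀.real Set.univ + n)⁻¹ • hR.meanUrn Set.univ n := by
  rw [← h.map_colour hR n MeasurableSet.univ, Measure.restrict_univ]
  exact Measure.map_mono Measure.restrict_le_self (hR.measurable_colour n)

/-- `𝔼[𝔪_n W] < ∞`. The step from `n` to `n + 1` bounds `𝔼[𝔪_{n+1} φ]` for simple functions
`φ ≤ W`, where no integrability of `W` under the new mean measure is needed. -/
theorem StandingAssumptions.integrable_weight_meanUrn (h : StandingAssumptions W q ρ PR m₀ ν)
    (hR : IsMVPP P m₀ ρ PR Y R) (n : ℕ) : Integrable W (hR.meanUrn Set.univ n) := by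
  induction n with
  | zero =>
    rw [h.meanUrn_univ_zero hR]
    exact W.integrable_of_rpow (by linarith [h.moment.two_lt]) h.initial
  | succ n ih =>
    obtain ⟨K, hK, hKb⟩ := exists_norm_meanOp_apply_le h.kernel h.moment
    have hL : Integrable W ((P.restrict Set.univ).map (Y n)) :=
      (ih.smul_measure ENNReal.ofReal_ne_top).mono_measure (h.map_colour_le hR n Set.univ)
    set L := (P.restrict Set.univ).map (Y n) with hLdef
    have hsimple : ∀ φ : SimpleFunc E ℂ,
        Integrable (BW.ofSimple φ : BW W) (hR.meanUrn Set.univ (n + 1)) ∧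
        ∫ x, (BW.ofSimple φ : BW W) x ∂hR.meanUrn Set.univ (n + 1) =
          ∫ x, (BW.ofSimple φ : BW W) x ∂hR.meanUrn Set.univ n +
            ∫ x, meanOp h.kernel h.moment (BW.ofSimple φ) x ∂L := by
      intro φ
      refine BW.ofSimple_induction (W := W) (p := fun g =>
        Integrable g (hR.meanUrn Set.univ (n + 1)) ∧
        ∫ x, g x ∂hR.meanUrn Set.univ (n + 1) = ∫ x, g x ∂hR.meanUrn Set.univ n +
            ∫ x, meanOp h.kernel h.moment g x ∂L) ?_ ?_ ?_ φ
      · intro A hA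
        exact ⟨(integrable_const (1 : ℂ)).indicator hA,
          h.integral_indicator_meanUrn_succ hR n MeasurableSet.univ hA⟩
      · rintro f g ⟨hf, hf'⟩ ⟨hg, hg'⟩
        refine ⟨hf.add hg, ?_⟩
        rw [map_add]
        simp only [BW.add_apply]
        rw [integral_add hf hg, integral_add (f.integrable ih) (g.integrable ih),
          integral_add (BW.integrable hL _) (BW.integrable hL _), hf', hg']
        ring
      · rintro c f ⟨hf, hf'⟩
        refine ⟨hf.const_mul c, ?_⟩
        rw [map_smul]
        simp only [BW.smul_apply]
        rw [MeasureTheory.integral_const_mul, MeasureTheory.integral_const_mul,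
          MeasureTheory.integral_const_mul, hf']
        ring
    set M : ℝ := ∫ x, W x ∂hR.meanUrn Set.univ n + K * ∫ x, W x ∂L with hM
    refine ⟨W.measurable'.aestronglyMeasurable, ?_⟩
    have hle : ∫⁻ x, ENNReal.ofReal (W x) ∂hR.meanUrn Set.univ (n + 1) ≤ ENNReal.ofReal M := by
      rw [lintegral_eq_nnreal]
      refine iSup₂_le fun φ hφ => ?_
      have hφ' : ∀ x, ((φ x : ℝ≥0) : ℝ) ≤ W x := fun x => by
        have := hφ x
        rw [ENNReal.ofReal, ENNReal.coe_le_coe] at this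
        exact (NNReal.coe_le_coe.2 this).trans (Real.coe_toNNReal _ (W.pos x).le).le
      obtain ⟨h1, h2⟩ := hsimple (φ.map fun r : ℝ≥0 => ((r : ℝ) : ℂ))
      set g : BW W := BW.ofSimple (φ.map fun r : ℝ≥0 => ((r : ℝ) : ℂ)) with hg
      have hgx : ∀ x, g x = (((φ x : ℝ≥0) : ℝ) : ℂ) := fun x => rfl
      have hgb : ∀ x, ‖g x‖ ≤ 1 * W x := fun x => by
        rw [hgx, Complex.norm_real, Real.norm_of_nonneg (NNReal.coe_nonneg _), one_mul]
        exact hφ' x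
      have h3 : ‖∫ x, g x ∂hR.meanUrn Set.univ (n + 1)‖ ≤ M := by
        rw [h2, hM, ← MeasureTheory.integral_const_mul]
        refine (norm_add_le _ _).trans (add_le_add ?_ ?_)
        · exact norm_integral_le_of_norm_le ih (Eventually.of_forall fun x => by
            simpa using hgb x)
        · exact norm_integral_le_of_norm_le (hL.const_mul K) (Eventually.of_forall fun x => by
            simpa using hKb g 1 hgb x)
      rw [← SimpleFunc.lintegral_eq_lintegral]
      refine le_trans (le_of_eq ?_) (ENNReal.ofReal_le_ofReal h3)
      have h4 : ∫ x, g x ∂hR.meanUrn Set.univ (n + 1) =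
          ((∫ x, ((φ x : ℝ≥0) : ℝ) ∂hR.meanUrn Set.univ (n + 1) : ℝ) : ℂ) :=
        integral_complex_ofReal
      rw [h4, Complex.norm_real, Real.norm_of_nonneg (integral_nonneg fun x => NNReal.coe_nonneg _),
        ofReal_integral_eq_lintegral_ofReal]
      · refine lintegral_congr fun x => ?_
        simp
      · simpa [hgx] using h1.norm
      · exact Eventually.of_forall fun x => NNReal.coe_nonneg _
    refine lt_of_le_of_lt ((lintegral_congr fun x => ?_).trans_le hle) ENNReal.ofReal_lt_top
    rw [← ofReal_norm, Real.norm_of_nonneg (W.pos x).le]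

theorem StandingAssumptions.integrable_weight_meanUrn_restrict
    (h : StandingAssumptions W q ρ PR m₀ ν) (hR : IsMVPP P m₀ ρ PR Y R) (B : Set Ω) (n : ℕ) :
    Integrable W (hR.meanUrn B n) :=
  (h.integrable_weight_meanUrn hR n).mono_measure (hR.meanUrn_mono (Set.subset_univ B) n)

theorem StandingAssumptions.integrable_weight_map_colour
    (h : StandingAssumptions W q ρ PR m₀ ν) (hR : IsMVPP P m₀ ρ PR Y R) (B : Set Ω) (n : ℕ) :
    Integrable W ((P.restrict B).map (Y n)) :=
  ((h.integrable_weight_meanUrn hR n).smul_measure ENNReal.ofReal_ne_top).mono_measure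
    (h.map_colour_le hR n B)

theorem StandingAssumptions.integral_meanUrn_succ (h : StandingAssumptions W q ρ PR m₀ ν)
    (hR : IsMVPP P m₀ ρ PR Y R) (n : ℕ) {B : Set Ω}
    (hB : MeasurableSet[history Y R n ⊔ MeasurableSpace.comap (Y n) inferInstance] B) (g : BW W) :
    ∫ x, g x ∂hR.meanUrn B (n + 1) = ∫ x, g x ∂hR.meanUrn B n +
      ∫ x, meanOp h.kernel h.moment g x ∂((P.restrict B).map (Y n)) := by
  obtain ⟨K, hK, hKb⟩ := exists_norm_meanOp_apply_le h.kernel h.moment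
  have h1 := h.integrable_weight_meanUrn_restrict hR B (n + 1)
  have h2 := h.integrable_weight_meanUrn_restrict hR B n
  have h3 := h.integrable_weight_map_colour hR B n
  induction g using BW.induction with
  | hind A hA => exact h.integral_indicator_meanUrn_succ hR n hB hA
  | hadd f g hf hg =>
    rw [map_add]
    simp only [BW.add_apply]
    rw [integral_add (f.integrable h1) (g.integrable h1), integral_add (f.integrable h2)
      (g.integrable h2), integral_add (BW.integrable h3 _) (BW.integrable h3 _), hf, hg]
    ring
  | hsmul c f hf =>
    rw [map_smul]
    simp only [BW.smul_apply]
    rw [MeasureTheory.integral_const_mul, MeasureTheory.integral_const_mul,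
      MeasureTheory.integral_const_mul, hf]
    ring
  | hlim u g C hb hu ih =>
    refine tendsto_nhds_unique (BW.tendsto_integral h1 hb hu) ?_
    simp only [ih]
    exact (BW.tendsto_integral h2 hb hu).add (BW.tendsto_integral h3
      (fun n => hKb (u n) C (hb n)) (tendsto_meanOp_apply h.kernel h.moment hb hu))

/-- `𝔼[𝔪_{k+m} g; B] = 𝔼[𝔪_k (∏_{i<m} (1 + 𝐑/(i+b)) g); B]` for `B` in the history up to time `k`,
where `b = 𝔪_k(E) = m₀(E) + k`. -/
theorem StandingAssumptions.integral_meanUrn_add (h : StandingAssumptions W q ρ PR m₀ ν)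
    (hR : IsMVPP P m₀ ρ PR Y R) (k : ℕ) {B : Set Ω} (hB : MeasurableSet[history Y R k] B)
    (m : ℕ) (g : BW W) :
    ∫ x, g x ∂hR.meanUrn B (k + m) = ∫ x, stepProd (meanOp h.kernel h.moment)
      (harmonicStep (m₀.real Set.univ + k)) m g x ∂hR.meanUrn B k := by
  induction m generalizing g with
  | zero => rfl
  | succ m ih =>
    have hB' : MeasurableSet[history Y R (k + m)] B := history_mono (Nat.le_add_right k m) B hB
    have ha := hR.initial_mass_pos
    have hi := h.integrable_weight_meanUrn_restrict hR B (k + m)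
    rw [← add_assoc, h.integral_meanUrn_succ hR _ (le_sup_left (a := history Y R (k + m)) B hB'),
      h.map_colour hR _ hB', integral_smul_measure, ENNReal.toReal_ofReal (by positivity),
      stepProd_succ_apply, ← stepProd_apply_comm, ← map_smul, ← map_add, ← ih]
    simp only [BW.add_apply, BW.smul_apply]
    rw [integral_add (BW.integrable hi _) ((BW.integrable hi _).const_mul _),
      MeasureTheory.integral_const_mul, Complex.real_smul, harmonicStep]
    push_cast
    ring_nf

theorem StandingAssumptions.integrable_weight_urnKernel (h : StandingAssumptions W q ρ PR m₀ ν)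
    (hR : IsMVPP P m₀ ρ PR Y R) : ∀ᵐ ω ∂P, ∀ n, Integrable W (hR.urnKernel n ω) := by
  rw [ae_all_iff]
  intro n
  have := (integral_bind_kernel _ (h.integrable_weight_meanUrn hR n)).2.2
  rwa [Measure.restrict_univ] at this

theorem StandingAssumptions.integral_composition_ae (h : StandingAssumptions W q ρ PR m₀ ν)
    (hR : IsMVPP P m₀ ρ PR Y R) {F : Type*} [NormedAddCommGroup F] [NormedSpace ℝ F] :
    ∀ᵐ ω ∂P, ∀ (g : E → F) (n : ℕ),
      ∫ᵛ x, g x ∂<•(composition m₀ R n ω) = ∫ x, g x ∂hR.urnKernel n ω := by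
  filter_upwards [h.composition_eq_urnKernel hR] with ω hω g n
  rw [hω, VectorMeasure.integral_toSignedMeasure]

theorem StandingAssumptions.integrable_integral_composition
    (h : StandingAssumptions W q ρ PR m₀ ν) (hR : IsMVPP P m₀ ρ PR Y R) (n : ℕ) (g : BW W) :
    Integrable (fun ω => ∫ᵛ x, g x ∂<•(composition m₀ R n ω)) P := by
  have h1 := (integral_bind_kernel _ (g.integrable (h.integrable_weight_meanUrn hR n))).2.1
  rw [Measure.restrict_univ] at h1
  exact h1.congr ((h.integral_composition_ae hR (F := ℂ)).mono fun ω hω => (hω g n).symm)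

theorem StandingAssumptions.setIntegral_integral_composition
    (h : StandingAssumptions W q ρ PR m₀ ν) (hR : IsMVPP P m₀ ρ PR Y R) (B : Set Ω) (n : ℕ)
    (g : BW W) :
    ∫ ω in B, ∫ᵛ x, g x ∂<•(composition m₀ R n ω) ∂P = ∫ x, g x ∂hR.meanUrn B n := by
  rw [IsMVPP.meanUrn, (integral_bind_kernel _
    (g.integrable (h.integrable_weight_meanUrn_restrict hR B n))).1]
  exact integral_congr_ae (ae_restrict_of_ae
    ((h.integral_composition_ae hR (F := ℂ)).mono fun ω hω => hω g n))

theorem StandingAssumptions.aestronglyMeasurable_integral_composition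
    (h : StandingAssumptions W q ρ PR m₀ ν) (hR : IsMVPP P m₀ ρ PR Y R) (n : ℕ) (g : BW W) :
    AEStronglyMeasurable[history Y R n] (fun ω => ∫ᵛ x, g x ∂<•(composition m₀ R n ω)) P := by
  have hcongr : ∀ {f : BW W}, AEStronglyMeasurable[history Y R n]
      (fun ω => ∫ x, f x ∂hR.urnKernel n ω) P → AEStronglyMeasurable[history Y R n]
      (fun ω => ∫ᵛ x, f x ∂<•(composition m₀ R n ω)) P := fun {f} hf =>
    hf.congr ((h.integral_composition_ae hR (F := ℂ)).mono fun ω hω => (hω f n).symm)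
  refine hcongr ?_
  induction g using BW.induction with
  | hind A hA =>
    have h1 : StronglyMeasurable[history Y R n]
        fun ω => ((composition m₀ R n ω A : ℝ) : ℂ) :=
      (Complex.measurable_ofReal.comp (measurable_composition_apply n hA)).stronglyMeasurable
    refine h1.aestronglyMeasurable.congr ?_
    filter_upwards [h.urnKernel_real_ae hR hA] with ω hω
    rw [integral_indicator_apply, hω]
  | hadd f g hf hg =>
    refine (hf.add hg).congr ?_
    filter_upwards [h.integrable_weight_urnKernel hR] with ω hω
    exact (integral_add (f.integrable (hω n)) (g.integrable (hω n))).symm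
  | hsmul c f hf =>
    refine (hf.const_smul c).congr (Eventually.of_forall fun ω => ?_)
    exact (MeasureTheory.integral_const_mul c f).symm
  | hlim u g C hb hu ih =>
    refine aestronglyMeasurable_of_tendsto_ae_subalgebra ih ?_
    filter_upwards [h.integrable_weight_urnKernel hR] with ω hω
    exact BW.tendsto_integral (hω n) hb hu

end MeanValues

/-! ### Invariant functionals and powers of the mean operator -/

section Functionals

variable {X : Type*} [NormedAddCommGroup X] [NormedSpace ℂ X]

theorem prod_one_add_harmonicStep {b : ℝ} (hb : 0 < b) (n : ℕ) :
    ∏ i ∈ Finset.range n, (1 + harmonicStep b i) = ((n : ℂ) + b) / b := by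
  have hne : ∀ i : ℕ, ((i : ℂ) + b) ≠ 0 := fun i => by
    have : ((i : ℝ) + b) ≠ 0 := by positivity
    exact_mod_cast this
  induction n with
  | zero =>
    have := hne 0
    simp only [Nat.cast_zero, zero_add] at this
    simp [this]
  | succ n ih =>
    have h0 := hne 0
    simp only [Nat.cast_zero, zero_add] at h0
    have hn := hne n
    rw [Finset.prod_range_succ, ih, harmonicStep]
    push_cast
    field_simp
    ring

theorem apply_stepProd_of_invariant {T : X →L[ℂ] X} {φ : X →L[ℂ] ℂ} (hφ : ∀ v, φ (T v) = φ v)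
    (δ : ℕ → ℂ) (n : ℕ) (v : X) :
    φ (stepProd T δ n v) = (∏ i ∈ Finset.range n, (1 + δ i)) * φ v := by
  induction n with
  | zero => simp [stepProd_zero]
  | succ n ih =>
    rw [stepProd_succ_apply, map_add, map_smul, hφ, ih, Finset.prod_range_succ, smul_eq_mul]
    ring

/-- The spectral projection at `1` is given by the invariant functional. -/
theorem IsSLQC.spectralProjection_one_apply [CompleteSpace X] {T : X →L[ℂ] X} (h : IsSLQC T)
    {e : X} (he : T e = e) {φ : X →L[ℂ] ℂ} (hφ : ∀ v, φ (T v) = φ v) (hφe : φ e = 1) (v : X) :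
    spectralProjection T 1 v = φ v • e := by
  have he0 : e ≠ 0 := by
    rintro rfl
    simp at hφe
  obtain ⟨c, hc⟩ := h.exists_spectralProjection_eq_smul he he0 v
  have h1 := (φ.continuous.tendsto 0).comp (h.tendsto_stepProd he he0 one_pos hc)
  rw [map_zero] at h1
  have h2 : Tendsto (fun n : ℕ => (n : ℂ)⁻¹ * ((n : ℂ) + 1) * (φ v - c)) atTop
      (𝓝 (1 * (φ v - c))) := by
    refine Tendsto.mul_const _ ?_
    have h3 : Tendsto (fun n : ℕ => 1 + (n : ℂ)⁻¹) atTop (𝓝 (1 + 0)) :=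
      tendsto_const_nhds.add tendsto_inv_atTop_nhds_zero_nat
    rw [add_zero] at h3
    refine h3.congr' ((eventually_gt_atTop 0).mono fun n hn => ?_)
    have : (n : ℂ) ≠ 0 := by exact_mod_cast hn.ne'
    field_simp
  have h4 : (1 : ℂ) * (φ v - c) = 0 := by
    refine tendsto_nhds_unique h2 (h1.congr fun n => ?_)
    rw [Function.comp_apply, ← Complex.coe_smul, map_smul, map_sub,
      apply_stepProd_of_invariant hφ, map_smul, map_smul, hφe, prod_one_add_harmonicStep one_pos]
    simp only [smul_eq_mul]
    push_cast
    ring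
  rw [one_mul, sub_eq_zero] at h4
  rw [hc, h4]

/-- A functional vanishes along the products iff it vanishes along the powers, as both families
span the same subspaces. -/
theorem forall_apply_stepProd_eq_zero_iff {T : X →L[ℂ] X} {φ : X →L[ℂ] ℂ} {δ : ℕ → ℂ}
    (hδ : ∀ i, δ i ≠ 0) (v : X) :
    (∀ n, φ (stepProd T δ n v) = 0) ↔ ∀ n, φ ((T ^ n) v) = 0 := by
  constructor
  · intro h
    have key : ∀ n m, φ ((T ^ n) (stepProd T δ m v)) = 0 := by
      intro n
      induction n with
      | zero => simpa using h
      | succ n ih =>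
        intro m
        have h1 := ih (m + 1)
        rw [stepProd_succ_apply, map_add, map_add, ih m, zero_add, map_smul, map_smul,
          smul_eq_mul, mul_eq_zero] at h1
        rw [pow_succ]
        exact h1.resolve_left (hδ m)
    intro n
    simpa [stepProd_zero] using key n 0
  · intro h
    have key : ∀ m n, φ ((T ^ n) (stepProd T δ m v)) = 0 := by
      intro m
      induction m with
      | zero => simpa [stepProd_zero] using h
      | succ m ih =>
        intro n
        have h1 : (T ^ n) (T (stepProd T δ m v)) = (T ^ (n + 1)) (stepProd T δ m v) := by
          rw [pow_succ]; rfl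
        rw [stepProd_succ_apply, map_add, map_add, ih n, zero_add, map_smul, map_smul, h1,
          ih (n + 1), smul_zero]
    intro n
    simpa using key n 0

theorem apply_pow_eq_zero_of_add_smul {T : X →L[ℂ] X} {φ : X →L[ℂ] ℂ} {C : ℂ} {v : X}
    (h : ∀ n, φ (((T + C • (1 : X →L[ℂ] X)) ^ n) v) = 0) (n : ℕ) : φ ((T ^ n) v) = 0 := by
  have key : ∀ m n, φ (((T + C • (1 : X →L[ℂ] X)) ^ n) ((T ^ m) v)) = 0 := by
    intro m
    induction m with
    | zero => simpa using h
    | succ m ih =>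
      intro n
      have h1 := ih (n + 1)
      have h2 : ((T + C • (1 : X →L[ℂ] X)) ^ (n + 1)) ((T ^ m) v) =
          ((T + C • (1 : X →L[ℂ] X)) ^ n) ((T ^ (m + 1)) v) +
            C • ((T + C • (1 : X →L[ℂ] X)) ^ n) ((T ^ m) v) := by
        rw [pow_succ, pow_succ' T, ← map_smul, ← map_add]
        rfl
      rw [h2, map_add, map_smul, ih n, smul_zero, add_zero] at h1
      exact h1
  simpa using key n 0

theorem coe_stepProd_restrict {T : X →L[ℂ] X} {D : Submodule ℂ X} (hD : ∀ v ∈ D, T v ∈ D)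
    (δ : ℕ → ℂ) (n : ℕ) (v : D) :
    (stepProd (T.restrict hD) δ n v : X) = stepProd T δ n v := by
  induction n with
  | zero => rfl
  | succ n ih =>
    rw [stepProd_succ_apply, stepProd_succ_apply, ← ih]
    rfl

end Functionals

/-! ### Square integrable random variables and conditional means -/

section Probability

theorem tendsto_integral_mul_of_eLpNorm {Ω : Type*} [MeasurableSpace Ω] {μ : Measure Ω}
    {u : ℕ → Ω → ℂ} {Z : Ω → ℂ} (hZ : MemLp Z 2 μ) (hu : ∀ n, AEStronglyMeasurable (u n) μ)
    (h : Tendsto (fun n => eLpNorm (u n) 2 μ) atTop (𝓝 0)) :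
    Tendsto (fun n => ∫ ω, Z ω * u n ω ∂μ) atTop (𝓝 0) := by
  rw [tendsto_zero_iff_enorm_tendsto_zero]
  have h1 : Tendsto (fun n => eLpNorm Z 2 μ * eLpNorm (u n) 2 μ) atTop (𝓝 (eLpNorm Z 2 μ * 0)) :=
    ENNReal.Tendsto.const_mul h (Or.inr hZ.2.ne)
  rw [mul_zero] at h1
  refine tendsto_of_tendsto_of_tendsto_of_le_of_le tendsto_const_nhds h1 (fun _ => zero_le)
    fun n => ?_
  refine (enorm_integral_le_lintegral_enorm _).trans ?_
  have h2 := eLpNorm_smul_le_mul_eLpNorm (p := 2) (q := 2) (r := 1) (hu n) hZ.1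
  rwa [eLpNorm_one_eq_lintegral_enorm] at h2

theorem ae_eq_const_of_forall_setIntegral_eq {Ω : Type*} {m m' : MeasurableSpace Ω}
    {μ : @Measure Ω m'} [IsFiniteMeasure μ] (hm : m ≤ m') {X : Ω → ℂ} (hX : Integrable X μ)
    (hXm : AEStronglyMeasurable[m] X μ) {c : ℂ}
    (h : ∀ B, MeasurableSet[m] B → ∫ ω in B, X ω ∂μ = c * μ.real B) : ∀ᵐ ω ∂μ, X ω = c := by
  refine ae_eq_of_forall_setIntegral_eq_of_sigmaFinite' hm (g := fun _ => c)
    (fun s _ _ => hX.integrableOn) (fun s _ _ => (integrable_const c).integrableOn)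
    (fun s hs _ => ?_) hXm aestronglyMeasurable_const
  rw [h s hs]
  simp [mul_comm]

theorem integral_mul_eq_zero_of_forall_setIntegral_eq_zero {Ω : Type*}
    {m m' : MeasurableSpace Ω} {μ : @Measure Ω m'} [IsFiniteMeasure μ] (hm : m ≤ m')
    {X Z : Ω → ℂ} (hX : AEStronglyMeasurable[m] X μ) (hZ : Integrable Z μ)
    (hZX : Integrable (fun ω => X ω * Z ω) μ)
    (h : ∀ B, MeasurableSet[m] B → ∫ ω in B, Z ω ∂μ = 0) : ∫ ω, X ω * Z ω ∂μ = 0 := by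
  have h1 : (fun _ => (0 : ℂ)) =ᵐ[μ] μ[Z | m] := by
    refine ae_eq_condExp_of_forall_setIntegral_eq hm hZ
      (fun s _ _ => (integrable_const (0 : ℂ)).integrableOn) (fun s hs _ => ?_)
      aestronglyMeasurable_const
    rw [h s hs]
    simp
  have h2 := condExp_bilin_of_aestronglyMeasurable_left (ContinuousLinearMap.mul ℝ ℂ) hX hZX hZ
  rw [← integral_condExp hm]
  have h3 : μ[fun ω => X ω * Z ω | m] =ᵐ[μ] fun _ => (0 : ℂ) := by
    refine h2.trans ?_
    filter_upwards [h1] with ω hω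
    rw [← hω, map_zero]
  rw [integral_congr_ae h3]
  simp

end Probability

/-! ### Conditional means of the fluctuation limits -/

section Limits

variable {E Ω Ω' : Type*} [MeasurableSpace E] [MeasurableSpace Ω] [MeasurableSpace Ω']
  {W : Weight E} {q : ℝ} {ρ : E → Ω' → SignedMeasure E} {PR : Measure Ω'}
  {m₀ ν : Measure E} [IsFiniteMeasure m₀] {P : Measure Ω} [IsProbabilityMeasure P]
  {Y : ℕ → Ω → E} {R : ℕ → Ω → SignedMeasure E} {p : ℕ} {lam : Fin p → ℂ} {θ : ℝ} {κ : ℕ}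
  {Λ : Fin p → Ω → ℂ}

/-- The rescaled deviation of the normalised composition from `ν`. -/
def scaledDeviation (m₀ ν : Measure E) [IsFiniteMeasure m₀] (R : ℕ → Ω → SignedMeasure E)
    (θ : ℝ) (κ : ℕ) (f : E → ℂ) (n : ℕ) (ω : Ω) : ℂ :=
  (((n : ℝ) ^ (1 - θ) / (Real.log n) ^ (κ - 1) : ℝ) : ℂ) *
    ((∫ᵛ x, f x ∂<•(composition m₀ R n ω)) / ((m₀.real Set.univ + n : ℝ) : ℂ) - ∫ x, f x ∂ν)

theorem StandingAssumptions.fluctuationError_ae (h : StandingAssumptions W q ρ PR m₀ ν)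
    (hR : IsMVPP P m₀ ρ PR Y R) (f : E → ℂ) :
    ∀ᵐ ω ∂P, ∀ n, fluctuationError m₀ ν R lam θ κ f Λ n ω =
      scaledDeviation m₀ ν R θ κ f n ω -
        ∑ j, (n : ℂ) ^ (Complex.I * ((lam j).im : ℂ)) * Λ j ω := by
  filter_upwards [h.composition_univ_ae hR] with ω hω n
  rw [fluctuationError, scaledDeviation, hω n]

theorem StandingAssumptions.aestronglyMeasurable_scaledDeviation
    (h : StandingAssumptions W q ρ PR m₀ ν) (hR : IsMVPP P m₀ ρ PR Y R) (f : BW W) (n : ℕ) :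
    AEStronglyMeasurable[history Y R n] (scaledDeviation m₀ ν R θ κ f n) P := by
  have h1 := h.aestronglyMeasurable_integral_composition hR n f
  exact (((h1.mul_const (((m₀.real Set.univ + n : ℝ) : ℂ)⁻¹)).sub
    (aestronglyMeasurable_const (b := ∫ x, f x ∂ν))).const_mul
      (((n : ℝ) ^ (1 - θ) / (Real.log n) ^ (κ - 1) : ℝ) : ℂ)).congr
    (Eventually.of_forall fun ω => rfl)

theorem StandingAssumptions.integrable_scaledDeviation
    (h : StandingAssumptions W q ρ PR m₀ ν) (hR : IsMVPP P m₀ ρ PR Y R) (f : BW W) (n : ℕ) :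
    Integrable (scaledDeviation m₀ ν R θ κ f n) P :=
  (((h.integrable_integral_composition hR n f).div_const _).sub (integrable_const _)).const_mul _

theorem StandingAssumptions.aestronglyMeasurable_fluctuationError
    (h : StandingAssumptions W q ρ PR m₀ ν) (hR : IsMVPP P m₀ ρ PR Y R) (f : BW W)
    (hΛ : ∀ j, AEStronglyMeasurable (Λ j) P) (n : ℕ) :
    AEStronglyMeasurable (fluctuationError m₀ ν R lam θ κ f Λ n) P := by
  refine AEStronglyMeasurable.congr (f := fun ω => scaledDeviation m₀ ν R θ κ f n ω -
        ∑ j, (n : ℂ) ^ (Complex.I * ((lam j).im : ℂ)) * Λ j ω) ?_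
    ((h.fluctuationError_ae hR f).mono fun ω hω => (hω n).symm)
  exact (h.integrable_scaledDeviation hR f n).aestronglyMeasurable.sub
    (Finset.aestronglyMeasurable_fun_sum _ fun j _ => (hΛ j).const_mul _)

/-- If the coefficients `z j` are such that `∑ n^{i Im λ_j} z j → 0` then all of them vanish. -/
theorem eq_zero_of_tendsto_sum_cpow_im (hinj : Function.Injective lam)
    (hre : ∀ j, (lam j).re = θ) (z : Fin p → ℂ)
    (hz : Tendsto (fun n : ℕ => ∑ j, (n : ℂ) ^ (Complex.I * ((lam j).im : ℂ)) * z j) atTop (𝓝 0))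
    (j : Fin p) : z j = 0 := by
  refine eq_zero_of_tendsto_sum_cpow Finset.univ (fun j => (lam j).im) (fun i _ j _ hij => ?_) z hz
    j (Finset.mem_univ j)
  exact hinj (Complex.ext (by rw [hre, hre]) hij)

/-- The factor `Γ(b) / Γ(b + λ) / (κ - 1)!`, the limit of the rescaled products
`∏ (1 + λ / (i + b))`. -/
def limitFactor (b : ℝ) (lam : ℂ) (κ : ℕ) : ℂ :=
  Complex.Gamma b / Complex.Gamma (b + lam) / (κ - 1).factorial

theorem limitFactor_ne_zero {b : ℝ} (hb : 0 < b) {lam : ℂ} (hl : 0 < lam.re) (κ : ℕ) :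
    limitFactor b lam κ ≠ 0 := by
  refine div_ne_zero (div_ne_zero (Complex.Gamma_ne_zero_of_re_pos (by simpa))
    (Complex.Gamma_ne_zero_of_re_pos (by simp; linarith))) ?_
  exact_mod_cast (κ - 1).factorial_ne_zero

/-- `𝔼[Λ_j | 𝓕_k]` is a multiple of `𝔪_k g_j`, in integrated form. The coefficients of the
oscillations `n^{i Im λ_j}` in `𝔼[·; B]` of the rescaled deviation can be computed in two ways. -/
theorem StandingAssumptions.setIntegral_limit (h : StandingAssumptions W q ρ PR m₀ ν)
    (hR : IsMVPP P m₀ ρ PR Y R) {D : Submodule ℂ (BW W)} [CompleteSpace D]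
    (hDinv : ∀ f ∈ D, meanOp h.kernel h.moment f ∈ D) (hDone : BW.one W ∈ D)
    (hlarge : IsLargeCase ((meanOp h.kernel h.moment).restrict hDinv) lam θ κ) (f : D)
    (hΛ : IsFluctuationLimit P m₀ ν R lam θ κ (f : BW W) Λ) (k : ℕ) {B : Set Ω}
    (hB : MeasurableSet[history Y R k] B) (j : Fin p) :
    ∫ ω in B, Λ j ω ∂P = limitFactor (m₀.real Set.univ + k) (lam j) κ *
      ∫ x, ((((meanOp h.kernel h.moment).restrict hDinv - lam j • (1 : D →L[ℂ] D)) ^ (κ - 1))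
        (spectralProjection ((meanOp h.kernel h.moment).restrict hDinv) (lam j) f) : BW W) x
          ∂hR.meanUrn B k := by
  have hν := h.isProbabilityMeasure
  have hBm := hR.history_le k B hB
  have ha := hR.initial_mass_pos
  set a : ℝ := m₀.real Set.univ with ha_def
  set b : ℝ := a + k with hb_def
  have hb : 0 < b := by positivity
  set T := (meanOp h.kernel h.moment).restrict hDinv with hT
  have hWν : Integrable W ν :=
    W.integrable_of_rpow (by linarith [h.moment.two_lt]) h.integrable
  have hWB := h.integrable_weight_meanUrn_restrict hR B k
  set e : D := ⟨BW.one W, hDone⟩ with he_def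
  have he : T e = e := Subtype.ext (meanOp_one h.kernel h.moment h.balance)
  set φ : D →L[ℂ] ℂ := (BW.integralCLM hWν).comp D.subtypeL with hφ_def
  have hφ : ∀ v, φ (T v) = φ v := fun v =>
    integral_meanOp_of_invariant h.kernel h.moment hWν h.invariant v
  have hφe : φ e = 1 := by
    change ∫ x, BW.one W x ∂ν = 1
    simp
  have he0 : e ≠ 0 := by
    intro h0
    rw [h0, map_zero] at hφe
    exact zero_ne_one hφe
  set Φ : D →L[ℂ] ℂ := (BW.integralCLM hWB).comp D.subtypeL with hΦ_def
  have hΦe : Φ e = ((b * P.real B : ℝ) : ℂ) := by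
    change ∫ x, BW.one W x ∂hR.meanUrn B k = _
    simp only [BW.one_apply, integral_const]
    rw [h.meanUrn_real_univ hR B k]
    simp [hb_def, ha_def]
  set g : Fin p → D := fun j => ((T - lam j • (1 : D →L[ℂ] D)) ^ (κ - 1))
    (spectralProjection T (lam j) f) with hg_def
  have hc := hlarge.slqc.spectralProjection_one_apply he hφ hφe f
  have hmain := (Φ.continuous.tendsto 0).comp (hlarge.tendsto_stepProd he he0 hb hc k)
  rw [map_zero] at hmain
  set V : ℕ → ℂ := fun n => ((((n + k : ℕ) : ℝ) ^ θ *
      (Real.log ((n + k : ℕ) : ℝ)) ^ (κ - 1))⁻¹ : ℝ) *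
        (Φ (stepProd T (harmonicStep b) n f) -
          ((n : ℂ) + b) / b * (φ f * ((b * P.real B : ℝ) : ℂ))) with hV
  set S : ℕ → ℂ := fun n => ∑ j, (((n + k : ℕ) : ℂ) ^ (Complex.I * ((lam j).im : ℂ))) *
    (limitFactor b (lam j) κ * Φ (g j)) with hS
  have hVS : Tendsto (fun n => V n - S n) atTop (𝓝 0) := by
    refine hmain.congr fun n => ?_
    rw [Function.comp_apply, map_sub, ← Complex.coe_smul, map_smul, map_sub, map_smul, map_smul,
      hΦe, map_sum, prod_one_add_harmonicStep hb]
    simp only [map_smul, smul_eq_mul, hV, hS, limitFactor, hg_def]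
  set r : ℕ → ℝ := fun n => ((n + k : ℕ) : ℝ) / (((n + k : ℕ) : ℝ) + a) with hr
  have hr1 : Tendsto r atTop (𝓝 1) := by
    have h1 : Tendsto (fun n : ℕ => (n : ℝ) / ((n : ℝ) + a)) atTop (𝓝 1) :=
      tendsto_natCast_div_add_atTop a
    exact (tendsto_add_atTop_iff_nat (f := fun n : ℕ => (n : ℝ) / ((n : ℝ) + a)) k).2 h1
  have hSb : ∀ᶠ n : ℕ in atTop, ‖S n‖ ≤ ∑ j, ‖limitFactor b (lam j) κ * Φ (g j)‖ := by
    filter_upwards [eventually_gt_atTop 0] with n hn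
    refine (norm_sum_le _ _).trans (le_of_eq (Finset.sum_congr rfl fun j _ => ?_))
    rw [norm_mul, norm_natCast_cpow_I_mul (by omega), one_mul]
  have hrS : Tendsto (fun n => ((r n - 1 : ℝ) : ℂ) * S n) atTop (𝓝 0) := by
    have h1 : Tendsto (fun n => |r n - 1| * ∑ j, ‖limitFactor b (lam j) κ * Φ (g j)‖) atTop
        (𝓝 0) := by
      have := ((hr1.sub_const 1).abs).mul_const (∑ j, ‖limitFactor b (lam j) κ * Φ (g j)‖)
      simpa using this
    refine squeeze_zero_norm' (hSb.mono fun n hn => ?_) h1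
    rw [norm_mul, Complex.norm_real, Real.norm_eq_abs]
    exact mul_le_mul_of_nonneg_left hn (abs_nonneg _)
  have hΛi : ∀ j, Integrable (Λ j) P := fun j => (hΛ.memLp j).integrable one_le_two
  have hI : Tendsto (fun n => ∫ ω in B,
      fluctuationError m₀ ν R lam θ κ (f : BW W) Λ n ω ∂P) atTop (𝓝 0) := by
    have hZ : MemLp (B.indicator fun _ => (1 : ℂ)) 2 P := (memLp_const 1).indicator hBm
    refine (tendsto_integral_mul_of_eLpNorm hZ (fun n =>
      h.aestronglyMeasurable_fluctuationError hR (f : BW W)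
        (fun j => (hΛi j).aestronglyMeasurable) n) hΛ.tendsto_L2).congr fun n => ?_
    rw [← integral_indicator hBm]
    refine integral_congr_ae (Eventually.of_forall fun ω => ?_)
    by_cases hω : ω ∈ B <;> simp [hω]
  have hI' : ∀ n : ℕ, 0 < n → ∫ ω in B,
      fluctuationError m₀ ν R lam θ κ (f : BW W) Λ (n + k) ω ∂P = (r n : ℂ) * V n -
        ∑ j, (((n + k : ℕ) : ℂ) ^ (Complex.I * ((lam j).im : ℂ))) * ∫ ω in B, Λ j ω ∂P := by
    intro n hn
    rw [integral_congr_ae (ae_restrict_of_ae ((h.fluctuationError_ae hR (f : BW W)).mono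
      fun ω hω => hω (n + k))), integral_sub (h.integrable_scaledDeviation hR _ _).integrableOn
      (integrable_finsetSum _ fun j _ => ((hΛi j).integrableOn.const_mul _)),
      integral_finsetSum _ fun j _ => ((hΛi j).integrableOn.const_mul _)]
    simp only [MeasureTheory.integral_const_mul]
    congr 1
    have hXi : Integrable (fun ω => ∫ᵛ x, (f : BW W) x ∂<•(composition m₀ R (n + k) ω))
        (P.restrict B) := (h.integrable_integral_composition hR (n + k) (f : BW W)).integrableOn
    simp only [scaledDeviation]
    rw [MeasureTheory.integral_const_mul, integral_sub (hXi.div_const _) (integrable_const _),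
      integral_div, h.setIntegral_integral_composition hR B (n + k), add_comm n k,
      h.integral_meanUrn_add hR k hB n, integral_const, measureReal_restrict_apply_univ]
    have e1 : ∫ x, stepProd (meanOp h.kernel h.moment) (harmonicStep (m₀.real Set.univ + k)) n
        (f : BW W) x ∂hR.meanUrn B k = Φ (stepProd T (harmonicStep b) n f) := by
      change _ = ∫ x, (stepProd T (harmonicStep b) n f : BW W) x ∂hR.meanUrn B k
      rw [hT, coe_stepProd_restrict]
    rw [e1]
    change _ * (_ - P.real B • φ f) = _
    simp only [hV, hr]
    generalize Φ (stepProd T (harmonicStep b) n f) = F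
    rw [add_comm n k]
    have hN : (0 : ℝ) < ((k + n : ℕ) : ℝ) := by exact_mod_cast (by omega : 0 < k + n)
    have hbn : (n : ℂ) + b = ((((k + n : ℕ) : ℝ) + a : ℝ) : ℂ) := by
      rw [hb_def]; push_cast; ring
    rw [hbn, Real.rpow_sub hN, Real.rpow_one, mul_inv]
    have hNa : (((((k + n : ℕ) : ℝ) + a : ℝ)) : ℂ) ≠ 0 := by
      have : (((k + n : ℕ) : ℝ) + a) ≠ 0 := by positivity
      exact_mod_cast this
    have hbc : (b : ℂ) ≠ 0 := by exact_mod_cast hb.ne'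
    have hθ : (((((k + n : ℕ) : ℝ) ^ θ : ℝ)) : ℂ) ≠ 0 := by
      exact_mod_cast (Real.rpow_pos_of_pos hN θ).ne'
    rw [add_comm a, Complex.real_smul]
    generalize ((k + n : ℕ) : ℝ) + a = s at hNa ⊢
    generalize ((k + n : ℕ) : ℝ) ^ θ = t at hθ ⊢
    generalize Real.log ((k + n : ℕ) : ℝ) ^ (κ - 1) = l
    generalize ((k + n : ℕ) : ℝ) = N
    push_cast
    rw [div_eq_mul_inv _ (l : ℂ)]
    generalize ((l : ℂ))⁻¹ = l'
    field_simp
  have hfin : Tendsto (fun n : ℕ => ∑ j, (n : ℂ) ^ (Complex.I * ((lam j).im : ℂ)) *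
      (limitFactor b (lam j) κ * Φ (g j) - ∫ ω in B, Λ j ω ∂P)) atTop (𝓝 0) := by
    refine (tendsto_add_atTop_iff_nat k).1 ?_
    have h1 : Tendsto (fun n : ℕ => (r n : ℂ)) atTop (𝓝 ((1 : ℝ) : ℂ)) :=
      (Complex.continuous_ofReal.tendsto 1).comp hr1
    have h2 := (((tendsto_add_atTop_iff_nat k).2 hI).sub (h1.mul hVS)).sub hrS
    simp only [mul_zero, sub_zero] at h2
    refine h2.congr' ((eventually_gt_atTop 0).mono fun n hn => ?_)
    dsimp only
    rw [hI' n hn]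
    simp only [mul_sub, Finset.sum_sub_distrib]
    simp only [hS]
    push_cast
    ring
  have := eq_zero_of_tendsto_sum_cpow_im hlarge.injective hlarge.re_eq _ hfin j
  rw [sub_eq_zero] at this
  exact this.symm

end Limits

/-! ### Functions that do not charge the urn -/

section Vanishing

theorem measureReal_setOf_eq_of_ae_eq {α : Type*} [MeasurableSpace α] {μ : Measure α} {u : α → ℂ}
    {c : ℂ} (h : ∀ᵐ x ∂μ, u x = c) : μ.real {x | u x = c} = μ.real Set.univ := by
  refine measureReal_congr (h.mono fun x hx => ?_)
  exact propext ⟨fun _ => trivial, fun _ => hx⟩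

theorem measureReal_setOf_eq_of_ae_eq_of_ne {α : Type*} [MeasurableSpace α] {μ : Measure α}
    {u : α → ℂ} {c c' : ℂ} (h : ∀ᵐ x ∂μ, u x = c) (hc : c ≠ c') : μ.real {x | u x = c'} = 0 := by
  have h0 : μ {x | u x = c'} = 0 :=
    measure_mono_null (t := {x | ¬ u x = c})
      (fun x (hx : u x = c') (hx' : u x = c) => hc (hx'.symm.trans hx)) (ae_iff.1 h)
  rw [Measure.real, h0, ENNReal.toReal_zero]

variable {E Ω Ω' : Type*} [MeasurableSpace E] [MeasurableSpace Ω] [MeasurableSpace Ω']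
  {W : Weight E} {q : ℝ} {ρ : E → Ω' → SignedMeasure E} {PR : Measure Ω'}
  {m₀ ν : Measure E} [IsFiniteMeasure m₀] {P : Measure Ω} [IsProbabilityMeasure P]
  {Y : ℕ → Ω → E} {R : ℕ → Ω → SignedMeasure E}

theorem integral_norm_eq_zero_iff {μ : Measure E} (hW : Integrable W μ) (g : BW W) :
    ∫ x, ‖g x‖ ∂μ = 0 ↔ ∀ᵐ x ∂μ, g x = 0 := by
  rw [integral_eq_zero_iff_of_nonneg (fun x => norm_nonneg _) (g.integrable hW).norm]
  exact eventually_congr (Eventually.of_forall fun x => norm_eq_zero)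

theorem integral_abs_eq_zero_iff {μ : Measure E} (hW : Integrable W μ) (g : BW W) :
    ∫ x, g.abs x ∂μ = 0 ↔ ∀ᵐ x ∂μ, g x = 0 := by
  simp only [BW.abs_apply]
  rw [integral_complex_ofReal, Complex.ofReal_eq_zero, integral_norm_eq_zero_iff hW]

omit [IsProbabilityMeasure P] in
theorem IsMVPP.ae_meanUrn_iff (hR : IsMVPP P m₀ ρ PR Y R) (n : ℕ) (g : BW W) :
    (∀ᵐ x ∂hR.meanUrn Set.univ n, g x = 0) ↔ ∀ᵐ ω ∂P, ∀ᵐ x ∂hR.urnKernel n ω, g x = 0 := by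
  rw [IsMVPP.meanUrn, Measure.restrict_univ]
  exact ⟨Measure.ae_ae_of_ae_comp,
    Measure.ae_comp_of_ae_ae (g.measurable (measurableSet_singleton 0))⟩

theorem StandingAssumptions.composition_setOf_ne_zero_iff
    (h : StandingAssumptions W q ρ PR m₀ ν) (hR : IsMVPP P m₀ ρ PR Y R) (n : ℕ) (g : BW W) :
    (∀ᵐ ω ∂P, composition m₀ R n ω {x | ‖g x‖ ≠ 0} = 0) ↔
      ∀ᵐ x ∂hR.meanUrn Set.univ n, g x = 0 := by
  have hA : MeasurableSet {x | ‖g x‖ ≠ 0} :=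
    (g.measurable.norm (measurableSet_singleton 0)).compl
  rw [hR.ae_meanUrn_iff]
  refine eventually_congr ?_
  filter_upwards [h.urnKernel_real_ae hR hA] with ω hω
  rw [← hω n, measureReal_eq_zero_iff, ae_iff]
  simp only [ne_eq, norm_eq_zero]

theorem StandingAssumptions.integral_norm_composition_iff
    (h : StandingAssumptions W q ρ PR m₀ ν) (hR : IsMVPP P m₀ ρ PR Y R) (n : ℕ) (g : BW W) :
    (∀ᵐ ω ∂P, ∫ᵛ x, ‖g x‖ ∂<•(composition m₀ R n ω) = 0) ↔
      ∀ᵐ x ∂hR.meanUrn Set.univ n, g x = 0 := by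
  rw [hR.ae_meanUrn_iff]
  refine eventually_congr ?_
  filter_upwards [h.integral_composition_ae hR (F := ℝ), h.integrable_weight_urnKernel hR]
    with ω h1 h2
  rw [h1, integral_norm_eq_zero_iff (h2 n)]

theorem StandingAssumptions.integral_composition_eq_zero
    (h : StandingAssumptions W q ρ PR m₀ ν) (hR : IsMVPP P m₀ ρ PR Y R) (n : ℕ) (g : BW W)
    (hg : ∀ᵐ x ∂hR.meanUrn Set.univ n, g x = 0) :
    ∀ᵐ ω ∂P, ∫ᵛ x, g x ∂<•(composition m₀ R n ω) = 0 := by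
  rw [hR.ae_meanUrn_iff] at hg
  filter_upwards [hg, h.integral_composition_ae hR (F := ℂ)] with ω h1 h2
  rw [h2]
  exact integral_eq_zero_of_ae h1

omit [IsFiniteMeasure m₀] in
theorem StandingAssumptions.integrable_weight_initial (h : StandingAssumptions W q ρ PR m₀ ν) :
    Integrable W m₀ :=
  W.integrable_of_rpow (by linarith [h.moment.two_lt]) h.initial

omit [IsFiniteMeasure m₀] in
theorem StandingAssumptions.integrable_weight_invariant (h : StandingAssumptions W q ρ PR m₀ ν) :
    Integrable W ν :=
  W.integrable_of_rpow (by linarith [h.moment.two_lt]) h.integrable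

theorem harmonicStep_ne_zero {b : ℝ} (hb : 0 < b) (i : ℕ) : harmonicStep b i ≠ 0 := by
  have : ((i + b)⁻¹ : ℝ) ≠ 0 := by positivity
  exact Complex.ofReal_ne_zero.2 this

theorem StandingAssumptions.forall_ae_meanUrn_iff (h : StandingAssumptions W q ρ PR m₀ ν)
    (hR : IsMVPP P m₀ ρ PR Y R) (g : BW W) :
    (∀ n, ∀ᵐ x ∂hR.meanUrn Set.univ n, g x = 0) ↔
      ∀ n, ∫ x, ((meanOp h.kernel h.moment) ^ n) g.abs x ∂m₀ = 0 := by
  refine Iff.trans ?_ (forall_apply_stepProd_eq_zero_iff (T := meanOp h.kernel h.moment)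
    (φ := BW.integralCLM h.integrable_weight_initial)
    (harmonicStep_ne_zero hR.initial_mass_pos) g.abs)
  refine forall_congr' fun n => ?_
  rw [← integral_abs_eq_zero_iff (h.integrable_weight_meanUrn hR n), ← Nat.zero_add n,
    h.integral_meanUrn_add hR 0 MeasurableSet.univ, h.meanUrn_univ_zero hR, Nat.cast_zero,
    add_zero, Nat.zero_add]
  rfl

/-- The added measures are the increments of the composition, also for integrals. -/
theorem StandingAssumptions.integral_replacement (h : StandingAssumptions W q ρ PR m₀ ν)
    (hR : IsMVPP P m₀ ρ PR Y R) (g : BW W) :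
    ∀ᵐ ω ∂P, ∀ n, ∫ᵛ x, g x ∂<•(R n ω) = ∫ᵛ x, g x ∂<•(composition m₀ R (n + 1) ω) -
      ∫ᵛ x, g x ∂<•(composition m₀ R n ω) := by
  filter_upwards [h.composition_eq_urnKernel hR, h.integrable_weight_urnKernel hR] with ω h1 h2 n
  have hi : ∀ n, (composition m₀ R n ω).Integrable g := fun n => by
    rw [h1 n, VectorMeasure.Integrable, Measure.variation_toSignedMeasure]
    exact g.integrable (h2 n)
  rw [← VectorMeasure.integral_sub_vectorMeasure (hi _) (hi _), composition_succ,
    add_sub_cancel_left]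

theorem StandingAssumptions.forall_integral_composition_iff
    (h : StandingAssumptions W q ρ PR m₀ ν) (hR : IsMVPP P m₀ ρ PR Y R) (g : BW W) :
    (∀ n, ∀ᵐ ω ∂P, ∫ᵛ x, g x ∂<•(composition m₀ R n ω) = 0) ↔
      ∫ x, g x ∂m₀ = 0 ∧ ∀ n, ∀ᵐ ω ∂P, ∫ᵛ x, g x ∂<•(R n ω) = 0 := by
  have h0 : ∀ ω, ∫ᵛ x, g x ∂<•(composition m₀ R 0 ω) = ∫ x, g x ∂m₀ := fun ω => by
    rw [composition, Finset.range_zero, Finset.sum_empty, add_zero,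
      VectorMeasure.integral_toSignedMeasure]
  rw [← ae_all_iff, ← ae_all_iff]
  constructor
  · intro hX
    refine ⟨?_, ?_⟩
    · obtain ⟨ω, hω⟩ := hX.exists
      rw [← h0 ω, hω 0]
    · filter_upwards [hX, h.integral_replacement hR g] with ω h1 h2 n
      rw [h2, h1, h1, sub_zero]
  · rintro ⟨hm, hX⟩
    filter_upwards [hX, h.integral_replacement hR g] with ω h1 h2 n
    induction n with
    | zero => rw [h0, hm]
    | succ n ih =>
      have h3 := h2 n
      rw [h1, ih, sub_zero] at h3
      exact h3.symm

/-- If `𝔪_k g` and `𝔪_{k+1} g` are deterministic, then so is the mean increment `𝐑_x g`, for almost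
every colour `x` that may be drawn. -/
theorem StandingAssumptions.meanOp_ae_eq_sub (h : StandingAssumptions W q ρ PR m₀ ν)
    (hR : IsMVPP P m₀ ρ PR Y R) (g : BW W) (k : ℕ) {b b' : ℂ}
    (hb : ∀ᵐ ω ∂P, ∫ᵛ x, g x ∂<•(composition m₀ R k ω) = b)
    (hb' : ∀ᵐ ω ∂P, ∫ᵛ x, g x ∂<•(composition m₀ R (k + 1) ω) = b') :
    ∀ᵐ x ∂hR.meanUrn Set.univ k, meanOp h.kernel h.moment g x = b' - b := by
  have ha := hR.initial_mass_pos
  have hY := hR.measurable_colour k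
  have hL : P.map (Y k) =
      ENNReal.ofReal (m₀.real Set.univ + k)⁻¹ • hR.meanUrn Set.univ k := by
    rw [← h.map_colour hR k MeasurableSet.univ, Measure.restrict_univ]
  have hWL : Integrable W (P.map (Y k)) := by
    have := h.integrable_weight_map_colour hR Set.univ k
    rwa [Measure.restrict_univ] at this
  have hc : ENNReal.ofReal (m₀.real Set.univ + k)⁻¹ ≠ 0 :=
    (ENNReal.ofReal_pos.2 (by positivity)).ne'
  rw [← Measure.ae_ennreal_smul_measure_iff hc, ← hL]
  have hprob : IsProbabilityMeasure (P.map (Y k)) :=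
    Measure.isProbabilityMeasure_map hY.aemeasurable
  have hi := BW.integrable hWL (meanOp h.kernel h.moment g)
  refine Integrable.ae_eq_of_forall_setIntegral_eq _ (fun _ => b' - b) hi (integrable_const _)
    fun A hA _ => ?_
  set B := Y k ⁻¹' A with hB
  have hBm : MeasurableSet[history Y R k ⊔ MeasurableSpace.comap (Y k) inferInstance] B :=
    le_sup_right (b := MeasurableSpace.comap (Y k) inferInstance) B ⟨A, hA, rfl⟩
  have h1 := h.integral_meanUrn_succ hR k hBm g
  rw [← h.setIntegral_integral_composition, ← h.setIntegral_integral_composition,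
    integral_congr_ae (ae_restrict_of_ae hb), integral_congr_ae (ae_restrict_of_ae hb'),
    ← Measure.restrict_map hY hA] at h1
  simp only [integral_const, measureReal_restrict_apply_univ] at h1 ⊢
  rw [map_measureReal_apply hY hA, smul_sub, h1]
  ring

/-- If `g` is an eigenfunction of `𝐑` for an eigenvalue other than `0` and all `𝔪_n g` vanish, then
`g` vanishes almost everywhere along the urn. -/
theorem StandingAssumptions.ae_meanUrn_eq_zero (h : StandingAssumptions W q ρ PR m₀ ν)
    (hR : IsMVPP P m₀ ρ PR Y R) {g : BW W} {z : ℂ} (hz0 : z ≠ 0)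
    (hg : meanOp h.kernel h.moment g = z • g)
    (hX : ∀ n, ∀ᵐ ω ∂P, ∫ᵛ x, g x ∂<•(composition m₀ R n ω) = 0) (n : ℕ) :
    ∀ᵐ x ∂hR.meanUrn Set.univ n, g x = 0 := by
  filter_upwards [h.meanOp_ae_eq_sub hR g n (hX n) (hX (n + 1))] with x hx
  rw [hg, BW.smul_apply, sub_zero] at hx
  exact (mul_eq_zero.1 hx).resolve_left hz0

/-- The mean mass removed from a set in one step is bounded. -/
theorem StandingAssumptions.exists_meanUrn_sub_le (h : StandingAssumptions W q ρ PR m₀ ν)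
    (hR : IsMVPP P m₀ ρ PR Y R) : ∃ C : ℝ, ∀ k A, MeasurableSet A →
      (hR.meanUrn Set.univ k).real A - C ≤ (hR.meanUrn Set.univ (k + 1)).real A := by
  obtain ⟨C, hC, hpos⟩ := exists_meanMeasure_ge h.kernel h.moment
  refine ⟨C, fun k A hA => ?_⟩
  obtain ⟨h4, h5⟩ := h.setIntegral_replacement hR k MeasurableSet.univ hA
  have h6 : -C ≤ ∫ ω in Set.univ, meanMeasure (ρ (Y k ω)) PR A ∂P := by
    rw [Measure.restrict_univ]
    by_cases hi : Integrable (fun ω => meanMeasure (ρ (Y k ω)) PR A) P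
    · have h7 : ∫ _, -C ∂P ≤ ∫ ω, meanMeasure (ρ (Y k ω)) PR A ∂P := by
        refine integral_mono (integrable_const _) hi fun ω => ?_
        have h8 := hpos (Y k ω) A hA
        have h9 : A.indicator (fun _ => C) (Y k ω) ≤ C :=
          Set.indicator_le_self' (fun _ _ => hC) _
        change -C ≤ _
        linarith
      simpa using h7
    · rw [integral_undef hi]
      linarith
  have h10 : (hR.meanUrn Set.univ (k + 1)).real A = (hR.meanUrn Set.univ k).real A +
      ∫ ω in Set.univ, R k ω A ∂P := by
    rw [h.meanUrn_real hR _ _ hA, h.meanUrn_real hR _ _ hA,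
      ← integral_add (h.integrable_composition hR k hA).integrableOn h4.integrableOn]
    simp [composition_succ]
  rw [h10, h5]
  linarith

/-- Let `g` be an eigenfunction of `𝐑` for an eigenvalue `z ∉ {0, 1}` such that all `𝔪_n g` are
deterministic. Then `g` is a constant `γ_n` almost everywhere for `𝔼 𝔪_n`. Had `γ_n` and `γ_{n+1}`
different values, the whole mass of `{g = γ_n}` would be lost in one step; but a replacement removes
only a bounded mass. Equal values are compatible with the balance of the urn only if they are `0`. -/
theorem StandingAssumptions.exists_eq_zero_of_deterministic
    (h : StandingAssumptions W q ρ PR m₀ ν) (hR : IsMVPP P m₀ ρ PR Y R) {g : BW W} {z : ℂ}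
    (hz0 : z ≠ 0) (hz1 : z ≠ 1) (hg : meanOp h.kernel h.moment g = z • g) {b : ℕ → ℂ}
    (hX : ∀ n, ∀ᵐ ω ∂P, ∫ᵛ x, g x ∂<•(composition m₀ R n ω) = b n) : ∃ n, b n = 0 := by
  obtain ⟨C, hpos⟩ := h.exists_meanUrn_sub_le hR
  obtain ⟨k, hk⟩ := exists_nat_gt C
  have ha := hR.initial_mass_pos
  set γ : ℕ → ℂ := fun n => (b (n + 1) - b n) / z with hγ
  have hgγ : ∀ n, ∀ᵐ x ∂hR.meanUrn Set.univ n, g x = γ n := fun n => by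
    filter_upwards [h.meanOp_ae_eq_sub hR g n (hX n) (hX (n + 1))] with x hx
    rw [hg, BW.smul_apply] at hx
    rw [hγ, eq_div_iff hz0, mul_comm]
    exact hx
  have hbγ : ∀ n : ℕ, b n = ((m₀.real Set.univ + n : ℝ) : ℂ) * γ n := fun n => by
    have h1 := h.setIntegral_integral_composition hR Set.univ n g
    rw [integral_congr_ae (hgγ n), integral_congr_ae (ae_restrict_of_ae (hX n))] at h1
    simp only [integral_const, measureReal_restrict_apply_univ, h.meanUrn_real_univ hR,
      probReal_univ, one_smul, mul_one, Complex.real_smul] at h1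
    exact h1
  by_cases hγk : γ k = γ (k + 1)
  · refine ⟨k, ?_⟩
    have h1 : b (k + 1) - b k = γ k := by
      rw [hbγ, hbγ, ← hγk]
      push_cast
      ring
    have h2 : b (k + 1) - b k = z * γ k := by
      rw [hγ]
      field_simp
    have h3 : (z - 1) * γ k = 0 := by
      rw [sub_mul, ← h2, h1, one_mul, sub_self]
    rw [hbγ, (mul_eq_zero.1 h3).resolve_left (sub_ne_zero.2 hz1), mul_zero]
  · exfalso
    have hAm : MeasurableSet {x | g x = γ k} := g.measurable (measurableSet_singleton _)
    have h1 := hpos k _ hAm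
    rw [measureReal_setOf_eq_of_ae_eq (hgγ k),
      measureReal_setOf_eq_of_ae_eq_of_ne (hgγ (k + 1)) (Ne.symm hγk),
      h.meanUrn_real_univ hR, probReal_univ (μ := P), mul_one] at h1
    linarith

omit [IsFiniteMeasure m₀] in
/-- If `𝐑` is spectrally-large quasi-compact and `g` does not charge the urn, then `g = 0` almost
everywhere for `ν`, since the mean compositions of the urn, normalised, converge to `ν`. -/
theorem StandingAssumptions.ae_invariant_eq_zero (h : StandingAssumptions W q ρ PR m₀ ν)
    (hm₀ : 0 < m₀.real Set.univ) (hT : IsSLQC (meanOp h.kernel h.moment)) (g : BW W)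
    (hg : ∀ n, ∫ x, ((meanOp h.kernel h.moment) ^ n) g.abs x ∂m₀ = 0) : ∀ᵐ x ∂ν, g x = 0 := by
  have hν := h.isProbabilityMeasure
  have hW := h.integrable_weight_invariant
  rw [← integral_abs_eq_zero_iff hW]
  have he := meanOp_one h.kernel h.moment h.balance
  have hφe : BW.integralCLM hW (BW.one W) = 1 := by simp
  have he0 : BW.one W ≠ 0 := by
    intro h0
    rw [h0, map_zero] at hφe
    exact zero_ne_one hφe
  have hproj := hT.spectralProjection_one_apply he (φ := BW.integralCLM hW)
    (fun v => integral_meanOp_of_invariant h.kernel h.moment hW h.invariant v) hφe g.abs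
  set φ₀ := BW.integralCLM h.integrable_weight_initial with hφ₀
  have h0 : ∀ n, φ₀ (stepProd (meanOp h.kernel h.moment) (harmonicStep 1) n g.abs) = 0 :=
    (forall_apply_stepProd_eq_zero_iff (harmonicStep_ne_zero one_pos) _).2 hg
  have hlim := (φ₀.continuous.tendsto 0).comp (hT.tendsto_stepProd he he0 one_pos hproj)
  rw [map_zero] at hlim
  have hφ₀e : φ₀ (BW.one W) = ((m₀.real Set.univ : ℝ) : ℂ) := by simp [hφ₀]
  set I := BW.integralCLM hW g.abs with hI
  have h2 : Tendsto (fun n : ℕ => -((1 + (n : ℂ)⁻¹) * (I * (m₀.real Set.univ : ℂ)))) atTop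
      (𝓝 (-((1 + 0) * (I * (m₀.real Set.univ : ℂ))))) :=
    ((tendsto_const_nhds.add tendsto_inv_atTop_nhds_zero_nat).mul_const _).neg
  have h3 : -((1 + 0) * (I * (m₀.real Set.univ : ℂ))) = 0 := by
    refine tendsto_nhds_unique h2 (hlim.congr' ((eventually_gt_atTop 0).mono fun n hn => ?_))
    have hn0 : (n : ℂ) ≠ 0 := by exact_mod_cast hn.ne'
    rw [Function.comp_apply, ← Complex.coe_smul, map_smul, map_sub, h0, map_smul, map_smul, hφ₀e,
      prod_one_add_harmonicStep one_pos]
    simp only [smul_eq_mul]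
    push_cast
    field_simp
    ring
  have hm : ((m₀.real Set.univ : ℝ) : ℂ) ≠ 0 := by exact_mod_cast hm₀.ne'
  have h4 : I = 0 := by simpa [hm] using h3
  exact h4

omit [IsFiniteMeasure m₀] in
/-- If `m₀` is absolutely continuous with respect to `ν`, then a function vanishing `ν`-almost
everywhere does not charge the urn: `𝐑 + C` is positive for some `C`, and by invariance of `ν` it
preserves the non-negative functions of vanishing `ν`-integral. -/
theorem StandingAssumptions.integral_pow_eq_zero (h : StandingAssumptions W q ρ PR m₀ ν)
    (hm₀ : m₀ ≪ ν) (g : BW W) (hg : ∀ᵐ x ∂ν, g x = 0) (n : ℕ) :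
    ∫ x, ((meanOp h.kernel h.moment) ^ n) g.abs x ∂m₀ = 0 := by
  have hν := h.isProbabilityMeasure
  have hW := h.integrable_weight_invariant
  obtain ⟨C, hC, hpos⟩ := exists_meanOp_add_nonneg h.kernel h.moment
  set T := meanOp h.kernel h.moment with hT
  set S := T + (C : ℂ) • (1 : BW W →L[ℂ] BW W) with hS
  have hnn : ∀ n, ∀ x, 0 ≤ ((S ^ n) g.abs x).re ∧ ((S ^ n) g.abs x).im = 0 := by
    intro n
    induction n with
    | zero => intro x; simp
    | succ n ih =>
      rw [pow_succ']
      exact hpos _ ih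
  have hint : ∀ n, ∫ x, (S ^ n) g.abs x ∂ν = 0 := by
    intro n
    induction n with
    | zero => exact (integral_abs_eq_zero_iff hW g).2 hg
    | succ n ih =>
      have h1 : BW.integralCLM hW (S ((S ^ n) g.abs)) =
          BW.integralCLM hW (T ((S ^ n) g.abs)) + C * BW.integralCLM hW ((S ^ n) g.abs) := by
        rw [← smul_eq_mul, ← map_smul, ← map_add]
        rfl
      rw [BW.integralCLM_apply, BW.integralCLM_apply, BW.integralCLM_apply,
        integral_meanOp_of_invariant h.kernel h.moment hW h.invariant, ih, mul_zero,
        add_zero] at h1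
      rw [pow_succ']
      exact h1
  have hae : ∀ n, ∀ᵐ x ∂ν, (S ^ n) g.abs x = 0 := fun n => by
    have e : ∀ x, (S ^ n) g.abs x = ((((S ^ n) g.abs x).re : ℝ) : ℂ) := fun x =>
      Complex.ext rfl ((hnn n x).2.trans (Complex.ofReal_im _).symm)
    have h1 := hint n
    rw [integral_congr_ae (Eventually.of_forall e), integral_complex_ofReal,
      Complex.ofReal_eq_zero, integral_eq_zero_iff_of_nonneg (fun x => (hnn n x).1)
        (BW.integrable hW _).re] at h1
    filter_upwards [h1] with x hx
    rw [e, show ((S ^ n) g.abs x).re = 0 from hx, Complex.ofReal_zero]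
  refine apply_pow_eq_zero_of_add_smul (φ := BW.integralCLM h.integrable_weight_initial)
    (C := (C : ℂ)) (fun n => ?_) n
  exact integral_eq_zero_of_ae (hm₀.ae_le (hae n))

/-- A fluctuation limit with vanishing conditional means is zero: it is orthogonal to the rescaled
deviations, hence to all the limits, in particular to itself. -/
theorem StandingAssumptions.limit_eq_zero {p : ℕ} {lam : Fin p → ℂ} {θ : ℝ} {κ : ℕ}
    {Λ : Fin p → Ω → ℂ} (h : StandingAssumptions W q ρ PR m₀ ν)
    (hR : IsMVPP P m₀ ρ PR Y R) (hinj : Function.Injective lam) (hre : ∀ j, (lam j).re = θ)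
    (f : BW W) (hΛ : IsFluctuationLimit P m₀ ν R lam θ κ f Λ) (j : Fin p)
    (hj : ∀ n B, MeasurableSet[history Y R n] B → ∫ ω in B, Λ j ω ∂P = 0) :
    ∀ᵐ ω ∂P, Λ j ω = 0 := by
  set Z : Ω → ℂ := fun ω => starRingEnd ℂ (Λ j ω) with hZdef
  have hZ : MemLp Z 2 P := (hΛ.memLp j).star
  have herrm := fun n => h.aestronglyMeasurable_fluctuationError (lam := lam) (θ := θ) (κ := κ)
    hR f (fun j => (hΛ.memLp j).1) n
  have hlim := tendsto_integral_mul_of_eLpNorm hZ herrm hΛ.tendsto_L2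
  have hZΛ : ∀ l, Integrable (fun ω => Z ω * Λ l ω) P := fun l => hZ.integrable_mul (hΛ.memLp l)
  have hfin : ∀ᶠ n in atTop, eLpNorm (fluctuationError m₀ ν R lam θ κ f Λ n) 2 P < ∞ :=
    hΛ.tendsto_L2.eventually (gt_mem_nhds ENNReal.zero_lt_top)
  have hZB : ∀ n B, MeasurableSet[history Y R n] B → ∫ ω in B, Z ω ∂P = 0 := fun n B hB => by
    rw [hZdef, integral_conj, hj n B hB, map_zero]
  have hsum : Tendsto (fun n : ℕ => ∑ l, (n : ℂ) ^ (Complex.I * ((lam l).im : ℂ)) *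
      (-∫ ω, Z ω * Λ l ω ∂P)) atTop (𝓝 0) := by
    refine hlim.congr' (hfin.mono fun n hn => ?_)
    have hZerr : Integrable (fun ω => Z ω * fluctuationError m₀ ν R lam θ κ f Λ n ω) P :=
      hZ.integrable_mul ⟨herrm n, hn⟩
    have hZs : Integrable (fun ω => ∑ l, (n : ℂ) ^ (Complex.I * ((lam l).im : ℂ)) *
        (Z ω * Λ l ω)) P := integrable_finsetSum _ fun l _ => (hZΛ l).const_mul _
    have e : ∀ᵐ ω ∂P, scaledDeviation m₀ ν R θ κ f n ω * Z ω =
        Z ω * fluctuationError m₀ ν R lam θ κ f Λ n ω +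
          ∑ l, (n : ℂ) ^ (Complex.I * ((lam l).im : ℂ)) * (Z ω * Λ l ω) := by
      filter_upwards [h.fluctuationError_ae (lam := lam) (θ := θ) (κ := κ) (Λ := Λ) hR f]
        with ω hω
      have e2 : ∑ l, (n : ℂ) ^ (Complex.I * ((lam l).im : ℂ)) * (Z ω * Λ l ω) =
          Z ω * ∑ l, (n : ℂ) ^ (Complex.I * ((lam l).im : ℂ)) * Λ l ω := by
        rw [Finset.mul_sum]
        exact Finset.sum_congr rfl fun l _ => by ring
      rw [hω n, e2]
      ring
    have h1 : ∫ ω, scaledDeviation m₀ ν R θ κ f n ω * Z ω ∂P = 0 :=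
      integral_mul_eq_zero_of_forall_setIntegral_eq_zero (hR.history_le n)
        (h.aestronglyMeasurable_scaledDeviation hR f n) (hZ.integrable one_le_two)
        ((hZerr.add hZs).congr (e.mono fun ω hω => hω.symm)) (hZB n)
    rw [integral_congr_ae e, integral_add hZerr hZs,
      integral_finsetSum _ fun l _ => (hZΛ l).const_mul _] at h1
    simp only [MeasureTheory.integral_const_mul] at h1
    rw [eq_neg_of_add_eq_zero_left h1, ← Finset.sum_neg_distrib]
    exact Finset.sum_congr rfl fun l _ => by ring
  have h2 := eq_zero_of_tendsto_sum_cpow_im hinj hre _ hsum j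
  rw [neg_eq_zero] at h2
  have e : ∀ ω, Z ω * Λ j ω = ((‖Λ j ω‖ ^ 2 : ℝ) : ℂ) := fun ω => by
    rw [hZdef, mul_comm, Complex.mul_conj']
    push_cast
    rfl
  rw [integral_congr_ae (Eventually.of_forall e), integral_complex_ofReal,
    Complex.ofReal_eq_zero, integral_eq_zero_iff_of_nonneg (fun ω => by positivity)
      (hΛ.memLp j).norm.integrable_sq] at h2
  filter_upwards [h2] with ω hω
  simpa using hω

end Vanishing

end MVPP

end

/-! ### The equivalences -/

theorem theorem2p16
    {E Ω Ω' : Type*} [MeasurableSpace E] [MeasurableSpace Ω] [MeasurableSpace Ω']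
    (W : Weight E) (q : ℝ) (ρ : E → Ω' → SignedMeasure E) (PR : Measure Ω')
    (m₀ ν : Measure E) [IsFiniteMeasure m₀]
    (h : StandingAssumptions W q ρ PR m₀ ν)
    (P : Measure Ω) [IsProbabilityMeasure P]
    (Y : ℕ → Ω → E) (R : ℕ → Ω → SignedMeasure E)
    (hR : IsMVPP P m₀ ρ PR Y R)
    (D : Submodule ℂ (BW W)) (hDclosed : IsClosed (D : Set (BW W)))
    (hDinv : ∀ f ∈ D, meanOp h.kernel h.moment f ∈ D) (hDone : BW.one W ∈ D)
    {p : ℕ} (lam : Fin p → ℂ) (θ : ℝ) (κ : ℕ)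
    (hlarge : IsLargeCase ((meanOp h.kernel h.moment).restrict hDinv) lam θ κ)
    (f : D) (Λ : Fin p → Ω → ℂ)
    (hΛ : IsFluctuationLimit P m₀ ν R lam θ κ (f : BW W) Λ)
    (j : Fin p) (g : D)
    (hg : g = (((meanOp h.kernel h.moment).restrict hDinv - lam j • (1 : D →L[ℂ] D)) ^ (κ - 1))
      (spectralProjection ((meanOp h.kernel h.moment).restrict hDinv) (lam j) f)) :
    [ ∃ c : ℂ, ∀ᵐ ω ∂P, Λ j ω = c,
      ∀ᵐ ω ∂P, Λ j ω = ∫ ω', Λ j ω' ∂P,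
      ∀ᵐ ω ∂P, Λ j ω = 0,
      ∀ n, ∀ᵐ ω ∂P, ∫ᵛ x, (g : BW W) x ∂<•(composition m₀ R n ω) = 0,
      ∫ x, (g : BW W) x ∂m₀ = 0 ∧ ∀ n, ∀ᵐ ω ∂P, ∫ᵛ x, (g : BW W) x ∂<•(R n ω) = 0,
      ∀ n, ∀ᵐ ω ∂P, ∫ᵛ x, ‖(g : BW W) x‖ ∂<•(composition m₀ R n ω) = 0,
      ∀ n, ∀ᵐ ω ∂P, composition m₀ R n ω {x | ‖(g : BW W) x‖ ≠ 0} = 0,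
      ∀ n, ∫ x, ((meanOp h.kernel h.moment) ^ n) (g : BW W).abs x ∂m₀ = 0 ].TFAE ∧
    (IsSLQC (meanOp h.kernel h.moment) →
      (∃ c : ℂ, ∀ᵐ ω ∂P, Λ j ω = c) → ∀ᵐ x ∂ν, (g : BW W) x = 0) ∧
    (m₀ ≪ ν → (∀ᵐ x ∂ν, (g : BW W) x = 0) → ∃ c : ℂ, ∀ᵐ ω ∂P, Λ j ω = c) := by
  have hD : CompleteSpace D := hDclosed.completeSpace_coe
  have hm₀ := hR.initial_mass_pos
  set T := (meanOp h.kernel h.moment).restrict hDinv with hT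
  have hre : 0 < (lam j).re := by
    rw [hlarge.re_eq]
    linarith [hlarge.half_lt]
  have hz0 : lam j ≠ 0 := fun h0 => by
    rw [h0, Complex.zero_re] at hre
    exact lt_irrefl 0 hre
  have hz1 : lam j ≠ 1 := fun h1 => by
    have h2 := hlarge.re_eq j
    rw [h1, Complex.one_re] at h2
    exact hlarge.lt_one.ne h2.symm
  have hTg : meanOp h.kernel h.moment (g : BW W) = lam j • (g : BW W) := by
    obtain ⟨hκ, hpow⟩ := hlarge.one_le_and_pow_mul_eq_zero j
    have h1 : (T - lam j • (1 : D →L[ℂ] D)) g = 0 := by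
      have h2 := DFunLike.congr_fun hpow f
      rw [← Nat.succ_pred_eq_of_pos hκ, pow_succ'] at h2
      rw [hg]
      exact h2
    have h3 : T g = lam j • g := sub_eq_zero.1 h1
    exact congrArg Subtype.val h3
  -- `𝔼[Λ_j; B]` in terms of `𝔼[𝔪_k g; B]`
  have hset : ∀ k B, MeasurableSet[history Y R k] B → ∫ ω in B, Λ j ω ∂P =
      limitFactor (m₀.real Set.univ + k) (lam j) κ *
        ∫ ω in B, ∫ᵛ x, (g : BW W) x ∂<•(composition m₀ R k ω) ∂P := fun k B hB => by
    rw [h.setIntegral_integral_composition hR, hg]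
    exact h.setIntegral_limit hR hDinv hDone hlarge f hΛ k hB j
  have hfac : ∀ k : ℕ, limitFactor (m₀.real Set.univ + k) (lam j) κ ≠ 0 := fun k =>
    limitFactor_ne_zero (by positivity) hre κ
  have hconst : ∀ c : ℂ, (∀ᵐ ω ∂P, Λ j ω = c) → ∀ k : ℕ, ∀ᵐ ω ∂P,
      ∫ᵛ x, (g : BW W) x ∂<•(composition m₀ R k ω) =
        (limitFactor (m₀.real Set.univ + k) (lam j) κ)⁻¹ * c := by
    intro c hc k
    refine ae_eq_const_of_forall_setIntegral_eq (hR.history_le k)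
      (h.integrable_integral_composition hR k _)
      (h.aestronglyMeasurable_integral_composition hR k _) fun B hB => ?_
    have h1 := hset k B hB
    rw [integral_congr_ae (ae_restrict_of_ae hc), integral_const, Complex.real_smul,
      measureReal_restrict_apply_univ] at h1
    rw [mul_assoc, mul_comm c, h1, inv_mul_cancel_left₀ (hfac k)]
  have h13 : (∃ c : ℂ, ∀ᵐ ω ∂P, Λ j ω = c) → ∀ᵐ ω ∂P, Λ j ω = 0 := by
    rintro ⟨c, hc⟩
    obtain ⟨k, hk⟩ := h.exists_eq_zero_of_deterministic hR hz0 hz1 hTg (hconst c hc)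
    have hc0 : c = 0 := (mul_eq_zero.1 hk).resolve_left (inv_ne_zero (hfac k))
    rwa [hc0] at hc
  have h34 : (∀ᵐ ω ∂P, Λ j ω = 0) →
      ∀ n, ∀ᵐ ω ∂P, ∫ᵛ x, (g : BW W) x ∂<•(composition m₀ R n ω) = 0 := fun h3 n => by
    simpa using hconst 0 h3 n
  have h43 : (∀ n, ∀ᵐ ω ∂P, ∫ᵛ x, (g : BW W) x ∂<•(composition m₀ R n ω) = 0) →
      ∀ᵐ ω ∂P, Λ j ω = 0 := fun h4 => by
    refine h.limit_eq_zero hR hlarge.injective hlarge.re_eq _ hΛ j fun n B hB => ?_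
    rw [hset n B hB, integral_congr_ae (ae_restrict_of_ae (h4 n)), integral_zero, mul_zero]
  have h4Z : (∀ n, ∀ᵐ ω ∂P, ∫ᵛ x, (g : BW W) x ∂<•(composition m₀ R n ω) = 0) ↔
      ∀ n, ∀ᵐ x ∂hR.meanUrn Set.univ n, (g : BW W) x = 0 :=
    ⟨h.ae_meanUrn_eq_zero hR hz0 hTg, fun h1 n => h.integral_composition_eq_zero hR n _ (h1 n)⟩
  have h6Z := forall_congr' fun n => h.integral_norm_composition_iff hR n (g : BW W)
  have h7Z := forall_congr' fun n => h.composition_setOf_ne_zero_iff hR n (g : BW W)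
  have h8Z := h.forall_ae_meanUrn_iff hR (g : BW W)
  refine ⟨?_, fun hS h1 => ?_, fun hac hg0 => ?_⟩
  · tfae_have 1 → 3 := h13
    tfae_have 3 → 2 := fun h3 => by
      rw [integral_congr_ae h3, integral_zero]
      exact h3
    tfae_have 2 → 1 := fun h2 => ⟨_, h2⟩
    tfae_have 3 → 4 := h34
    tfae_have 4 → 3 := h43
    tfae_have 4 ↔ 5 := h.forall_integral_composition_iff hR _
    tfae_have 4 ↔ 6 := h4Z.trans h6Z.symm
    tfae_have 6 ↔ 7 := h6Z.trans h7Z.symm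
    tfae_have 7 ↔ 8 := h7Z.trans h8Z
    tfae_finish
  · exact h.ae_invariant_eq_zero hm₀ hS _ (h8Z.1 (h4Z.1 (h34 (h13 h1))))
  · exact ⟨0, h43 (h4Z.2 (h8Z.2 (h.integral_pow_eq_zero hac _ hg0)))⟩
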